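/- Let $n\ge 0$ be an integer. A \emph{table} is a finite set $R$ of pairs of integers $(i,k)$ with $i,k\le n$. Think of $(i,k)$ as the cell in column $i$ and row $k$ of a grid whose columns are numbered $n,n-1,n-2,\dots$ from left to right and whose rows are numbered $n,n-1,n-2,\dots$ from top to bottom. In each cell one strand enters from the left and one from below. If $(i,k)\in R$ they cross there (left to right, bottom to top), otherwise they do not cross and the left one leaves through the top, the bottom one through the right side. A strand is labelled by the row $a\le n$ at whose left end it starts. $R$ is an \emph{rc-graph} if no two strands intersect twice and no two strands with nonpositive labels intersect. For an rc-graph $R$ and $1\le k\le n$, the rc-graph $R\leftarrow k$ is obtained as follows. Call $(i,j)\notin R$ an \emph{open space} if the strand entering it from the left has a positive label and the strand entering it from below has a nonpositive label. Put $k_1=k$, let $i_1$ be the smallest $i$ such that $(i,k_1)$ is open, and add $(i_1,k_1)$ to $R$. Whenever a cell $(i_j,k_j)$ has been added: if no two strands intersect twice, stop; otherwise the two strands crossing at $(i_j,k_j)$ also intersect at some other cell $(\ell_{j+1},k_{j+1})$ with $k_{j+1}>k_j$; remove this cell, then add $(i_{j+1},k_{j+1})$, where $i_{j+1}$ is the smallest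 $i>\ell_{j+1}$ such that $(i,k_{j+1})$ is open in the current table, and repeat. For a word $v=v_1\cdots v_m$ in the letters $1,\dots,n$ put $R\leftarrow v=(\cdots((R\leftarrow v_1)\leftarrow v_2)\cdots)\leftarrow v_m$. A \emph{Young tableau} is a filling of a Young diagram with numbers from $1,\dots,n$, weakly increasing from left to right in rows and strictly increasing from top to bottom in columns. Its word $v(Y)$ is obtained by reading each row from left to right, from the bottom row to the top row. Put $R\leftarrow Y=R\leftarrow v(Y)$, and for Young tableaux $Y_1,Y_2$ let $Y_1\leftarrow Y_2$ be the Young tableau obtained by inserting the letters of $v(Y_2)$ one by one into $Y_1$ by Schensted row insertion. Then for every rc-graph $R$ and all Young tableaux $Y_1,Y_2$, the insertions below are well defined (each has exactly one result, an rc-graph) and $$R\leftarrow(Y_1\leftarrow Y_2)=(R\leftarrow Y_1)\leftarrow Y_2 .$$ -/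

import Mathlib

/-! ### Tables of strands and rc-graphs

A table is a finite set `R` of cells `(i, k)` (column `i`, row `k`) with `i, k ≤ n`.  Columns are
numbered decreasingly from left to right (the leftmost one is `n`) and rows are numbered
decreasingly from top to bottom (the top one is `n`).  In a cell of `R` the two strands cross, in
any other cell they bend without crossing. -/

/-- The two sides through which strands enter a cell. -/
inductive EntrySide
  | left
  | bottom

/-- `StrandEnters n R a s i k`: in the table `R`, the strand labelled `a` (the one that starts at
the left end of row `a`) enters the cell `(i, k)` through the side `s`.
(`StrandEnters n R a .bottom i (n + 1)` says that the strand leaves the table in column `i`.) -/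
inductive StrandEnters (n : ℕ) (R : Finset (ℤ × ℤ)) (a : ℤ) : EntrySide → ℤ → ℤ → Prop
  | start : a ≤ n → StrandEnters n R a .left n a
  | crossRight {i k : ℤ} : StrandEnters n R a .left i k → (i, k) ∈ R →
      StrandEnters n R a .left (i - 1) k
  | bendUp {i k : ℤ} : StrandEnters n R a .left i k → (i, k) ∉ R →
      StrandEnters n R a .bottom i (k + 1)
  | crossUp {i k : ℤ} : StrandEnters n R a .bottom i k → k ≤ n → (i, k) ∈ R →
      StrandEnters n R a .bottom i (k + 1)
  | bendRight {i k : ℤ} : StrandEnters n R a .bottom i k → k ≤ n → (i, k) ∉ R →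
      StrandEnters n R a .left (i - 1) k

/-- The strands labelled `a` and `b` intersect at the cell `c`. -/
def StrandsCross (n : ℕ) (R : Finset (ℤ × ℤ)) (a b : ℤ) (c : ℤ × ℤ) : Prop :=
  c ∈ R ∧
    ((StrandEnters n R a .left c.1 c.2 ∧ StrandEnters n R b .bottom c.1 c.2) ∨
      (StrandEnters n R b .left c.1 c.2 ∧ StrandEnters n R a .bottom c.1 c.2))

/-- No two strands intersect twice. -/
def NoDoubleCrossing (n : ℕ) (R : Finset (ℤ × ℤ)) : Prop :=
  ∀ (a b : ℤ) (c d : ℤ × ℤ), StrandsCross n R a b c → StrandsCross n R a b d → c = d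

/-- rc-graphs, with the standing convention that no two strands with nonpositive labels
intersect. -/
@[ext]
structure RCGraph (n : ℕ) where
  cells : Finset (ℤ × ℤ)
  le_of_mem : ∀ c ∈ cells, c.1 ≤ n ∧ c.2 ≤ n
  noDoubleCrossing : NoDoubleCrossing n cells
  nonpos_not_cross : ∀ (a b : ℤ) (c : ℤ × ℤ), a ≤ 0 → b ≤ 0 → ¬ StrandsCross n cells a b c

/-! ### Insertion into rc-graphs -/

/-- `(i, k)` is an open space: the strands passing through it do not cross there, the upper left
one (going from left to top) has a positive label, and the lower right one (going from bottom to
right) has a nonpositive label. -/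
def IsOpenSpace (n : ℕ) (R : Finset (ℤ × ℤ)) (i k : ℤ) : Prop :=
  i ≤ n ∧ k ≤ n ∧ (i, k) ∉ R ∧
    ∃ a b : ℤ, 0 < a ∧ b ≤ 0 ∧ StrandEnters n R a .left i k ∧ StrandEnters n R b .bottom i k

/-- `InsertAt n D c U`: the insertion algorithm, when it is about to add the cell `c` to the
table `D`, stops with the table `U`.  After adding `c`, the algorithm stops if no two strands
intersect twice.  Otherwise it removes the intersection `d`, in a higher row, of the two strands
which cross at `c`, and goes on with the first open space to the left of `d` in its row. -/
inductive InsertAt (n : ℕ) : Finset (ℤ × ℤ) → ℤ × ℤ → Finset (ℤ × ℤ) → Prop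
  | done {D : Finset (ℤ × ℤ)} {c : ℤ × ℤ} :
      NoDoubleCrossing n (insert c D) → InsertAt n D c (insert c D)
  | step {D U : Finset (ℤ × ℤ)} {c d : ℤ × ℤ} {a b i : ℤ} :
      ¬ NoDoubleCrossing n (insert c D) →
      StrandsCross n (insert c D) a b c →
      StrandsCross n (insert c D) a b d →
      c.2 < d.2 →
      IsLeast {x : ℤ | d.1 < x ∧ IsOpenSpace n ((insert c D).erase d) x d.2} i →
      InsertAt n ((insert c D).erase d) (i, d.2) U →
      InsertAt n D c U

/-- `R.InsertLetter k U`: inserting the number `k` into `R` produces the rc-graph `U`. -/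
def RCGraph.InsertLetter {n : ℕ} (R : RCGraph n) (k : ℕ) (U : RCGraph n) : Prop :=
  ∃ i : ℤ, IsLeast {x : ℤ | IsOpenSpace n R.cells x k} i ∧ InsertAt n R.cells (i, (k : ℤ)) U.cells

/-- `R.InsertWord v U`: inserting the letters of `v` one by one into `R` produces `U`. -/
def RCGraph.InsertWord {n : ℕ} (R : RCGraph n) : List ℕ → RCGraph n → Prop
  | [], U => U = R
  | k :: v, U => ∃ S : RCGraph n, R.InsertLetter k S ∧ S.InsertWord v U

/-! ### Young tableaux -/

/-- Young tableaux (of any shape) filled with numbers `1, …, n`. -/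
structure YoungTableau (n : ℕ) where
  shape : YoungDiagram
  filling : SemistandardYoungTableau shape
  entry_mem : ∀ i j : ℕ, (i, j) ∈ shape → 1 ≤ filling i j ∧ filling i j ≤ n

/-- The rows of a tableau, from top to bottom. -/
def YoungTableau.rows {n : ℕ} (Y : YoungTableau n) : List (List ℕ) :=
  (List.range (Y.shape.colLen 0)).map fun i =>
    (List.range (Y.shape.rowLen i)).map fun j => Y.filling i j

/-- The word of a tableau: each row is read from left to right, from the bottom row to the top
one. -/
def YoungTableau.word {n : ℕ} (Y : YoungTableau n) : List ℕ :=
  Y.rows.reverse.flatten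

/-- Schensted row insertion of `x` into a tableau given by its rows: `x` replaces the leftmost
entry of the first row which is greater than `x`, and this entry is inserted in the same way into
the remaining rows; if there is no such entry, `x` is added at the end of the row. -/
def schenstedInsert : ℕ → List (List ℕ) → List (List ℕ)
  | x, [] => [[x]]
  | x, r :: rs =>
      if h : r.findIdx (fun y => decide (x < y)) < r.length then
        r.set (r.findIdx (fun y => decide (x < y))) x ::
          schenstedInsert (r[r.findIdx (fun y => decide (x < y))]) rs
      else
        (r ++ [x]) :: rs

/-- Row `s` may stand directly below row `r` in a tableau. -/
def RowBelow (r s : List ℕ) : Prop :=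
  s.length ≤ r.length ∧ ∀ j : ℕ, j < s.length → r.getD j 0 < s.getD j 0

/-- Nonempty weakly increasing rows with entries in `1, …, n`. -/
def IsTableauRow (n : ℕ) (r : List ℕ) : Prop :=
  r ≠ [] ∧ (∀ i j : ℕ, i ≤ j → j < r.length → r.getD i 0 ≤ r.getD j 0) ∧
    ∀ j : ℕ, j < r.length → 1 ≤ r.getD j 0 ∧ r.getD j 0 ≤ n

/-- `T` is the list of rows of a Young tableau with entries in `1, …, n`. -/
def IsTableauRows (n : ℕ) : List (List ℕ) → Prop
  | [] => True
  | r :: rs => IsTableauRow n r ∧ (∀ s ∈ rs.head?, RowBelow r s) ∧ IsTableauRows n rs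

theorem IsTableauRow.schensted_set {n x : ℕ} {r : List ℕ} (hr : IsTableauRow n r)
    (hx : 1 ≤ x ∧ x ≤ n) (p : ℕ) (hp : p < r.length) (hpx : x < r.getD p 0)
    (hlt : ∀ j < p, r.getD j 0 ≤ x) : IsTableauRow n (r.set p x) := by
  obtain ⟨h0, h1, h2⟩ := hr
  refine ⟨by simpa using h0, ?_, ?_⟩
  · intro i j hij hj
    have hj' : j < r.length := by simpa using hj
    have hi' : i < r.length := by omega
    have key := h1 i j hij hj'
    have k1 : i < p → r.getD i 0 ≤ x := hlt i
    have k2 : p ≤ j → r.getD p 0 ≤ r.getD j 0 := fun h => h1 p j h hj'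
    simp only [List.getD_eq_getElem?_getD, List.getElem?_set] at *
    split_ifs <;> simp_all <;> omega
  · intro j hj
    have hj' : j < r.length := by simpa using hj
    have key := h2 j hj'
    simp only [List.getD_eq_getElem?_getD, List.getElem?_set] at *
    split_ifs <;> simp_all

theorem IsTableauRow.schensted_append {n x : ℕ} {r : List ℕ} (hr : IsTableauRow n r)
    (hx : 1 ≤ x ∧ x ≤ n) (hlt : ∀ j < r.length, r.getD j 0 ≤ x) :
    IsTableauRow n (r ++ [x]) := by
  obtain ⟨h0, h1, h2⟩ := hr
  refine ⟨by simp, ?_, ?_⟩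
  · intro i j hij hj
    simp only [List.length_append, List.length_singleton] at hj
    rcases Nat.lt_or_ge j r.length with hj' | hj'
    · rw [List.getD_append _ _ _ _ hj', List.getD_append _ _ _ _ (by omega)]
      exact h1 i j hij hj'
    · obtain rfl : j = r.length := by omega
      rw [List.getD_append_right _ _ _ _ le_rfl]
      rcases Nat.lt_or_ge i r.length with hi' | hi'
      · rw [List.getD_append _ _ _ _ hi']
        simpa using hlt i hi'
      · obtain rfl : i = r.length := by omega
        rw [List.getD_append_right _ _ _ _ le_rfl]
  · intro j hj
    simp only [List.length_append, List.length_singleton] at hj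
    rcases Nat.lt_or_ge j r.length with hj' | hj'
    · rw [List.getD_append _ _ _ _ hj']
      exact h2 j hj'
    · obtain rfl : j = r.length := by omega
      rw [List.getD_append_right _ _ _ _ le_rfl]
      simpa using hx

theorem getD_findIdx_spec (x : ℕ) (r : List ℕ) :
    (∀ j < r.findIdx (fun y => decide (x < y)), r.getD j 0 ≤ x) ∧
      (∀ h : r.findIdx (fun y => decide (x < y)) < r.length,
        x < r[r.findIdx (fun y => decide (x < y))]) := by
  constructor
  · intro j hj
    have hl : j < r.length := hj.trans_le List.findIdx_le_length
    have := List.not_of_lt_findIdx hj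
    rw [List.getD_eq_getElem _ _ hl]
    simpa using this
  · intro h
    simpa using List.findIdx_getElem (w := h)

theorem RowBelow.append {r s : List ℕ} (h : RowBelow r s) (x : ℕ) : RowBelow (r ++ [x]) s := by
  refine ⟨by simpa using h.1.trans (Nat.le_succ _), fun j hj => ?_⟩
  rw [List.getD_append _ _ _ _ (hj.trans_le h.1)]
  exact h.2 j hj

/-- Row insertion preserves tableaux. -/
theorem IsTableauRows.schenstedInsert {n : ℕ} : ∀ (T : List (List ℕ)) (x : ℕ),
    IsTableauRows n T → 1 ≤ x ∧ x ≤ n → IsTableauRows n (schenstedInsert x T)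
  | [], x, _, hx => by
      refine ⟨⟨by simp, ?_, ?_⟩, by simp, trivial⟩
      · intro i j hij hj
        obtain rfl : j = 0 := by simpa using hj
        obtain rfl : i = 0 := by omega
        exact le_rfl
      · intro j hj
        obtain rfl : j = 0 := by simpa using hj
        simpa using hx
  | r :: rs, x, ⟨hr, hb, hrs⟩, hx => by
      obtain ⟨hlt, hgt⟩ := getD_findIdx_spec x r
      rw [_root_.schenstedInsert]
      split_ifs with h
      · have hgt' := hgt h
        generalize hp : r.findIdx (fun y => decide (x < y)) = p at *
        have hy : 1 ≤ r[p] ∧ r[p] ≤ n := by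
          have h2 := hr.2.2 p h
          rwa [List.getD_eq_getElem _ _ h] at h2
        refine ⟨hr.schensted_set hx p h (by rwa [List.getD_eq_getElem _ _ h]) hlt, ?_,
          IsTableauRows.schenstedInsert rs _ hrs hy⟩
        -- the bumped entry lands weakly to the left in the next row
        have hset : ∀ j, (r.set p x).getD j 0 ≤ r.getD j 0 := by
          intro j
          by_cases h1 : p = j
          · subst h1
            simpa [List.getD_eq_getElem?_getD, h] using hgt'.le
          · simp [List.getD_eq_getElem?_getD, h1]
        have hset' : ∀ j ≤ p, (r.set p x).getD j 0 < r[p] := by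
          intro j hj
          rcases hj.lt_or_eq with hj | rfl
          · exact (hset j).trans_lt ((hlt j hj).trans_lt hgt')
          · simpa [List.getD_eq_getElem?_getD, h] using hgt'
        cases rs with
        | nil =>
          simp only [_root_.schenstedInsert, List.head?_cons, Option.mem_some_iff, forall_eq']
          refine ⟨by simp; omega, fun j hj => ?_⟩
          obtain rfl : j = 0 := by simpa using hj
          simpa using hset' 0 (Nat.zero_le _)
        | cons s ss =>
          have hrb : RowBelow r s := hb s (by simp)
          obtain ⟨hlt2, hgt2⟩ := getD_findIdx_spec (r[p]) s
          have hqp : s.findIdx (fun y => decide (r[p] < y)) ≤ p := by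
            by_contra hc
            push Not at hc
            have h3 := hlt2 p hc
            have h4 := hrb.2 p (hc.trans_le List.findIdx_le_length)
            rw [List.getD_eq_getElem _ _ h] at h4
            omega
          rw [_root_.schenstedInsert]
          split_ifs with h5
          · simp only [List.head?_cons, Option.mem_some_iff, forall_eq']
            refine ⟨by simpa using hrb.1, fun j hj => ?_⟩
            have hj' : j < s.length := by simpa using hj
            by_cases hjq : s.findIdx (fun y => decide (r[p] < y)) = j
            · rw [hjq] at hqp ⊢
              have := hset' j hqp
              simpa [List.getD_eq_getElem?_getD, hj'] using this
            · have h6 := (hset j).trans_lt (hrb.2 j hj')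
              have h7 : (s.set (s.findIdx (fun y => decide (r[p] < y))) r[p]).getD j 0
                  = s.getD j 0 := by
                simp [List.getD_eq_getElem?_getD, hjq]
              rw [h7]; exact h6
          · simp only [List.head?_cons, Option.mem_some_iff, forall_eq']
            have h8 : s.length ≤ p := by omega
            refine ⟨by simp; omega, fun j hj => ?_⟩
            simp only [List.length_append, List.length_singleton] at hj
            rcases Nat.lt_or_ge j s.length with hj' | hj'
            · rw [List.getD_append _ _ _ _ hj']
              exact (hset j).trans_lt (hrb.2 j hj')
            · obtain rfl : j = s.length := by omega
              rw [List.getD_append_right _ _ _ _ le_rfl]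
              simpa using hset' _ h8
      · have hl : r.findIdx (fun y => decide (x < y)) = r.length :=
          le_antisymm List.findIdx_le_length (by omega)
        rw [hl] at hlt
        exact ⟨hr.schensted_append hx hlt, fun s hs => (hb s hs).append x, hrs⟩

theorem IsTableauRows.foldl {n : ℕ} (v : List ℕ) (hv : ∀ x ∈ v, 1 ≤ x ∧ x ≤ n) :
    ∀ T : List (List ℕ), IsTableauRows n T →
      IsTableauRows n (v.foldl (fun T x => _root_.schenstedInsert x T) T) := by
  induction v with
  | nil => exact fun T hT => hT
  | cons x v ih =>
    exact fun T hT => ih (fun y hy => hv y (by simp [hy])) _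
      (hT.schenstedInsert T x (hv x (by simp)))

theorem IsTableauRows.rowBelow {n : ℕ} : ∀ (T : List (List ℕ)), IsTableauRows n T → ∀ i : ℕ,
    RowBelow (T.getD i []) (T.getD (i + 1) [])
  | [], _, i => by simp [RowBelow]
  | [r], _, 0 => by simp [RowBelow]
  | r :: s :: rs, h, 0 => by simpa using h.2.1 s (by simp)
  | r :: rs, h, i + 1 => by simpa using IsTableauRows.rowBelow rs h.2.2 i

theorem IsTableauRows.rowBelow_of_lt {n : ℕ} {T : List (List ℕ)} (h : IsTableauRows n T)
    {i k : ℕ} (hik : i < k) : RowBelow (T.getD i []) (T.getD k []) := by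
  induction k, hik using Nat.le_induction with
  | base => exact h.rowBelow T i
  | succ k _ ih =>
    have h1 := h.rowBelow T k
    exact ⟨h1.1.trans ih.1, fun j hj => (ih.2 j (hj.trans_le h1.1)).trans (h1.2 j hj)⟩

theorem IsTableauRows.row {n : ℕ} : ∀ (T : List (List ℕ)), IsTableauRows n T → ∀ i < T.length,
    IsTableauRow n (T.getD i [])
  | r :: rs, h, 0, _ => by simpa using h.1
  | r :: rs, h, i + 1, hi => by
      simpa using IsTableauRows.row rs h.2.2 i (by simpa using hi)

theorem IsTableauRows.row_of_lt {n : ℕ} {T : List (List ℕ)} (h : IsTableauRows n T) {i j : ℕ}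
    (hj : j < (T.getD i []).length) : IsTableauRow n (T.getD i []) := by
  refine h.row T i (by_contra fun hi => ?_)
  rw [List.getD_eq_default _ _ (by omega)] at hj
  simp at hj

/-- The Young tableau with given rows. -/
def YoungTableau.ofRows {n : ℕ} (T : List (List ℕ)) (hT : IsTableauRows n T) :
    YoungTableau n where
  shape :=
    { cells := (Finset.range T.length).biUnion fun i =>
        (Finset.range (T.getD i []).length).image fun j => (i, j)
      isLowerSet := by
        rintro ⟨i, j⟩ ⟨i', j'⟩ hle hm
        obtain ⟨hi, hj⟩ : i' ≤ i ∧ j' ≤ j := hle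
        simp only [Finset.coe_biUnion, Finset.mem_coe, Finset.mem_range, Finset.coe_image,
          Set.mem_iUnion, Set.mem_image, Prod.mk.injEq, exists_prop] at hm ⊢
        obtain ⟨a, ha, b, hb, rfl, rfl⟩ := hm
        refine ⟨i', hi.trans_lt ha, j', ?_, rfl, rfl⟩
        rcases hi.lt_or_eq with h | rfl
        · exact hj.trans_lt (hb.trans_le (hT.rowBelow_of_lt h).1)
        · exact hj.trans_lt hb }
  filling :=
    { entry := fun i j => (T.getD i []).getD j 0
      row_weak' := by
        intro i j1 j2 h12 hm
        simp only [← YoungDiagram.mem_cells, Finset.mem_biUnion, Finset.mem_range,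
          Finset.mem_image, Prod.mk.injEq] at hm
        obtain ⟨a, ha, b, hb, rfl, rfl⟩ := hm
        exact (hT.row T a ha).2.1 j1 b h12.le hb
      col_strict' := by
        intro i1 i2 j h12 hm
        simp only [← YoungDiagram.mem_cells, Finset.mem_biUnion, Finset.mem_range,
          Finset.mem_image, Prod.mk.injEq] at hm
        obtain ⟨a, ha, b, hb, rfl, rfl⟩ := hm
        exact (hT.rowBelow_of_lt h12).2 b hb
      zeros' := by
        intro i j hm
        simp only [← YoungDiagram.mem_cells, Finset.mem_biUnion, Finset.mem_range,
          Finset.mem_image, Prod.mk.injEq] at hm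
        refine List.getD_eq_default _ _ (not_lt.1 fun hj => hm ?_)
        refine ⟨i, by_contra fun hi => ?_, j, hj, rfl, rfl⟩
        rw [List.getD_eq_default _ _ (by omega)] at hj
        simp at hj }
  entry_mem := by
    intro i j hm
    simp only [← YoungDiagram.mem_cells, Finset.mem_biUnion, Finset.mem_range,
      Finset.mem_image, Prod.mk.injEq] at hm
    obtain ⟨a, ha, b, hb, rfl, rfl⟩ := hm
    exact (hT.row T a ha).2.2 b hb


theorem isTableauRows_of_getD {n : ℕ} : ∀ T : List (List ℕ),
    (∀ i < T.length, IsTableauRow n (T.getD i [])) →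
    (∀ i, i + 1 < T.length → RowBelow (T.getD i []) (T.getD (i + 1) [])) → IsTableauRows n T
  | [], _, _ => trivial
  | r :: rs, h1, h2 => by
      refine ⟨by simpa using h1 0 (by simp), ?_, isTableauRows_of_getD rs ?_ ?_⟩
      · intro s hs
        cases rs with
        | nil => simp at hs
        | cons t ts =>
          have := h2 0 (by simp)
          simp_all
      · intro i hi
        simpa using h1 (i + 1) (by simpa using hi)
      · intro i hi
        simpa using h2 (i + 1) (by simpa using hi)

theorem YoungTableau.isTableauRows_rows {n : ℕ} (Y : YoungTableau n) :
    IsTableauRows n Y.rows := by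
  have hrow : ∀ i < Y.shape.colLen 0, Y.rows.getD i [] =
      (List.range (Y.shape.rowLen i)).map fun j => Y.filling i j := by
    intro i hi
    simp [YoungTableau.rows, List.getD_eq_getElem?_getD, hi]
  have hget : ∀ i j, j < Y.shape.rowLen i →
      ((List.range (Y.shape.rowLen i)).map fun j => Y.filling i j).getD j 0 = Y.filling i j := by
    intro i j hj
    simp [List.getD_eq_getElem?_getD, hj]
  have hlen : Y.rows.length = Y.shape.colLen 0 := by simp [YoungTableau.rows]
  refine isTableauRows_of_getD _ (fun i hi => ?_) (fun i hi => ?_)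
  · rw [hlen] at hi
    rw [hrow i hi]
    refine ⟨?_, ?_, ?_⟩
    · have : 0 < Y.shape.rowLen i := by
        rwa [← YoungDiagram.mem_iff_lt_rowLen, YoungDiagram.mem_iff_lt_colLen]
      simp; omega
    · intro j k hjk hk
      simp only [List.length_map, List.length_range] at hk
      rw [hget i j (hjk.trans_lt hk), hget i k hk]
      exact Y.filling.row_weak_of_le hjk (YoungDiagram.mem_iff_lt_rowLen.2 hk)
    · intro j hj
      simp only [List.length_map, List.length_range] at hj
      rw [hget i j hj]
      exact Y.entry_mem i j (YoungDiagram.mem_iff_lt_rowLen.2 hj)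
  · rw [hlen] at hi
    rw [hrow i (by omega), hrow (i + 1) hi]
    have hanti := Y.shape.rowLen_anti i (i + 1) (Nat.le_succ i)
    refine ⟨by simpa using hanti, fun j hj => ?_⟩
    simp only [List.length_map, List.length_range] at hj
    rw [hget i j (hj.trans_le hanti), hget (i + 1) j hj]
    exact Y.filling.col_strict (Nat.lt_succ_self i) (YoungDiagram.mem_iff_lt_rowLen.2 hj)

/-- The rows of `YoungTableau.ofRows T hT` are those of `T`. -/
theorem YoungTableau.rows_ofRows {n : ℕ} (T : List (List ℕ)) (hT : IsTableauRows n T) :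
    (YoungTableau.ofRows T hT).rows = T := by
  have hmem : ∀ i j, (i, j) ∈ (YoungTableau.ofRows T hT).shape ↔ j < (T.getD i []).length := by
    intro i j
    simp only [YoungTableau.ofRows, ← YoungDiagram.mem_cells, Finset.mem_biUnion,
      Finset.mem_range, Finset.mem_image, Prod.mk.injEq]
    constructor
    · rintro ⟨a, ha, b, hb, rfl, rfl⟩
      exact hb
    · intro hj
      refine ⟨i, by_contra fun hi => ?_, j, hj, rfl, rfl⟩
      rw [List.getD_eq_default _ _ (by omega)] at hj
      simp at hj
  have hrl : ∀ i, (YoungTableau.ofRows T hT).shape.rowLen i = (T.getD i []).length := by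
    intro i
    refine eq_of_forall_lt_iff fun j => ?_
    rw [← YoungDiagram.mem_iff_lt_rowLen, hmem]
  have hcl : (YoungTableau.ofRows T hT).shape.colLen 0 = T.length := by
    refine eq_of_forall_lt_iff fun i => ?_
    rw [← YoungDiagram.mem_iff_lt_colLen, hmem]
    constructor
    · intro hj
      by_contra hi
      rw [List.getD_eq_default _ _ (by omega)] at hj
      simp at hj
    · intro hi
      exact List.length_pos_of_ne_nil (hT.row T i hi).1
  have hent : ∀ i j, (YoungTableau.ofRows T hT).filling i j = (T.getD i []).getD j 0 :=
    fun _ _ => rfl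
  refine List.ext_getElem (by simp [YoungTableau.rows, hcl]) fun i h1 h2 => ?_
  simp only [YoungTableau.rows, List.getElem_map, List.getElem_range, hrl, hent,
    List.getD_eq_getElem T [] h2]
  refine List.ext_getElem (by simp) fun j h3 h4 => ?_
  simp [List.getD_eq_getElem?_getD, h4]

theorem YoungTableau.mem_word {n : ℕ} (Y : YoungTableau n) : ∀ x ∈ Y.word, 1 ≤ x ∧ x ≤ n := by
  intro x hx
  simp only [YoungTableau.word, YoungTableau.rows, List.mem_flatten, List.mem_reverse,
    List.mem_map, List.mem_range] at hx
  obtain ⟨_, ⟨i, -, rfl⟩, hx⟩ := hx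
  simp only [List.mem_map, List.mem_range] at hx
  obtain ⟨j, hj, rfl⟩ := hx
  exact Y.entry_mem i j (YoungDiagram.mem_iff_lt_rowLen.2 hj)

/-- The tableau `Y₁ ← Y₂`: the letters of the word of `Y₂` are inserted one by one into `Y₁` by
Schensted row insertion. -/
def YoungTableau.insertTableau {n : ℕ} (Y₁ Y₂ : YoungTableau n) : YoungTableau n :=
  YoungTableau.ofRows (Y₂.word.foldl (fun T x => schenstedInsert x T) Y₁.rows)
    (IsTableauRows.foldl Y₂.word Y₂.mem_word Y₁.rows Y₁.isTableauRows_rows)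

/-- `R.InsertTableau Y U`: the rc-graph `R ← Y`, that is `R ← word of Y`, is `U`. -/
def RCGraph.InsertTableau {n : ℕ} (R : RCGraph n) (Y : YoungTableau n) (U : RCGraph n) : Prop :=
  R.InsertWord Y.word U

/-! ### Rows of strands -/

/-! The heart of the matter is that Knuth equivalent words, inserted into an rc-graph, give the same
result (`KnuthEquiv.insertWord`). Schensted insertion of a letter replaces the word of a tableau
followed by this letter by a Knuth equivalent word (`KnuthEquiv.schenstedInsert`), so v(Y₁)v(Y₂) and
the word of Y₁ ← Y₂ are Knuth equivalent, and the theorem follows.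

To compare insertions, they are followed row by row. With positions counted from the left, the
labels entering a row from below form a sequence `u`, and the crossings `C` of the row turn it into
the sequence `rowTop` entering the next row. Being an rc-graph is a condition on single rows
(`IsRow`, `ReducedTable`): at each crossing the left label is positive and exceeds the lower one.
Adding a crossing at an open space exchanges two adjacent labels leaving the row, a positive `a` and
a nonpositive `b` to its right. The exchange `(a, b)` is handed to the next row. If `a` and `b` do
not cross there, it is a mere relabelling and leaves the row as it came. If they do, their crossing
is removed, which cancels the exchange, and the crossing added further left creates a new one. So
the insertion of k is a chain of exchanges, one for each row from row k on (`RowStep`,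
`insertAt_spec`, `InsertRows`).

The nonpositive labels of two successive exchanges keep their relative order from row to row
(`RowStep.asc`, `RowStep.desc`); this is the analogue of the row bumping lemma. For an elementary
Knuth relation with largest letter z, both sides agree below row z, and the triples of exchanges
entering row z are related by `KnuthRel.first` or `KnuthRel.last`. By `KnuthRel.rowSteps`, related
triples produce the same crossings in a row and leave it as related triples. Under `first`, the two
interchanged steps never interfere. Under `last` they may compete for the same cell, and then a
third relation `braid` (or `first`) comes out; `braid` in turn yields `braid` or `first`. Hence all
rows above agree as well. -/

open Classical in
/-- The label entering cell `p` of row `k` from the left, when `C` is the set of crossings of the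
row and `u` gives the labels entering the row from below. -/
noncomputable def rowLeft (k : ℤ) (C : Set ℕ) (u : ℕ → ℤ) : ℕ → ℤ
  | 0 => k
  | p + 1 => if p ∈ C then rowLeft k C u p else u p

open Classical in
/-- The label leaving cell `p` of row `k` through the top. -/
noncomputable def rowTop (k : ℤ) (C : Set ℕ) (u : ℕ → ℤ) (p : ℕ) : ℤ :=
  if p ∈ C then u p else rowLeft k C u p

section
variable {k : ℤ} {C C' : Set ℕ} {u u' : ℕ → ℤ} {p q r : ℕ}

theorem rowLeft_succ_mem (h : p ∈ C) : rowLeft k C u (p + 1) = rowLeft k C u p := by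
  simp [rowLeft, h]

theorem rowLeft_succ_notMem (h : p ∉ C) : rowLeft k C u (p + 1) = u p := by
  simp [rowLeft, h]

theorem rowTop_mem (h : p ∈ C) : rowTop k C u p = u p := by simp [rowTop, h]

theorem rowTop_notMem (h : p ∉ C) : rowTop k C u p = rowLeft k C u p := by simp [rowTop, h]

theorem rowLeft_congr (hC : ∀ s < p, s ∈ C ↔ s ∈ C') (hu : ∀ s < p, u s = u' s) :
    rowLeft k C u p = rowLeft k C' u' p := by
  induction p with
  | zero => rfl
  | succ p ih =>
    have h1 := ih (fun s hs => hC s (by omega)) (fun s hs => hu s (by omega))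
    have h2 := hC p (by omega)
    have h3 := hu p (by omega)
    by_cases h : p ∈ C
    · rw [rowLeft_succ_mem h, rowLeft_succ_mem (h2.1 h), h1]
    · rw [rowLeft_succ_notMem h, rowLeft_succ_notMem (fun h' => h (h2.2 h')), h3]

theorem rowLeft_congr_of_le (hpq : p ≤ q) (h : rowLeft k C u p = rowLeft k C' u' p)
    (hC : ∀ s, p ≤ s → s < q → (s ∈ C ↔ s ∈ C')) (hu : ∀ s, p ≤ s → s < q → u s = u' s) :
    rowLeft k C u q = rowLeft k C' u' q := by
  induction q, hpq using Nat.le_induction with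
  | base => exact h
  | succ q hq ih =>
    have h1 := ih (fun s h1 h2 => hC s h1 (by omega)) (fun s h1 h2 => hu s h1 (by omega))
    have h2 := hC q hq (by omega)
    have h3 := hu q hq (by omega)
    by_cases h : q ∈ C
    · rw [rowLeft_succ_mem h, rowLeft_succ_mem (h2.1 h), h1]
    · rw [rowLeft_succ_notMem h, rowLeft_succ_notMem (fun h' => h (h2.2 h')), h3]

theorem rowLeft_eq_or (p : ℕ) : rowLeft k C u p = k ∨ ∃ s < p, rowLeft k C u p = u s := by
  induction p with
  | zero => exact Or.inl rfl
  | succ p ih =>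
    by_cases h : p ∈ C
    · rw [rowLeft_succ_mem h]
      rcases ih with ih | ⟨s, hs, ih⟩
      · exact Or.inl ih
      · exact Or.inr ⟨s, by omega, ih⟩
    · exact Or.inr ⟨p, by omega, rowLeft_succ_notMem h⟩

/-- Strands do not depend on their names: relabelling commutes with passing through the row,
provided that the label `k` starting in the row is fixed. Exchanges travel upwards by this
principle. -/
theorem rowLeft_comp (f : ℤ → ℤ) (hf : f k = k) (p : ℕ) :
    rowLeft k C (fun s => f (u s)) p = f (rowLeft k C u p) := by
  induction p with
  | zero => exact hf.symm
  | succ p ih => by_cases h : p ∈ C <;> simp [rowLeft, h, ih]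

theorem rowTop_comp (f : ℤ → ℤ) (hf : f k = k) (p : ℕ) :
    rowTop k C (fun s => f (u s)) p = f (rowTop k C u p) := by
  by_cases h : p ∈ C <;> simp [rowTop, h, rowLeft_comp f hf]
end

/-- The labels `u` may enter row `k` from below: labels are distinct and less than `k`, the
nonpositive ones are in decreasing order, and all but finitely many are nonpositive. -/
structure IsState (k : ℤ) (u : ℕ → ℤ) : Prop where
  inj : Function.Injective u
  lt : ∀ p, u p < k
  anti : ∀ p q, p < q → u p ≤ 0 → u q ≤ 0 → u q < u p
  tail : ∃ N, ∀ p ≥ N, u p ≤ 0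

/-- `C` is the set of crossings of row `k` of a reduced table in which strands with nonpositive
labels do not cross. -/
structure IsRow (k : ℤ) (C : Set ℕ) (u : ℕ → ℤ) : Prop extends IsState k u where
  pos : 0 < k
  fin : C.Finite
  cross : ∀ p ∈ C, 0 < rowLeft k C u p ∧ u p < rowLeft k C u p

/-- A letter that has not entered the table yet (`none`), or a pair of labels which are to be
exchanged, the first one positive, the second one nonpositive. -/
abbrev Exchange := Option (ℤ × ℤ)

/-- Exchange two labels. -/
def Exchange.act : Exchange → (ℕ → ℤ) → ℕ → ℤ
  | none, u => u
  | some e, u => fun p => Equiv.swap e.1 e.2 (u p)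

/-- The exchange `e` increases the number of crossings by one. -/
def Exchange.Valid : Exchange → (ℕ → ℤ) → Prop
  | none, _ => True
  | some e, u => 0 < e.1 ∧ e.2 ≤ 0 ∧
      ∃ p q, p < q ∧ u p = e.1 ∧ u q = e.2 ∧ ∀ r, p < r → r < q → e.1 < u r

/-- `r` is the rightmost open space among the positions satisfying `P`. -/
def IsBlock (k : ℤ) (C : Set ℕ) (u : ℕ → ℤ) (P : ℕ → Prop) (r : ℕ) : Prop :=
  P r ∧ 0 < rowLeft k C u r ∧ ∀ s, r ≤ s → P s → s ∉ C ∧ u s ≤ 0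

/-- The effect on row `k` of an exchange `e` of the labels entering it from below: the new set of
crossings, and the exchange of the labels which leave the row through the top. -/
inductive RowStep (k : ℤ) (C : Set ℕ) (u : ℕ → ℤ) : Exchange → Set ℕ → ℤ × ℤ → Prop
  | pass {a b : ℤ} : (∀ p, u p = a → u (p + 1) = b → p ∉ C → p + 1 ∉ C) →
      RowStep k C u (some (a, b)) C (a, b)
  | bump {a b : ℤ} {p r : ℕ} : u p = a → u (p + 1) = b → p ∉ C → p + 1 ∈ C →
      IsBlock k (C \ {p + 1}) (Exchange.act (some (a, b)) u) (· < p + 1) r →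
      RowStep k C u (some (a, b)) (insert r (C \ {p + 1}))
        (rowLeft k (C \ {p + 1}) (Exchange.act (some (a, b)) u) r,
          Exchange.act (some (a, b)) u r)
  | start {r : ℕ} : IsBlock k C u (fun _ => True) r →
      RowStep k C u none (insert r C) (rowLeft k C u r, u r)

/-! ### Exchanges passing through one row. -/

section
variable {k : ℤ} {C C' : Set ℕ} {u u' : ℕ → ℤ} {p q r : ℕ} {a b : ℤ}

theorem act_left (h : u p = a) : Exchange.act (some (a, b)) u p = b := by
  simp [Exchange.act, h]

theorem act_right (h : u q = b) : Exchange.act (some (a, b)) u q = a := by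
  simp [Exchange.act, h]

theorem act_of_ne (h1 : u r ≠ a) (h2 : u r ≠ b) : Exchange.act (some (a, b)) u r = u r := by
  simp [Exchange.act, Equiv.swap_apply_of_ne_of_ne h1 h2]

theorem act_of_pos_ne (hu : Function.Injective u) (hp : u p = a) (hq : u q = b) (h1 : r ≠ p)
    (h2 : r ≠ q) : Exchange.act (some (a, b)) u r = u r :=
  act_of_ne (fun h => h1 (hu (h.trans hp.symm))) (fun h => h2 (hu (h.trans hq.symm)))

theorem IsRow.notMem (h : IsRow k C u) (hp : rowLeft k C u p ≤ 0) : p ∉ C :=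
  fun hm => by have := (h.cross p hm).1; omega

theorem IsRow.notMem_succ (h : IsRow k C u) (hp : p ∉ C) (hu : u p ≤ 0) : p + 1 ∉ C :=
  h.notMem (by rwa [rowLeft_succ_notMem hp])

theorem IsRow.prev (h : IsRow k C u) (hp : rowLeft k C u (p + 1) ≤ 0) : p ∉ C ∧ u p ≤ 0 := by
  by_cases hm : p ∈ C
  · have := (h.cross p hm).1
    rw [rowLeft_succ_mem hm] at hp
    omega
  · exact ⟨hm, by rwa [rowLeft_succ_notMem hm] at hp⟩

/-- Where a strand entering from below at `p` can travel to the right. -/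
theorem IsState.rowLeft_eq (h : IsState k u) {s : ℕ} (hs : rowLeft k C u s = u p) :
    p < s ∧ p ∉ C ∧ ∀ t, p < t → t < s → t ∈ C := by
  induction s with
  | zero => exact absurd (h.lt p) (by rw [← hs]; simp [rowLeft])
  | succ s ih =>
    by_cases hm : s ∈ C
    · rw [rowLeft_succ_mem hm] at hs
      obtain ⟨h1, h2, h3⟩ := ih hs
      refine ⟨by omega, h2, fun t h4 h5 => ?_⟩
      rcases Nat.lt_succ_iff_lt_or_eq.1 h5 with h6 | rfl
      · exact h3 t h4 h6
      · exact hm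
    · rw [rowLeft_succ_notMem hm] at hs
      obtain rfl := h.inj hs
      exact ⟨by omega, hm, fun t _ _ => by omega⟩

/-- Between the two strands of an exchange, the strands travelling to the right have labels at
least the positive one. -/
theorem IsRow.le_rowLeft (h : IsRow k C u) (hb : ∀ r, p < r → r < q → u p < u r) {s : ℕ}
    (h1 : p < s) (h2 : s ≤ q) : u p ≤ rowLeft k C u s := by
  induction s, h1 using Nat.le_induction with
  | base =>
    by_cases hm : p ∈ C
    · rw [rowLeft_succ_mem hm]; exact (h.cross p hm).2.le
    · rw [rowLeft_succ_notMem hm]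
  | succ s hs ih =>
    by_cases hm : s ∈ C
    · rw [rowLeft_succ_mem hm]; exact ih (by omega)
    · rw [rowLeft_succ_notMem hm]; exact (hb s hs (by omega)).le

/-- A strand between the two strands of an exchange which travels to the right with the positive
label crosses nothing, unless both strands cross. -/
theorem IsRow.rowLeft_ne (h : IsRow k C u) (hpq : p < q)
    (hb : ∀ r, p < r → r < q → u p < u r)
    (hact : p + 1 = q → p ∉ C → p + 1 ∉ C) {s : ℕ} (hs : rowLeft k C u s = u p) :
    s = p + 1 ∧ p ∉ C ∧ s ∉ C := by
  obtain ⟨h1, h2, h3⟩ := h.rowLeft_eq hs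
  -- The label `u p` enters cell `p + 1` from the left. If this cell is before `q`, the label from
  -- below is larger, which a crossing does not allow; the case `p + 1 = q` is covered by `hact`.
  have key : p + 1 ∉ C := by
    rcases Nat.lt_or_ge (p + 1) q with h4 | h4
    · intro hm
      have := (h.cross _ hm).2
      rw [rowLeft_succ_notMem h2] at this
      have := hb (p + 1) (by omega) h4
      omega
    · exact hact (by omega) h2
  rcases Nat.lt_or_ge (p + 1) s with h4 | h4
  · exact absurd (h3 _ (by omega) h4) key
  · obtain rfl : s = p + 1 := by omega
    exact ⟨rfl, h2, key⟩

/-- Among the nonpositive labels only `b` moves, from `q` to `p`, and it jumps over none of the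
others, because the labels in between are positive. -/
theorem IsState.act (h : IsState k u) (hk : 0 < k) {e : Exchange} (he : e.Valid u) :
    IsState k (e.act u) := by
  rcases e with _ | ⟨a, b⟩
  · exact h
  obtain ⟨ha, hb, p, q, hpq, hp, hq, hbet⟩ := he
  simp only at ha hb hp hq hbet
  refine ⟨fun s t hst => h.inj ((Equiv.swap a b).injective hst), fun s => ?_, ?_, ?_⟩
  · by_cases h1 : s = p
    · subst h1; rw [act_left hp]; omega
    by_cases h2 : s = q
    · subst h2; rw [act_right hq, ← hp]; exact h.lt p
    rw [act_of_pos_ne h.inj hp hq h1 h2]; exact h.lt s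
  · intro s t hst
    have hs : s ≠ p → s ≠ q → Exchange.act (some (a, b)) u s = u s :=
      act_of_pos_ne h.inj hp hq
    have ht : t ≠ p → t ≠ q → Exchange.act (some (a, b)) u t = u t :=
      act_of_pos_ne h.inj hp hq
    have hp' : Exchange.act (some (a, b)) u p = b := act_left hp
    have hq' : Exchange.act (some (a, b)) u q = a := act_right hq
    have := h.anti s t hst
    have := h.anti s q
    have := h.anti q t
    have := hbet t
    grind
  · obtain ⟨N, hN⟩ := h.tail
    refine ⟨max N (q + 1), fun s hs => ?_⟩
    rw [act_of_pos_ne h.inj hp hq (by omega) (by omega)]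
    exact hN s (by omega)

/-- The exchange is a relabelling here. The row stays reduced because `a` enters no crossing from
the left (`IsRow.rowLeft_ne`), and where `b` is crossed the left label is at least `a`, hence
greater than `a`. -/
theorem IsRow.act_of_pass (h : IsRow k C u) (he : Exchange.Valid (some (a, b)) u)
    (hpass : ∀ p, u p = a → u (p + 1) = b → p ∉ C → p + 1 ∉ C) :
    IsRow k C (Exchange.act (some (a, b)) u) ∧ Exchange.Valid (some (a, b)) (rowTop k C u) ∧
      rowTop k C (Exchange.act (some (a, b)) u) =
        Exchange.act (some (a, b)) (rowTop k C u) := by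
  have hst := h.toIsState.act h.pos he
  obtain ⟨ha, hb, p, q, hpq, hp, hq, hbet⟩ := he
  simp only at ha hb hp hq hbet
  have hak : a < k := hp ▸ h.lt p
  have hk := h.pos
  have hfix : Equiv.swap a b k = k := Equiv.swap_apply_of_ne_of_ne (by omega) (by omega)
  have hne : ∀ s, rowLeft k C u s = a → s = p + 1 ∧ p ∉ C ∧ s ∉ C := by
    intro s hs
    exact h.rowLeft_ne hpq (by rwa [hp]) (fun h1 h2 => hpass p hp (h1 ▸ hq) h2)
      (hs.trans hp.symm)
  have hle : ∀ s, p < s → s ≤ q → a ≤ rowLeft k C u s := by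
    intro s h1 h2
    have := h.le_rowLeft (p := p) (q := q) (by rwa [hp]) h1 h2
    rwa [hp] at this
  refine ⟨⟨hst, h.pos, h.fin, fun s hs => ?_⟩, ?_, funext fun s => rowTop_comp _ hfix s⟩
  · have hL : rowLeft k C (Exchange.act (some (a, b)) u) s =
        Equiv.swap a b (rowLeft k C u s) := rowLeft_comp _ hfix s
    obtain ⟨h1, h2⟩ := h.cross s hs
    have h3 : rowLeft k C u s ≠ a := fun h3 => (hne s h3).2.2 hs
    rw [hL, Equiv.swap_apply_of_ne_of_ne h3 (by omega)]
    refine ⟨h1, ?_⟩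
    by_cases h4 : u s = b
    · rw [act_right h4]
      obtain rfl : s = q := h.inj (h4.trans hq.symm)
      have := hle s hpq le_rfl
      omega
    · by_cases h5 : u s = a
      · rw [act_left h5]; omega
      · rw [act_of_ne h5 h4]; exact h2
  · classical
    -- A label that crosses leaves in the column where it entered. Either of the two labels, if it
    -- bends to the right, leaves through the next cell, which holds no crossing.
    refine ⟨ha, hb, if p ∈ C then p else p + 1, if q ∈ C then q else q + 1, ?_, ?_, ?_, ?_⟩
    · split_ifs with h1 h2 h2 <;> try omega
      have : p + 1 ≠ q := fun h3 => hpass p hp (h3 ▸ hq) h1 (h3 ▸ h2)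
      omega
    · split_ifs with h1
      · rw [rowTop_mem h1, hp]
      · have h2 : rowLeft k C u (p + 1) = a := by rw [rowLeft_succ_notMem h1, hp]
        rw [rowTop_notMem (hne _ h2).2.2, h2]
    · split_ifs with h1
      · rw [rowTop_mem h1, hq]
      · rw [rowTop_notMem (h.notMem_succ h1 (by omega)), rowLeft_succ_notMem h1, hq]
    · intro s h1 h2
      by_cases hs : s ∈ C
      · rw [rowTop_mem hs]
        refine hbet s (by split_ifs at h1 <;> omega) ?_
        split_ifs at h2 with h3
        · exact h2
        · exact lt_of_le_of_ne (by omega) (fun h4 => h3 (h4 ▸ hs))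
      · rw [rowTop_notMem hs]
        have h4 : p < s := by split_ifs at h1 <;> omega
        have h5 : s ≤ q := by split_ifs at h2 <;> omega
        refine lt_of_le_of_ne (hle s h4 h5) fun h6 => ?_
        obtain ⟨h7, h8, -⟩ := hne s h6.symm
        rw [if_neg h8] at h1
        omega

theorem rowLeft_insert :
    rowLeft k (insert r C) u (r + 1) = rowLeft k C u r := by
  rw [rowLeft_succ_mem (Set.mem_insert r C)]
  exact rowLeft_congr (fun s hs => by simp [hs.ne]) (fun _ _ => rfl)

theorem rowLeft_insert_of_le (h : p ≤ r) :
    rowLeft k (insert r C) u p = rowLeft k C u p :=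
  rowLeft_congr (fun s hs => by simp [(hs.trans_le h).ne]) (fun _ _ => rfl)

theorem rowLeft_insert_of_lt (hr : r + 1 ∉ C) (h : r + 1 < p) :
    rowLeft k (insert r C) u p = rowLeft k C u p := by
  refine rowLeft_congr_of_le (p := r + 2) h ?_ (fun s h1 h2 => ?_) (fun _ _ _ => rfl)
  · rw [rowLeft_succ_notMem hr, rowLeft_succ_notMem (by simpa using hr)]
  · have : s ≠ r := by omega
    simp [this]

/-! #### Adding a crossing at an open space -/

theorem rowTop_injective (h : IsRow k C u) : Function.Injective (rowTop k C u) := by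
  have hne : ∀ s t, s < t → rowTop k C u s ≠ rowTop k C u t := by
    intro s t hst heq
    by_cases h2 : t ∈ C
    · rw [rowTop_mem h2] at heq
      by_cases h1 : s ∈ C
      · rw [rowTop_mem h1] at heq; exact hst.ne (h.inj heq)
      · rw [rowTop_notMem h1] at heq
        have := (h.rowLeft_eq heq).1
        omega
    · rw [rowTop_notMem h2] at heq
      rcases rowLeft_eq_or (k := k) (C := C) (u := u) t with h3 | ⟨p, hp, h3⟩
      · by_cases h1 : s ∈ C
        · rw [rowTop_mem h1, h3] at heq; exact (h.lt s).ne heq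
        · have key : ∀ t, s < t → rowLeft k C u t ≠ k := by
            intro t ht
            induction t, ht using Nat.le_induction with
            | base => rw [rowLeft_succ_notMem h1]; exact (h.lt s).ne
            | succ t _ ih =>
              by_cases h5 : t ∈ C
              · rwa [rowLeft_succ_mem h5]
              · rw [rowLeft_succ_notMem h5]; exact (h.lt t).ne
          exact key t hst h3
      · obtain ⟨h4, h5, h6⟩ := h.rowLeft_eq h3
        by_cases h1 : s ∈ C
        · rw [rowTop_mem h1, h3] at heq
          exact h5 (h.inj heq ▸ h1)
        · rw [rowTop_notMem h1, h3] at heq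
          have := h.rowLeft_eq heq
          exact h1 (h6 s this.1 hst)
  intro s t heq
  rcases lt_trichotomy s t with h1 | h1 | h1
  · exact absurd heq (hne s t h1)
  · exact h1
  · exact absurd heq.symm (hne t s h1)

/-- The lower label is nonpositive and bends to the right, so cell `r + 1` holds no crossing and
lets it out through the top. Hence the two labels leave the row side by side, and the new crossing
exchanges them. -/
theorem IsRow.insert_open (h : IsRow k C u) (hr : r ∉ C) (hL : 0 < rowLeft k C u r)
    (hu : u r ≤ 0) :
    IsRow k (insert r C) u ∧
      Exchange.Valid (some (rowLeft k C u r, u r)) (rowTop k C u) ∧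
      rowTop k (insert r C) u =
        Exchange.act (some (rowLeft k C u r, u r)) (rowTop k C u) := by
  have hr1 : r + 1 ∉ C := h.notMem_succ hr hu
  have htr : rowTop k C u r = rowLeft k C u r := rowTop_notMem hr
  have htr1 : rowTop k C u (r + 1) = u r := by
    rw [rowTop_notMem hr1, rowLeft_succ_notMem hr]
  refine ⟨⟨h.toIsState, h.pos, h.fin.insert r, fun s hs => ?_⟩,
    ⟨hL, hu, r, r + 1, by omega, htr, htr1, fun s _ _ => by omega⟩, funext fun s => ?_⟩
  · rcases Set.mem_insert_iff.1 hs with rfl | hs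
    · rw [rowLeft_insert_of_le le_rfl]; exact ⟨hL, by omega⟩
    · rcases Nat.lt_or_ge (r + 1) s with h1 | h1
      · rw [rowLeft_insert_of_lt hr1 h1]; exact h.cross s hs
      · have : s ≠ r + 1 := fun h2 => hr1 (h2 ▸ hs)
        rw [rowLeft_insert_of_le (by omega)]; exact h.cross s hs
  · by_cases h1 : s = r
    · subst h1
      rw [act_left htr, rowTop_mem (Set.mem_insert _ _)]
    by_cases h2 : s = r + 1
    · subst h2
      rw [act_right htr1, rowTop_notMem (by simpa using hr1), rowLeft_insert]
    rw [act_of_pos_ne (rowTop_injective h) htr htr1 h1 h2]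
    have hL : rowLeft k (insert r C) u s = rowLeft k C u s := by
      rcases Nat.lt_or_ge (r + 1) s with h3 | h3
      · exact rowLeft_insert_of_lt hr1 h3
      · exact rowLeft_insert_of_le (by omega)
    by_cases hs : s ∈ C
    · rw [rowTop_mem hs, rowTop_mem (Set.mem_insert_of_mem r hs)]
    · rw [rowTop_notMem hs, rowTop_notMem (by simp [h1, hs]), hL]

/-! #### Removing a crossing -/

theorem rowLeft_erase_of_le (h : IsState k u) (hp : u p = a) (hq : u (p + 1) = b) {s : ℕ}
    (hs : s ≤ p) :
    rowLeft k (C \ {p + 1}) (Exchange.act (some (a, b)) u) s = rowLeft k C u s :=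
  rowLeft_congr (fun t ht => by simp; omega)
    (fun t ht => act_of_pos_ne h.inj hp hq (by omega) (by omega))

theorem rowLeft_erase_of_lt (h : IsState k u) (hp : u p = a) (hq : u (p + 1) = b) (hpC : p ∉ C)
    (hqC : p + 1 ∈ C) {s : ℕ} (hs : p + 1 < s) :
    rowLeft k (C \ {p + 1}) (Exchange.act (some (a, b)) u) s = rowLeft k C u s := by
  refine rowLeft_congr_of_le (p := p + 2) hs ?_ (fun t h1 h2 => ?_)
    (fun t h1 h2 => act_of_pos_ne h.inj hp hq (by omega) (by omega))
  · rw [rowLeft_succ_mem hqC, rowLeft_succ_notMem hpC, rowLeft_succ_notMem (by simp),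
      act_right hq, hp]
  · simp; omega

/-- Two strands that enter in exchanged positions and no longer cross continue as before: the
exchange and the removal cancel, and the rows above notice nothing. -/
theorem IsRow.erase (h : IsRow k C u) (ha : 0 < a) (hb : b ≤ 0) (hp : u p = a)
    (hq : u (p + 1) = b) (hpC : p ∉ C) (hqC : p + 1 ∈ C) :
    IsRow k (C \ {p + 1}) (Exchange.act (some (a, b)) u) ∧
      rowTop k (C \ {p + 1}) (Exchange.act (some (a, b)) u) = rowTop k C u := by
  refine ⟨⟨h.toIsState.act h.pos ⟨ha, hb, p, p + 1, by omega, hp, hq, fun s _ _ => by omega⟩,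
    h.pos, h.fin.subset Set.sdiff_subset, fun s hs => ?_⟩, funext fun s => ?_⟩
  · have h1 : s ≠ p := fun h1 => hpC (h1 ▸ hs.1)
    have h2 : s ≠ p + 1 := fun h2 => hs.2 h2
    rw [act_of_pos_ne h.inj hp hq h1 h2]
    rcases Nat.lt_or_ge s p with h3 | h3
    · rw [rowLeft_erase_of_le h.toIsState hp hq h3.le]; exact h.cross s hs.1
    · rw [rowLeft_erase_of_lt h.toIsState hp hq hpC hqC (by omega)]; exact h.cross s hs.1
  · by_cases h2 : s = p + 1
    · subst h2
      rw [rowTop_mem hqC, rowTop_notMem (by simp), rowLeft_succ_notMem (by simp [hpC]),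
        act_left hp, hq]
    have hL : rowLeft k (C \ {p + 1}) (Exchange.act (some (a, b)) u) s = rowLeft k C u s := by
      rcases Nat.lt_or_ge p s with h3 | h3
      · exact rowLeft_erase_of_lt h.toIsState hp hq hpC hqC (by omega)
      · exact rowLeft_erase_of_le h.toIsState hp hq h3
    by_cases hs : s ∈ C
    · rw [rowTop_mem hs, rowTop_mem (C := C \ {p + 1}) ⟨hs, h2⟩,
        act_of_pos_ne h.inj hp hq (fun h1 => hpC (h1 ▸ hs)) h2]
    · rw [rowTop_notMem hs, rowTop_notMem (fun h1 => hs h1.1), hL]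

/-! #### Blocks -/

/-- Search to the left from `p`. A nonpositive label on the left of a cell comes from a nonpositive
label that bends in the preceding cell, so the search goes on through empty cells until the left
label is positive. This happens at the latest in cell 0, where that label is `k`. -/
theorem IsRow.exists_isBlock (h : IsRow k C u) (hp : p ∉ C) (hu : u p ≤ 0) :
    ∃ r, IsBlock k C u (· < p + 1) r := by
  induction p with
  | zero =>
    exact ⟨0, Nat.zero_lt_one, h.pos, fun s _ hs => by obtain rfl : s = 0 := by omega
                                                       exact ⟨hp, hu⟩⟩
  | succ p ih =>
    rcases lt_or_ge 0 (rowLeft k C u (p + 1)) with h1 | h1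
    · refine ⟨p + 1, by omega, h1, fun s h2 h3 => ?_⟩
      obtain rfl : s = p + 1 := by omega
      exact ⟨hp, hu⟩
    · obtain ⟨h2, h3⟩ := h.prev h1
      obtain ⟨r, h4, h5, h6⟩ := ih h2 h3
      refine ⟨r, by omega, h5, fun s h7 h8 => ?_⟩
      rcases Nat.lt_succ_iff_lt_or_eq.1 h8 with h9 | rfl
      · exact h6 s h7 h9
      · exact ⟨hp, hu⟩

theorem IsRow.exists_isBlock_true (h : IsRow k C u) : ∃ r, IsBlock k C u (fun _ => True) r := by
  obtain ⟨N, hN⟩ := h.tail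
  obtain ⟨M, hM⟩ := h.fin.bddAbove
  have htail : ∀ s, max N (M + 1) ≤ s → s ∉ C ∧ u s ≤ 0 := fun s hs =>
    ⟨fun hm => by have := hM hm; omega, hN s (by omega)⟩
  obtain ⟨r, h1, h2, h3⟩ := h.exists_isBlock (htail _ le_rfl).1 (htail _ le_rfl).2
  refine ⟨r, trivial, h2, fun s h4 _ => ?_⟩
  rcases Nat.lt_or_ge s (max N (M + 1) + 1) with h5 | h5
  · exact h3 s h4 h5
  · exact htail s (by omega)

theorem IsBlock.unique {P : ℕ → Prop} (hP : ∀ s t, s ≤ t → P t → P s) {r' : ℕ}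
    (h1 : IsBlock k C u P r) (h2 : IsBlock k C u P r') : r = r' := by
  have key : ∀ r r', IsBlock k C u P r → IsBlock k C u P r' → ¬ r < r' := by
    rintro r r' ⟨-, -, h3⟩ ⟨h4, h5, -⟩ hlt
    obtain ⟨t, rfl⟩ : ∃ t, r' = t + 1 := ⟨r' - 1, by omega⟩
    obtain ⟨h6, h7⟩ := h3 t (by omega) (hP _ _ (by omega) h4)
    rw [rowLeft_succ_notMem h6] at h5
    omega
  have := key _ _ h1 h2
  have := key _ _ h2 h1
  omega

/-! #### Properties of row steps -/

theorem RowStep.unique (hu : Function.Injective u) {e : Exchange} {D D' : Set ℕ} {f f' : ℤ × ℤ}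
    (h1 : RowStep k C u e D f) (h2 : RowStep k C u e D' f') : D = D' ∧ f = f' := by
  cases h1 with
  | pass h1 =>
    cases h2 with
    | pass h2 => exact ⟨rfl, rfl⟩
    | bump h2 h3 h4 h5 h6 => exact absurd h5 (h1 _ h2 h3 h4)
  | bump h2 h3 h4 h5 h6 =>
    cases h2 with
    | pass h1 => exact absurd h5 (h1 _ h2 h3 h4)
    | bump h2' h3' h4' h5' h6' =>
      obtain rfl := hu (h2.trans h2'.symm)
      obtain rfl := h6.unique (fun s t h7 h8 => lt_of_le_of_lt h7 h8) h6'
      exact ⟨rfl, rfl⟩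
  | start h1 =>
    cases h2 with
    | start h2 =>
      obtain rfl := h1.unique (fun _ _ _ h => h) h2
      exact ⟨rfl, rfl⟩

/-- A bump is an `IsRow.erase`, which does not affect the labels above, followed by an
`IsRow.insert_open`, which exchanges two of them. -/
theorem RowStep.isRow {e : Exchange} {D : Set ℕ} {f : ℤ × ℤ} (hs : RowStep k C u e D f)
    (h : IsRow k C u) (he : e.Valid u) :
    IsRow k D (e.act u) ∧ Exchange.Valid (some f) (rowTop k C u) ∧
      rowTop k D (e.act u) = Exchange.act (some f) (rowTop k C u) := by
  cases hs with
  | pass h1 => exact h.act_of_pass he h1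
  | bump h2 h3 h4 h5 h6 =>
    obtain ⟨h7, h8⟩ := h.erase he.1 he.2.1 h2 h3 h4 h5
    obtain ⟨h9, h10⟩ := h6.2.2 _ le_rfl h6.1
    have := h7.insert_open h9 h6.2.1 h10
    rwa [h8] at this
  | start h1 =>
    obtain ⟨h9, h10⟩ := h1.2.2 _ le_rfl h1.1
    exact h.insert_open h9 h1.2.1 h10
end

/-! ### The order of two successive exchanges. -/

section
variable {k : ℤ} {C C' D : Set ℕ} {u u' : ℕ → ℤ} {p q r : ℕ} {a b : ℤ} {e : Exchange}
  {f : ℤ × ℤ}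

/-- A nonpositive label leaves in its own column if it crosses, and in the next one if it bends. Two
such labels could only collide, never overtake each other, and a collision would need a cell with
and without crossing. -/
theorem IsRow.isState_rowTop (h : IsRow k C u) : IsState (k + 1) (rowTop k C u) := by
  refine ⟨rowTop_injective h, fun p => ?_, ?_, ?_⟩
  · by_cases hp : p ∈ C
    · rw [rowTop_mem hp]; have := h.lt p; omega
    · rw [rowTop_notMem hp]
      rcases rowLeft_eq_or (k := k) (C := C) (u := u) p with h1 | ⟨s, -, h1⟩
      · omega
      · have := h.lt s; omega
  · have key : ∀ p, rowTop k C u p ≤ 0 → ∃ s, rowTop k C u p = u s ∧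
        (s = p ∧ p ∈ C ∨ s + 1 = p ∧ s ∉ C) := by
      intro p hp
      by_cases hm : p ∈ C
      · exact ⟨p, rowTop_mem hm, Or.inl ⟨rfl, hm⟩⟩
      · rw [rowTop_notMem hm] at hp ⊢
        cases p with
        | zero => exact absurd h.pos (by simpa [rowLeft] using hp)
        | succ p =>
          obtain ⟨h1, h2⟩ := h.prev hp
          exact ⟨p, rowLeft_succ_notMem h1, Or.inr ⟨rfl, h1⟩⟩
    intro p q hpq hp hq
    obtain ⟨s, h1, h2⟩ := key p hp
    obtain ⟨t, h3, h4⟩ := key q hq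
    rw [h1] at hp ⊢
    rw [h3] at hq ⊢
    refine h.anti s t ?_ hp hq
    rcases h2 with ⟨rfl, h2⟩ | ⟨h2, h2'⟩ <;> rcases h4 with ⟨rfl, h4⟩ | ⟨h4, h4'⟩ <;>
      try omega
    refine lt_of_le_of_ne (by omega) ?_
    rintro rfl
    exact h4' h2
  · obtain ⟨N, hN⟩ := h.tail
    obtain ⟨M, hM⟩ := h.fin.bddAbove
    refine ⟨max N (M + 1) + 1, fun p hp => ?_⟩
    obtain ⟨p, rfl⟩ : ∃ s, p = s + 1 := ⟨p - 1, by omega⟩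
    have hC : ∀ s > M, s ∉ C := fun s hs hm => by have := hM hm; omega
    rw [rowTop_notMem (hC _ (by omega)), rowLeft_succ_notMem (hC _ (by omega))]
    exact hN p (by omega)

/-- The nonpositive label of `e₂` belongs to a strand to the right of the one of `e₁`; letters that
have not entered yet count as farther and farther to the right. -/
def Exchange.Asc : Exchange → Exchange → Prop
  | _, none => True
  | none, some _ => False
  | some e, some f => f.2 < e.2

theorem IsState.lt_of_label_lt (h : IsState k u) (hp : u p ≤ 0) (hq : u q ≤ 0)
    (hlt : u q < u p) : p < q := by
  by_contra hc
  rcases Nat.lt_or_ge q p with h1 | h1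
  · have := h.anti q p h1 hq hp; omega
  · obtain rfl : p = q := by omega
    omega

theorem IsState.le_of_pos_le (h : IsState k u) (hp : u p ≤ 0) (hq : u q ≤ 0)
    (hle : p ≤ q) : u q ≤ u p := by
  rcases hle.lt_or_eq with h1 | rfl
  · exact (h.anti p q h1 hp hq).le
  · exact le_rfl

theorem RowStep.sign (hs : RowStep k C u e D f) (he : e.Valid u) : 0 < f.1 ∧ f.2 ≤ 0 := by
  cases hs with
  | pass h1 => exact ⟨he.1, he.2.1⟩
  | bump h2 h3 h4 h5 h6 => exact ⟨h6.2.1, (h6.2.2 _ le_rfl h6.1).2⟩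
  | start h1 => exact ⟨h1.2.1, (h1.2.2 _ le_rfl h1.1).2⟩

/-- The new crossing is not to the right of the cell where `b` enters after the exchange, and
nonpositive labels decrease to the right. -/
theorem RowStep.le_snd (h : IsRow k C u) (he : Exchange.Valid (some (a, b)) u)
    (hs : RowStep k C u (some (a, b)) D f) : b ≤ f.2 := by
  have hst := h.toIsState.act h.pos he
  have hs' := hs.sign he
  cases hs with
  | pass h1 => exact le_rfl
  | bump h2 h3 h4 h5 h6 =>
    have hb := act_left (b := b) h2
    have := hst.le_of_pos_le hs'.2 (by rw [hb]; exact he.2.1) (Nat.lt_succ_iff.1 h6.1)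
    rwa [hb] at this

/-- The first step leaves an obstacle: a new crossing, or, if it passes, the positive label now to
the right of `f₁.2`. The second step searches from the right through empty cells with nonpositive
labels, so it stops before passing the obstacle. -/
theorem RowStep.asc {e₁ e₂ : Exchange} {C₁ C₂ : Set ℕ} {f₁ f₂ : ℤ × ℤ} (h : IsRow k C u)
    (v₁ : e₁.Valid u) (v₂ : e₂.Valid (e₁.act u)) (s₁ : RowStep k C u e₁ C₁ f₁)
    (s₂ : RowStep k C₁ (e₁.act u) e₂ C₂ f₂) (hasc : e₁.Asc e₂) : f₂.2 < f₁.2 := by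
  have hr1 := (s₁.isRow h v₁).1
  have hst2 := hr1.toIsState.act h.pos v₂
  have hsg1 := s₁.sign v₁
  have hsg2 := s₂.sign v₂
  -- the new crossing in `C₁`, if any
  have hnew : e₁ = some f₁ ∧ C₁ = C ∨ ∃ r ∈ C₁, e₁.act u r = f₁.2 := by
    cases s₁ with
    | pass h1 => exact Or.inl ⟨rfl, rfl⟩
    | bump h2 h3 h4 h5 h6 => exact Or.inr ⟨_, Set.mem_insert _ _, rfl⟩
    | start h1 => exact Or.inr ⟨_, Set.mem_insert _ _, rfl⟩
  cases s₂ with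
  | pass h1 =>
    rcases e₁ with _ | ⟨a₁, b₁⟩
    · exact hasc.elim
    · exact lt_of_lt_of_le hasc (s₁.le_snd h v₁)
  | start h1 =>
    rename_i r₂
    obtain ⟨-, h3, h4⟩ := h1
    rcases hnew with ⟨rfl, rfl⟩ | ⟨r₁, h5, h6⟩
    · obtain ⟨f1, f2, p, q, hpq, hp, hq, hb⟩ := v₁
      have hp' : Exchange.act (some f₁) u p = f₁.2 := act_left hp
      have hq' : Exchange.act (some f₁) u q = f₁.1 := act_right hq
      have : p < r₂ := by
        by_contra hc
        have := (h4 q (by omega) trivial).2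
        omega
      have := hr1.anti p r₂ this (by omega) (h4 r₂ le_rfl trivial).2
      simp only at this ⊢
      omega
    · have : r₁ < r₂ := by
        by_contra hc
        exact (h4 r₁ (by omega) trivial).1 h5
      have := hr1.anti r₁ r₂ this (by omega) (h4 r₂ le_rfl trivial).2
      simp only at this ⊢
      omega
  | bump h2 h3 h4 h5 h6 =>
    rename_i a₂ b₂ p₂ r₂
    rcases e₁ with _ | ⟨a₁, b₁⟩
    · exact hasc.elim
    have hb₁ : b₁ ≤ f₁.2 := s₁.le_snd h v₁
    have hlt : b₂ < b₁ := hasc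
    have ha₂ : 0 < a₂ := v₂.1
    have hb₂ : b₂ ≤ 0 := v₂.2.1
    set w := Exchange.act (some (a₁, b₁)) u with hw
    have hne : ∀ s, s ≠ p₂ → s ≠ p₂ + 1 → Exchange.act (some (a₂, b₂)) w s = w s :=
      fun s => act_of_pos_ne hr1.inj h2 h3
    have hwp : Exchange.act (some (a₂, b₂)) w p₂ = b₂ := act_left h2
    obtain ⟨h7, -, h8⟩ := h6
    simp only at h7 h8 ⊢
    have h9 := h8 r₂ le_rfl h7
    rcases hnew with ⟨heq, rfl⟩ | ⟨r₁, h5', h6'⟩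
    · obtain ⟨f1, f2, p, q, hpq, hp, hq, hb⟩ := v₁
      simp only at f1 f2 hp hq hb
      obtain rfl : (a₁, b₁) = f₁ := Option.some.inj heq
      have hp' : w p = b₁ := act_left hp
      have hq' : w q = a₁ := act_right hq
      have hbet : ∀ s, p < s → s < q → a₁ < w s := by
        intro s hs1 hs2
        rw [hw, act_of_pos_ne h.inj hp hq (by omega) (by omega)]
        exact hb s hs1 hs2
      have h10 : p < p₂ + 1 := hr1.lt_of_label_lt (p := p) (q := p₂ + 1)
        (by rw [hp']; omega) (by rw [h3]; omega) (by rw [hp', h3]; omega)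
      have h11 : p ≠ p₂ := by rintro rfl; omega
      have hlt2 : p < r₂ := by
        by_contra hc
        rcases Nat.lt_or_ge p₂ q with h12 | h12
        · rcases Nat.lt_or_ge (p₂ + 1) q with h13 | h13
          · have := hbet (p₂ + 1) (by omega) h13
            omega
          · obtain rfl : q = p₂ + 1 := by omega
            omega
        · rcases h12.lt_or_eq with h13 | rfl
          · have := (h8 q (by omega) (by omega)).2
            rw [hne q (by omega) (by omega)] at this
            omega
          -- Here `q = p₂`: before the first exchange, the nonpositive `b₁` bent to the right in
          -- this cell, so the next cell cannot hold the crossing that the second step removes.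
          · exact h.notMem_succ h4 (by rw [hq]; exact f2) h5
      have hwp2 : Exchange.act (some (a₂, b₂)) w p = b₁ := by
        rw [hne p h11 (by omega), hp']
      have := hst2.anti p r₂ hlt2 (by rw [hwp2]; omega) h9.2
      rw [hwp2] at this
      exact this
    · have h10 : r₁ < p₂ + 1 := hr1.lt_of_label_lt (p := r₁) (q := p₂ + 1)
        (by rw [h6']; omega) (by rw [h3]; omega) (by rw [h6', h3]; omega)
      have h11 : r₁ ≠ p₂ := by rintro rfl; omega
      have hlt2 : r₁ < r₂ := by
        by_contra hc
        exact (h8 r₁ (by omega) h10).1 ⟨h5', by simp; omega⟩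
      have hwp2 : Exchange.act (some (a₂, b₂)) w r₁ = f₁.2 := by
        rw [hne r₁ h11 (by omega), h6']
      have := hst2.anti r₁ r₂ hlt2 (by rw [hwp2]; omega) h9.2
      rw [hwp2] at this
      exact this

/-- The cell just before the one where `b₂` enters receives a positive label, so the cells searched
by the first step, which receive nonpositive labels, end no further left than `b₂`. Hence `f₁.2 ≤
b₂`, and `RowStep.le_snd` gives the rest. If the first step passes, this is the hypothesis on the
order. -/
theorem RowStep.desc {e₁ e₂ : Exchange} {C₁ C₂ : Set ℕ} {f₁ f₂ : ℤ × ℤ} (h : IsRow k C u)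
    (v₁ : e₁.Valid u) (v₂ : e₂.Valid (e₁.act u)) (s₁ : RowStep k C u e₁ C₁ f₁)
    (s₂ : RowStep k C₁ (e₁.act u) e₂ C₂ f₂) (hasc : ¬ e₁.Asc e₂) : f₁.2 ≤ f₂.2 := by
  have hr1 := (s₁.isRow h v₁).1
  rcases e₂ with _ | ⟨a₂, b₂⟩
  · cases e₁ <;> exact absurd trivial hasc
  refine le_trans ?_ (s₂.le_snd hr1 v₂)
  have hsg1 := s₁.sign v₁
  obtain ⟨ha₂, hb₂, p₂, q₂, hpq, hp, hq, hb⟩ := v₂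
  simp only at ha₂ hb₂ hp hq hb
  -- The cell `q₂ - 1` is `p₂` itself or lies strictly between the exchanged positions.
  have hq2 : 0 < e₁.act u (q₂ - 1) := by
    rcases Nat.lt_or_ge p₂ (q₂ - 1) with h1 | h1
    · have := hb (q₂ - 1) h1 (by omega); omega
    · obtain h2 : q₂ - 1 = p₂ := by omega
      rw [h2, hp]; exact ha₂
  cases s₁ with
  | pass h1 => exact not_lt.1 hasc
  | bump h2 h3 h4 h5 h6 =>
    rename_i a₁ b₁ p₁ r₁
    have hle : b₁ ≤ b₂ := not_lt.1 hasc
    obtain ⟨h7, -, h8⟩ := h6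
    simp only at h7 h8 ⊢
    have hp1 : Exchange.act (some (a₁, b₁)) u p₁ = b₁ := act_left h2
    have hq1 : q₂ ≤ p₁ := by
      by_contra hc
      have := hr1.anti p₁ q₂ (by omega) (by omega) (by omega)
      omega
    rw [← hq]
    refine hr1.le_of_pos_le (by omega) (h8 _ le_rfl h7).2 ?_
    by_contra hc
    have := (h8 (q₂ - 1) (by omega) (by omega)).2
    omega
  | start h1 =>
    rename_i r₁
    rw [← hq]
    refine hr1.le_of_pos_le (by simp only [Exchange.act] at hq ⊢; omega)
      (h1.2.2 _ le_rfl trivial).2 ?_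
    by_contra hc
    have := (h1.2.2 (q₂ - 1) (by omega) trivial).2
    simp only [Exchange.act] at hq2
    omega

/-! #### Locality of row steps -/

/-- A row step changes only the cells up to the right one of the two exchanged strands. -/
theorem RowStep.exists_local_left (hst : IsState k u) (hpq : p < q) (hp : u p = a) (hq : u q = b)
    (hs : RowStep k C u (some (a, b)) D f) :
    ∃ A B : Set ℕ, (∀ s ∈ A ∪ B, s ≤ q) ∧ D = C \ A ∪ B ∧
      ∀ C' u', IsState k u' → (∀ s ≤ q, s ∈ C' ↔ s ∈ C) → (∀ s ≤ q, u' s = u s) →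
        RowStep k C' u' (some (a, b)) (C' \ A ∪ B) f := by
  cases hs with
  | pass h1 =>
    refine ⟨∅, ∅, by simp, by simp, fun C' u' hst' hC hu => ?_⟩
    have : C' \ ∅ ∪ ∅ = C' := by simp
    rw [this]
    refine .pass fun s h2 h3 h4 => ?_
    obtain rfl : s = p := hst'.inj (by rw [h2, hu p hpq.le, hp])
    obtain h5 : s + 1 = q := hst'.inj (by rw [h3, hu q le_rfl, hq])
    rw [hC _ h5.le]
    exact h1 s hp (by rw [h5, hq]) (by rwa [← hC s hpq.le])
  | bump h2 h3 h4 h5 h6 =>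
    rename_i p₁ r₁
    obtain rfl : p₁ = p := hst.inj (h2.trans hp.symm)
    obtain rfl : p₁ + 1 = q := hst.inj (h3.trans hq.symm)
    have hr := h6.1
    simp only at hr
    have hset : ∀ C : Set ℕ, insert r₁ (C \ {p₁ + 1}) = C \ {p₁ + 1} ∪ {r₁} := fun C => by
      ext; simp
    refine ⟨{p₁ + 1}, {r₁}, by simp; omega, hset C, fun C' u' hst' hC hu => ?_⟩
    have hu' : ∀ s ≤ p₁ + 1, Exchange.act (some (a, b)) u' s =
        Exchange.act (some (a, b)) u s := fun s hs => by simp [Exchange.act, hu s hs]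
    have hL : rowLeft k (C' \ {p₁ + 1}) (Exchange.act (some (a, b)) u') r₁ =
        rowLeft k (C \ {p₁ + 1}) (Exchange.act (some (a, b)) u) r₁ :=
      rowLeft_congr (fun s hs => by simp [hC s (by omega)]) (fun s hs => hu' s (by omega))
    rw [← hset, ← hL, ← hu' r₁ (by omega)]
    refine .bump (by rw [hu _ hpq.le, h2]) (by rw [hu _ le_rfl, h3])
      (by rwa [hC _ hpq.le]) (by rwa [hC _ le_rfl]) ⟨hr, by rw [hL]; exact h6.2.1, fun s h7 h8 => ?_⟩
    simp only at h8
    rw [hu' s (by omega), Set.mem_sdiff, hC s (by omega)]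
    exact h6.2.2 s h7 h8

/-- A row step whose new crossing is to the right of `q` depends only on what happens to the right
of `q`. -/
theorem RowStep.exists_local_right (h : IsRow k C u) {z : Exchange} (hz : z.Valid u)
    (hp : ∀ c d, z = some (c, d) → ∃ p' q', q < p' ∧ p' < q' ∧ u p' = c ∧ u q' = d)
    (hq : u q = b) (hb : b ≤ 0) (hfb : f.2 < b) (hs : RowStep k C u z D f) :
    ∃ A B : Set ℕ, (∀ s ∈ A ∪ B, q < s) ∧ D = C \ A ∪ B ∧
      ∀ C' u', IsState k u' → (∀ s > q, s ∈ C' ↔ s ∈ C) → (∀ s > q, u' s = u s) →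
        (∀ s > q, 0 < rowLeft k C u s → rowLeft k C' u' s = rowLeft k C u s) →
        RowStep k C' u' z (C' \ A ∪ B) f := by
  have hst := h.toIsState.act h.pos hz
  have hsg := hs.sign hz
  cases hs with
  | pass h1 =>
    rename_i c d
    refine ⟨∅, ∅, by simp, by simp, fun C' u' hst' hC hu hL => ?_⟩
    have : C' \ ∅ ∪ ∅ = C' := by simp
    rw [this]
    refine .pass fun s h2 h3 h4 => ?_
    obtain ⟨p', q', h5, h6, h7, h8⟩ := hp c d rfl
    obtain rfl : s = p' := hst'.inj (by rw [h2, hu p' h5, h7])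
    obtain h9 : s + 1 = q' := hst'.inj (by rw [h3, hu q' (by omega), h8])
    rw [hC _ (by omega)]
    exact h1 s h7 (by rw [h9, h8]) (by rwa [← hC s h5])
  | bump h2 h3 h4 h5 h6 =>
    rename_i c d p₁ r₁
    obtain ⟨p', q', h9, h10, h7, h8⟩ := hp c d rfl
    obtain rfl : p₁ = p' := h.inj (h2.trans h7.symm)
    have hr := h6.1
    simp only at hr
    have hqz : Exchange.act (some (c, d)) u q = b := by
      rw [act_of_pos_ne h.inj h2 h3 (by omega) (by omega), hq]
    have hqr : q < r₁ := hst.lt_of_label_lt (by omega) hsg.2 (by rw [hqz]; exact hfb)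
    have hset : ∀ C : Set ℕ, insert r₁ (C \ {p₁ + 1}) = C \ {p₁ + 1} ∪ {r₁} := fun C => by
      ext; simp
    refine ⟨{p₁ + 1}, {r₁}, by simp; omega, hset C, fun C' u' hst' hC hu hL => ?_⟩
    have hu' : ∀ s > q, Exchange.act (some (c, d)) u' s =
        Exchange.act (some (c, d)) u s := fun s hs => by simp [Exchange.act, hu s hs]
    -- The removed crossing is to the right of `r₁`, so it has no influence on the label entering
    -- `r₁` from the left.
    have hL0 := rowLeft_erase_of_le (C := C) h.toIsState h2 h3 (show r₁ ≤ p₁ by omega)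
    have hpos := h6.2.1
    rw [hL0] at hpos
    have hL1 : rowLeft k (C' \ {p₁ + 1}) (Exchange.act (some (c, d)) u') r₁ =
        rowLeft k (C \ {p₁ + 1}) (Exchange.act (some (c, d)) u) r₁ := by
      rw [hL0, ← hL r₁ hqr hpos]
      exact rowLeft_erase_of_le hst' (by rw [hu _ h9, h2]) (by rw [hu _ (by omega), h3])
        (by omega)
    rw [← hset, ← hL1, ← hu' r₁ hqr]
    refine .bump (by rw [hu _ h9, h2]) (by rw [hu _ (by omega), h3])
      (by rwa [hC _ h9]) (by rwa [hC _ (by omega)])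
      ⟨hr, by rw [hL1]; exact h6.2.1, fun s h7 h8 => ?_⟩
    rw [hu' s (by omega), Set.mem_sdiff, hC s (by omega)]
    exact h6.2.2 s h7 h8
  | start h1 =>
    rename_i r₁
    have hqr : q < r₁ := h.toIsState.lt_of_label_lt (by omega) hsg.2 (by rw [hq]; exact hfb)
    have hset : ∀ C : Set ℕ, insert r₁ C = C \ ∅ ∪ {r₁} := fun C => by ext; simp
    refine ⟨∅, {r₁}, by simpa using hqr, hset C, fun C' u' hst' hC hu hL => ?_⟩
    have hL1 := hL r₁ hqr h1.2.1
    rw [← hset, ← hL1, ← hu r₁ hqr]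
    refine .start ⟨trivial, by rw [hL1]; exact h1.2.1, fun s h7 h8 => ?_⟩
    rw [hu s (by omega), hC s (by omega)]
    exact h1.2.2 s h7 h8

/-- To the right of the exchanged strands, a row step does not change the positive labels. -/
theorem RowStep.rowLeft_right (h : IsRow k C u) (he : Exchange.Valid (some (a, b)) u)
    (hq : u q = b) (hs : RowStep k C u (some (a, b)) D f) {s : ℕ} (hqs : q < s)
    (hpos : 0 < rowLeft k C u s) :
    rowLeft k D (Exchange.act (some (a, b)) u) s = rowLeft k C u s := by
  have hrow := h.toIsState.act h.pos he
  cases hs with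
  | pass h1 =>
    obtain ⟨ha, hb, p, q', hpq, hp, hq', hbet⟩ := he
    simp only at ha hb hp hq' hbet
    obtain rfl : q' = q := h.inj (hq'.trans hq.symm)
    have hak : a < k := hp ▸ h.lt p
    have hfix : Equiv.swap a b k = k := Equiv.swap_apply_of_ne_of_ne (by omega) (by omega)
    have hL : rowLeft k C (Exchange.act (some (a, b)) u) s =
        Equiv.swap a b (rowLeft k C u s) := rowLeft_comp _ hfix s
    rw [hL, Equiv.swap_apply_of_ne_of_ne ?_ (by omega)]
    intro h2
    have := (h.rowLeft_ne hpq (by rwa [hp]) (fun h3 h4 => h1 p hp (h3 ▸ hq) h4)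
      (h2.trans hp.symm)).1
    omega
  | bump h2 h3 h4 h5 h6 =>
    rename_i p r
    obtain rfl : p + 1 = q := h.inj (h3.trans hq.symm)
    have hr := h6.1
    simp only at hr
    have herase := h.erase he.1 he.2.1 h2 h3 h4 h5
    obtain ⟨h7, h8⟩ := h6.2.2 r le_rfl hr
    rw [rowLeft_insert_of_lt (herase.1.notMem_succ h7 h8) (by omega),
      rowLeft_erase_of_lt h.toIsState h2 h3 h4 h5 hqs]

end

/-! ### Commuting row steps, and relations between three exchanges. -/

section
variable {k : ℤ} {C D : Set ℕ} {u : ℕ → ℤ} {p q r : ℕ} {a b : ℤ} {z : Exchange}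
  {f g : ℤ × ℤ}

theorem act_apply (s : ℕ) : Exchange.act (some (a, b)) u s =
    if u s = a then b else if u s = b then a else u s := Equiv.swap_apply_def a b (u s)

theorem act_comm {c d : ℤ} (h1 : a ≠ c) (h2 : b ≠ d) (h3 : a ≠ d) (h4 : c ≠ b) :
    Exchange.act (some (a, b)) (Exchange.act (some (c, d)) u) =
      Exchange.act (some (c, d)) (Exchange.act (some (a, b)) u) := by
  funext s
  simp only [act_apply]
  grind

/-- If two exchanges in ascending order may both be performed, then the first one happens entirely
to the left of the second one. -/
theorem IsState.positions (h : IsState k u) {c d : ℤ} (hx : Exchange.Valid (some (a, b)) u)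
    (hz : Exchange.Valid (some (c, d)) u) (hdb : d < b) (hp : u p = a) (hq : u q = b)
    (hpq : p < q) : ∃ p' q', q < p' ∧ p' < q' ∧ u p' = c ∧ u q' = d := by
  obtain ⟨ha, hb, p₁, q₁, -, hp₁, hq₁, hbet⟩ := hx
  obtain ⟨hc, hd, p', q', hpq', hp', hq', hbet'⟩ := hz
  simp only at ha hb hc hd hp₁ hq₁ hbet hp' hq' hbet'
  obtain rfl : p₁ = p := h.inj (hp₁.trans hp.symm)
  obtain rfl : q₁ = q := h.inj (hq₁.trans hq.symm)
  have h1 : q₁ < q' := h.lt_of_label_lt (by omega) (by omega) (by omega)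
  refine ⟨p', q', ?_, hpq', hp', hq'⟩
  by_contra hc
  rcases Nat.lt_or_ge p' q₁ with h2 | h2
  · have := hbet' q₁ h2 h1
    omega
  · obtain rfl : p' = q₁ := by omega
    omega

/-- By `IsState.positions`, the exchanges concern four different labels. -/
theorem IsState.act_comm_of_asc (h : IsState k u) (hx : Exchange.Valid (some (a, b)) u)
    (hz : z.Valid u) (hasc : Exchange.Asc (some (a, b)) z) :
    Exchange.act (some (a, b)) (z.act u) = z.act (Exchange.act (some (a, b)) u) := by
  rcases z with _ | ⟨c, d⟩
  · rfl
  have hdb : d < b := hasc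
  have hx' := hx
  obtain ⟨ha, hb, p, q, hpq, hp, hq, -⟩ := hx'
  obtain ⟨p', q', h1, h2, h3, h4⟩ := h.positions hx hz hdb hp hq hpq
  have h5 := hz.2.1
  have h6 := hz.1
  simp only at ha hb h5 h6 hp hq
  refine act_comm ?_ (by omega) (by omega) (by omega)
  rintro rfl
  have := h.inj (h3.trans hp.symm)
  omega

/-- Two row steps which do not meet commute. -/
theorem RowStep.commute (h : IsRow k C u) (hx : Exchange.Valid (some (a, b)) u)
    (hz : z.Valid u) (hasc : Exchange.Asc (some (a, b)) z) {Dx Dz : Set ℕ}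
    (sx : RowStep k C u (some (a, b)) Dx f) (sz : RowStep k C u z Dz g) (hg : g.2 < b) :
    ∃ D, RowStep k Dx (Exchange.act (some (a, b)) u) z D g ∧
      RowStep k Dz (z.act u) (some (a, b)) D f := by
  have hx' := hx
  obtain ⟨ha, hb, p, q, hpq, hp, hq, -⟩ := hx'
  simp only at ha hb hp hq
  have hpos : ∀ c d, z = some (c, d) → ∃ p' q', q < p' ∧ p' < q' ∧ u p' = c ∧ u q' = d := by
    rintro c d rfl
    exact h.positions hx hz hasc hp hq hpq
  obtain ⟨A, B, h1, rfl, h3⟩ := sx.exists_local_left h.toIsState hpq hp hq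
  obtain ⟨A', B', h4, rfl, h6⟩ := sz.exists_local_right h hz hpos hq hb hg
  have hzu : ∀ s ≤ q, z.act u s = u s := by
    intro s hs
    rcases z with _ | ⟨c, d⟩
    · rfl
    obtain ⟨p', q', h7, h8, h9, h10⟩ := hpos c d rfl
    exact act_of_pos_ne h.inj h9 h10 (by omega) (by omega)
  -- The two steps change cells on different sides of `q`, so their order does not matter.
  refine ⟨(C \ A ∪ B) \ A' ∪ B', h6 _ _ (h.toIsState.act h.pos hx) (fun s hs => ?_)
    (fun s hs => act_of_pos_ne h.inj hp hq (by omega) (by omega))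
    (fun s hs hL => sx.rowLeft_right h hx hq hs hL), ?_⟩
  · have h7 := h1 s
    simp only [Set.mem_union, Set.mem_sdiff] at h7 ⊢
    have h8 : ¬ s ≤ q := by omega
    tauto
  · have h7 := h3 (C \ A' ∪ B') (z.act u) (h.toIsState.act h.pos hz) (fun s hs => ?_) hzu
    · convert h7 using 1
      ext s
      have h8 := h1 s
      have h9 := h4 s
      simp only [Set.mem_union, Set.mem_sdiff] at h8 h9 ⊢
      have h10 : s ≤ q → ¬ q < s := by omega
      tauto
    · have h9 := h4 s
      simp only [Set.mem_union, Set.mem_sdiff] at h9 ⊢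
      have h10 : ¬ q < s := by omega
      tauto

/-- The row step of `z` fills the cell `q`, where the nonpositive label `u q` of the exchange
`(a, u q)` enters: `C₀` is the row before this cell is filled, and `P` gives the positions at which
the open space is looked for. After the exchange `(a, u q)` the step fills the cell `q + 1`. -/
structure RowStep.Meets (k : ℤ) (C : Set ℕ) (u : ℕ → ℤ) (a : ℤ) (q : ℕ) (z : Exchange)
    (D : Set ℕ) (g : ℤ × ℤ) (C₀ : Set ℕ) (P : ℕ → Prop) : Prop where
  down : ∀ s t, s ≤ t → P t → P s
  next : P (q + 1)
  block : ∀ s ≥ q, P s → s ∉ C₀ ∧ z.act u s ≤ 0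
  agree : ∀ s ≤ q + 1, s ∈ C₀ ↔ s ∈ C
  act_eq : ∀ s ≤ q, z.act u s = u s
  left : 0 < rowLeft k C u q
  eq_insert : D = insert q C₀
  fst_eq : g.1 = rowLeft k C u q
  snd_eq : g.2 = u q
  le_of : ∀ s c, z.act u s ≤ 0 → ¬ z.Asc (some (c, z.act u s)) → P s
  step : RowStep k C (Exchange.act (some (a, u q)) u) z (insert (q + 1) C₀)
    (a, z.act u (q + 1))

/-- The search of `z` for an open space cannot go past `q`, since cell `q - 1` receives a positive
label. So a new crossing of `z` is to the right of `q` or in `q`. In the latter case, if `(a, b)` is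
exchanged beforehand, the positive label `a` bends to the right in `q`, and the search already stops
at `q + 1`. -/
theorem RowStep.lt_or_meets (h : IsRow k C u) (hx : Exchange.Valid (some (a, b)) u)
    (hz : z.Valid u) (hasc : Exchange.Asc (some (a, b)) z) (hp : u p = a) (hq : u q = b)
    (hpq : p < q) (sz : RowStep k C u z D g) :
    g.2 < b ∨ ∃ C₀ P, RowStep.Meets k C u a q z D g C₀ P := by
  have ha : 0 < a := hx.1
  have hb : b ≤ 0 := hx.2.1
  have hqu : Exchange.act (some (a, u q)) u q = a := act_right rfl
  have hbet : ∀ s, p < s → s < q → a < u s := by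
    obtain ⟨-, -, p₁, q₁, -, hp₁, hq₁, hbet⟩ := hx
    obtain rfl : p₁ = p := h.inj (hp₁.trans hp.symm)
    obtain rfl : q₁ = q := h.inj (hq₁.trans hq.symm)
    exact hbet
  have hqk : a < k := hp ▸ h.lt p
  cases sz with
  | pass h1 => exact Or.inl hasc
  | bump h2 h3 h4 h5 h6 =>
    rename_i c d p₁ r
    obtain ⟨p', q', h9, h10, h7, h8⟩ := h.toIsState.positions hx hz hasc hp hq hpq
    obtain rfl : p₁ = p' := h.inj (h2.trans h7.symm)
    obtain ⟨h11, h12, h13⟩ := h6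
    simp only at h11 h13
    have hst := h.toIsState.act h.pos hz
    have hne : ∀ s, s ≠ p₁ → s ≠ p₁ + 1 → Exchange.act (some (c, d)) u s = u s := fun s =>
      act_of_pos_ne h.inj h2 h3
    have hqz := hne q (by omega) (by omega)
    by_cases hr : r = q
    · subst hr
      refine Or.inr ⟨C \ {p₁ + 1}, (· < p₁ + 1), fun s t h h' => lt_of_le_of_lt h h', by omega,
        h13, fun s hs => by simp; omega, fun s hs => hne s (by omega) (by omega), ?_, rfl,
        rowLeft_erase_of_le h.toIsState h2 h3 (by omega), hqz, ?_, ?_⟩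
      · rwa [rowLeft_erase_of_le h.toIsState h2 h3 (by omega)] at h12
      -- After the exchange `d` enters at `p₁`, and a nonpositive label which is not less than `d`
      -- cannot enter to the right of it.
      · intro s e hs hns
        by_contra hlt
        have h14 : Exchange.act (some (c, d)) u (p₁) = d := act_left h2
        have := hst.anti p₁ s (by omega) (by rw [h14]; exact hz.2.1) hs
        rw [h14] at this
        exact hns this
      · have hux := h.toIsState.act h.pos hx
        rw [← hq] at hux
        have e1 : Exchange.act (some (a, u r)) u p₁ = c := by
          rw [act_of_pos_ne h.inj hp rfl (by omega) (by omega), h2]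
        have e2 : Exchange.act (some (a, u r)) u (p₁ + 1) = d := by
          rw [act_of_pos_ne h.inj hp rfl (by omega) (by omega), h3]
        have hrC : r ∉ C := fun hm => (h13 r le_rfl h11).1 ⟨hm, by simp; omega⟩
        have e3 : rowLeft k (C \ {p₁ + 1})
            (Exchange.act (some (c, d)) (Exchange.act (some (a, u r)) u)) (r + 1) = a := by
          rw [rowLeft_erase_of_le hux e1 e2 (by omega), rowLeft_succ_notMem hrC, hqu]
        have e4 : ∀ s > r, Exchange.act (some (c, d)) (Exchange.act (some (a, u r)) u) s =
            Exchange.act (some (c, d)) u s := by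
          intro s hs
          have e5 : Exchange.act (some (a, u r)) u s = u s :=
            act_of_pos_ne h.inj hp rfl (by omega) (by omega)
          simp only [Exchange.act] at e5 ⊢
          rw [e5]
        have := RowStep.bump (k := k) (r := r + 1) e1 e2 h4 h5 ⟨by omega, by rw [e3]; exact ha,
          fun s hs hs' => ?_⟩
        · rwa [e3, e4 (r + 1) (by omega)] at this
        · rw [e4 s (by omega)]
          exact h13 s (by omega) hs'
    · refine Or.inl ?_
      have hrq : q < r := by
        by_contra hc
        have := (h13 (q - 1) (by omega) (by omega)).2
        rw [hne _ (by omega) (by omega)] at this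
        rcases Nat.lt_or_ge p (q - 1) with h14 | h14
        · have := hbet (q - 1) h14 (by omega); omega
        · rw [show q - 1 = p by omega] at this; omega
      have := hst.anti q r hrq (by rw [hqz]; omega) (h13 r le_rfl h11).2
      rwa [hqz, hq] at this
  | start h1 =>
    rename_i r
    obtain ⟨-, h12, h13⟩ := h1
    by_cases hr : r = q
    · subst hr
      refine Or.inr ⟨C, fun _ => True, fun _ _ _ h => h, trivial, h13, fun s hs => Iff.rfl,
        fun s _ => rfl, h12, rfl, rfl, rfl, fun _ _ _ _ => trivial, ?_⟩
      have e3 : rowLeft k C (Exchange.act (some (a, u r)) u) (r + 1) = a := by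
        rw [rowLeft_succ_notMem (h13 r le_rfl trivial).1, hqu]
      have e4 : ∀ s > r, Exchange.act (some (a, u r)) u s = u s := fun s hs =>
        act_of_pos_ne h.inj hp rfl (by omega) (by omega)
      have := RowStep.start (k := k) (C := C) (u := Exchange.act (some (a, u r)) u) (r := r + 1)
        ⟨trivial, by rw [e3]; exact ha, fun s hs _ => ?_⟩
      · rwa [e3, e4 (r + 1) (by omega)] at this
      · rw [e4 s (by omega)]
        exact h13 s (by omega) trivial
    · refine Or.inl ?_
      have hrq : q < r := by
        by_contra hc
        have := (h13 (q - 1) (by omega) trivial).2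
        rcases Nat.lt_or_ge p (q - 1) with h14 | h14
        · have := hbet (q - 1) h14 (by omega); omega
        · rw [show q - 1 = p by omega] at this; omega
      have := h.anti q r hrq (by omega) (h13 r le_rfl trivial).2
      rwa [hq] at this

/-- A row step passes if the right one of the two exchanged strands does not cross. -/
theorem RowStep.eq_of_notMem (h : IsState k u) (hq : u q = b) (hqC : q ∉ C)
    (hs : RowStep k C u (some (a, b)) D f) : D = C ∧ f = (a, b) :=
  hs.unique h.inj (.pass fun s _ h1 _ => by rwa [h.inj (h1.trans hq.symm)])

/-- A row step passes if the two strands are not adjacent. -/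
theorem RowStep.eq_of_ne (h : IsState k u) (hp : u p = a) (hq : u q = b) (hpq : p + 1 ≠ q)
    (hs : RowStep k C u (some (a, b)) D f) : D = C ∧ f = (a, b) :=
  hs.unique h.inj (.pass fun _ h1 h2 _ =>
    absurd (by rw [← h.inj (h1.trans hp.symm), h.inj (h2.trans hq.symm)]) hpq)

/-- A row step passes if the left one of the two exchanged strands crosses. -/
theorem RowStep.eq_of_mem (h : IsState k u) (hp : u p = a) (hpC : p ∈ C)
    (hs : RowStep k C u (some (a, b)) D f) : D = C ∧ f = (a, b) :=
  hs.unique h.inj (.pass fun _ h1 _ h2 => absurd hpC (h.inj (h1.trans hp.symm) ▸ h2))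

/-- The elementary relations between sequences of three exchanges. -/
inductive KnuthRel : Exchange → Exchange → Exchange → Exchange → Exchange → Exchange → Prop
  | first {x y z : Exchange} : ¬ y.Asc x → y.Asc z → KnuthRel y x z y z x
  | last {x y z : Exchange} : x.Asc y → ¬ z.Asc y → KnuthRel z x y x z y
  | braid {a b c d : ℤ} : d < b →
      KnuthRel (some (c, b)) (some (a, b)) (some (a, d)) (some (a, b)) (some (a, d)) (some (c, d))

theorem Exchange.exists_of_not_asc {e f : Exchange} (h : ¬ e.Asc f) : ∃ a b, f = some (a, b) := by
  rcases f with _ | ⟨a, b⟩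
  · cases e <;> exact absurd trivial h
  · exact ⟨a, b, rfl⟩

theorem Exchange.Asc.trans_not {x y z : Exchange} (h1 : ¬ y.Asc x) (h2 : y.Asc z) : x.Asc z := by
  rcases x with _ | ⟨a, b⟩
  · cases y <;> exact absurd trivial h1
  rcases z with _ | ⟨c, d⟩
  · trivial
  rcases y with _ | ⟨a', b'⟩
  · exact h2.elim
  · exact lt_of_lt_of_le h2 (not_lt.1 h1)

theorem Exchange.Asc.trans_not' {x y z : Exchange} (h1 : x.Asc y) (h2 : ¬ z.Asc y) :
    x.Asc z := by
  rcases y with _ | ⟨a', b'⟩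
  · cases z <;> exact absurd trivial h2
  rcases x with _ | ⟨a, b⟩
  · exact h1.elim
  rcases z with _ | ⟨c, d⟩
  · trivial
  · exact lt_of_le_of_lt (not_lt.1 h2) h1

/-- After `y`, the steps of `x` and `z` always commute. If `z` filled the cell where the nonpositive
label `b` of `x` enters, this cell would have no crossing, so `x` would pass with `b` unchanged. But
`RowStep.desc` for `y`, `x` and `RowStep.asc` for `y`, `z` then place the crossing of `z` strictly
to the right of `b`. -/
theorem KnuthRel.row_first (h : IsRow k C u) {x y : Exchange} {D₁ D₂ D₃ E₂ E₃ : Set ℕ}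
    {g₁ g₂ g₃ f₂ f₃ : ℤ × ℤ} (hyx : ¬ y.Asc x) (hyz : y.Asc z) (vy : y.Valid u)
    (vx : x.Valid (y.act u)) (vz : z.Valid (y.act u))
    (s₁ : RowStep k C u y D₁ g₁) (s₂ : RowStep k D₁ (y.act u) x D₂ g₂)
    (s₃ : RowStep k D₂ (x.act (y.act u)) z D₃ g₃) (t₂ : RowStep k D₁ (y.act u) z E₂ f₂)
    (t₃ : RowStep k E₂ (z.act (y.act u)) x E₃ f₃) :
    D₃ = E₃ ∧ KnuthRel (some g₁) (some g₂) (some g₃) (some g₁) (some f₂) (some f₃) := by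
  have h1 := (s₁.isRow h vy).1
  have o1 := RowStep.desc h vy vx s₁ s₂ hyx
  have o2 := RowStep.asc h vy vz s₁ t₂ hyz
  have hxz := Exchange.Asc.trans_not hyx hyz
  obtain ⟨a, b, rfl⟩ := Exchange.exists_of_not_asc hyx
  have hlt : f₂.2 < b := by
    have vx' := vx
    obtain ⟨ha, hb, p, q, hpq, hp, hq, -⟩ := vx'
    rcases t₂.lt_or_meets h1 vx vz hxz hp hq hpq with h2 | ⟨C₀, P, hm⟩
    · exact h2
    · have hqC : q ∉ D₁ := fun hc => (hm.block q le_rfl (hm.down _ _ (by omega) hm.next)).1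
        ((hm.agree q (by omega)).2 hc)
      obtain ⟨-, rfl⟩ := s₂.eq_of_notMem h1.toIsState hq hqC
      exact lt_of_lt_of_le o2 o1
  obtain ⟨E, h2, h3⟩ := RowStep.commute h1 vx vz hxz s₂ t₂ hlt
  have hx1 := (h1.toIsState.act h.pos vx).inj
  have hz1 := (h1.toIsState.act h.pos vz).inj
  obtain ⟨rfl, rfl⟩ := s₃.unique hx1 h2
  obtain ⟨rfl, rfl⟩ := t₃.unique hz1 h3
  exact ⟨rfl, .first (not_lt.2 o1) o2⟩

/-- If the steps of `x` and `z` do not meet, they commute, and the orders persist by `RowStep.asc`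
and `RowStep.desc`. If they meet, `z` fills `q` when it comes first and `q + 1` when it comes after
`x`. The order conditions on `y` then force `y = (a, b₁)`, where `b₁` is the label entering cell `q
+ 1`, and `y` makes up for the difference by removing the crossing at `q + 1`. The outgoing relation
is `first` if `x` bumps the crossing made by `z` in `q`, and `braid` otherwise. -/
theorem KnuthRel.row_last (h : IsRow k C u) {x y : Exchange} {D₁ D₂ D₃ E₁ E₂ E₃ : Set ℕ}
    {g₁ g₂ g₃ f₁ f₂ f₃ : ℤ × ℤ} (hxy : x.Asc y) (hzy : ¬ z.Asc y) (vz : z.Valid u)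
    (vx : x.Valid u) (vx' : x.Valid (z.act u)) (vz' : z.Valid (x.act u))
    (vy : y.Valid (x.act (z.act u)))
    (s₁ : RowStep k C u z D₁ g₁) (s₂ : RowStep k D₁ (z.act u) x D₂ g₂)
    (s₃ : RowStep k D₂ (x.act (z.act u)) y D₃ g₃) (t₁ : RowStep k C u x E₁ f₁)
    (t₂ : RowStep k E₁ (x.act u) z E₂ f₂) (t₃ : RowStep k E₂ (z.act (x.act u)) y E₃ f₃) :
    D₃ = E₃ ∧ KnuthRel (some g₁) (some g₂) (some g₃) (some f₁) (some f₂) (some f₃) := by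
  have hxz := Exchange.Asc.trans_not' hxy hzy
  obtain ⟨a', b', rfl⟩ := Exchange.exists_of_not_asc hzy
  rcases x with _ | ⟨a, b⟩
  · exact hxy.elim
  have hcomm := h.toIsState.act_comm_of_asc vx vz hxz
  rw [← hcomm] at t₃
  have hD₁ := (s₁.isRow h vz).1
  have hD₂ := (s₂.isRow hD₁ vx').1
  have hE₁ := (t₁.isRow h vx).1
  have hE₂ := (t₂.isRow hE₁ vz').1
  have hu2 := hD₂.toIsState
  have vy' : Exchange.Valid (some (a', b')) (z.act (Exchange.act (some (a, b)) u)) := by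
    rwa [← hcomm]
  have vx0 := vx
  obtain ⟨ha, hb, p, q, hpq, hp, hq, hbet⟩ := vx0
  simp only at ha hb hp hq hbet
  rcases s₁.lt_or_meets h vx vz hxz hp hq hpq with h2 | ⟨C₀, P, hm⟩
  · obtain ⟨E, h3, h4⟩ := RowStep.commute h vx vz hxz t₁ s₁ h2
    obtain ⟨rfl, rfl⟩ := t₂.unique hE₁.inj h3
    obtain ⟨rfl, rfl⟩ := s₂.unique hD₁.inj h4
    obtain ⟨rfl, rfl⟩ := s₃.unique hD₂.inj t₃
    have o1 := RowStep.asc hD₁ vx' vy s₂ s₃ hxy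
    have o2 := RowStep.desc hE₁ vz' vy' t₂ (by rwa [← hcomm]) hzy
    exact ⟨rfl, .last o1 (not_lt.2 o2)⟩
  have hPq : P q := hm.down _ _ (by omega) hm.next
  have hqC₀ := (hm.block q le_rfl hPq).1
  have hqC : q ∉ C := fun hc => hqC₀ ((hm.agree q (by omega)).2 hc)
  obtain ⟨hq1C₀, hb₁⟩ := hm.block (q + 1) (by omega) hm.next
  obtain ⟨rfl, rfl⟩ := t₁.eq_of_notMem h.toIsState hq hqC
  have hstep := hm.step
  rw [hq] at hstep
  obtain ⟨rfl, rfl⟩ := t₂.unique hE₁.inj hstep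
  obtain rfl := hm.eq_insert
  have hzp : z.act u p = a := by rw [hm.act_eq p hpq.le, hp]
  have hzq : z.act u q = b := by rw [hm.act_eq q le_rfl, hq]
  set b₁ := z.act u (q + 1) with hb₁_def
  have hzinj := hD₁.inj
  have hb₁b : b₁ < b := by
    have := hD₁.anti q (q + 1) (by omega) (by omega) hb₁
    omega
  set u₂ := Exchange.act (some (a, b)) (z.act u) with hu₂
  have hu₂p : u₂ p = b := act_left hzp
  have hu₂q : u₂ q = a := act_right hzq
  have hu₂ne : ∀ s, s ≠ p → s ≠ q → u₂ s = z.act u s := fun s => act_of_pos_ne hzinj hzp hzq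
  have hu₂q1 : u₂ (q + 1) = b₁ := hu₂ne _ (by omega) (by omega)
  -- the third exchange moves `a` again
  obtain ⟨rfl, rfl⟩ : a' = a ∧ b' = b₁ := by
    have hlt : b' < b := hxy
    obtain ⟨ha', hb', p', q', hpq', hp', hq', hbet'⟩ := vy
    simp only at ha' hb' hp' hq' hbet'
    have h5 : p < q' := hu2.lt_of_label_lt (by omega) (by omega) (by omega)
    have h6 : q < q' := by
      by_contra hc
      rcases Nat.lt_or_ge q' q with h7 | h7
      · have := hbet q' h5 h7
        rw [hu₂ne q' (by omega) (by omega), hm.act_eq q' h7.le] at hq'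
        omega
      · obtain rfl : q' = q := by omega
        omega
    have h7 : z.act u q' = b' := by rw [← hq', hu₂ne q' (by omega) (by omega)]
    -- So `b'` enters within the range searched by `z`, where all labels from `q` on were
    -- nonpositive before `a` moved to `q`. As the cell before `q'` must receive a positive label,
    -- only `q' = q + 1` is possible.
    have h8 : P q' := hm.le_of q' a' (by omega) (by rwa [h7])
    have h9 : q' = q + 1 := by
      by_contra hc
      have h10 := (hm.block (q' - 1) (by omega) (hm.down _ _ (by omega) h8)).2
      rw [← hu₂ne _ (by omega) (by omega)] at h10
      rcases Nat.lt_or_ge p' (q' - 1) with h11 | h11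
      · have := hbet' (q' - 1) h11 (by omega); omega
      · rw [show q' - 1 = p' by omega] at h10; omega
    subst h9
    have h10 : p' = q := by
      by_contra hc
      have h11 := hbet' q (by omega) (by omega)
      have h12 : p < p' := by
        by_contra hc'
        rcases Nat.lt_or_ge p' p with h13 | h13
        · have := hbet' p h13 (by omega); omega
        · obtain rfl : p' = p := by omega
          omega
      have := hbet p' h12 (by omega)
      rw [hu₂ne p' (by omega) (by omega), hm.act_eq p' (by omega)] at hp'
      omega
    subst h10
    exact ⟨hp'.symm.trans hu₂q, h7.symm⟩
  have hyq : Exchange.act (some (a', b₁)) u₂ q = b₁ := act_left hu₂q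
  have hyne : ∀ s < q, Exchange.act (some (a', b₁)) u₂ s = u₂ s := fun s hs =>
    act_of_pos_ne hu2.inj hu₂q hu₂q1 (by omega) (by omega)
  have hset : insert (q + 1) C₀ \ {q + 1} = C₀ := by
    ext s
    simp only [Set.mem_sdiff, Set.mem_insert_iff, Set.mem_singleton_iff]
    constructor
    · rintro ⟨h1 | h1, h2⟩
      · exact absurd h1 h2
      · exact h1
    · intro h1
      exact ⟨Or.inr h1, fun h2 => hq1C₀ (h2 ▸ h1)⟩
  have hset' : insert q C₀ \ {q} = C₀ := by
    ext s
    simp only [Set.mem_sdiff, Set.mem_insert_iff, Set.mem_singleton_iff]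
    constructor
    · rintro ⟨h1 | h1, h2⟩
      · exact absurd h1 h2
      · exact h1
    · intro h1
      exact ⟨Or.inr h1, fun h2 => hqC₀ (h2 ▸ h1)⟩
  have hg₁ : g₁ = (rowLeft k E₁ u q, b) := Prod.ext hm.fst_eq (hm.snd_eq.trans hq)
  have hak : a' < k := hp ▸ h.lt p
  have hfix : Equiv.swap a' b k = k :=
    Equiv.swap_apply_of_ne_of_ne (by omega) (by have := h.pos; omega)
  -- When `x` comes after `z`, it bumps exactly if `a` bends in the cell before `q` and so runs into
  -- the crossing which `z` has put there.
  by_cases hact : p + 1 = q ∧ p ∉ E₁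
  · obtain ⟨rfl, hpC⟩ := hact
    have hL : rowLeft k E₁ u (p + 1) = a' := by rw [rowLeft_succ_notMem hpC, hp]
    have hpC₀ : p ∉ C₀ := fun hc => hpC ((hm.agree p (by omega)).1 hc)
    rw [hL] at hg₁
    subst hg₁
    have o1 := s₂.le_snd hD₁ vx'
    cases s₂ with
    | pass h1 =>
      exact absurd (Set.mem_insert _ _) (h1 p hzp hzq (by simp [hpC₀]))
    | bump h2 h3 h4 h5 h6 =>
      rename_i p₁ r
      obtain rfl : p₁ = p := hzinj (h2.trans hzp.symm)
      rw [hset'] at h6 s₃ ⊢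
      have hr := h6.1
      simp only at hr
      have h7 : p₁ + 1 + 1 ∉ insert r C₀ := by
        simp only [Set.mem_insert_iff, not_or]
        exact ⟨by omega, hq1C₀⟩
      obtain ⟨rfl, rfl⟩ := s₃.eq_of_notMem hu2 hu₂q1 h7
      have hLr : rowLeft k C₀ (Exchange.act (some (a', b₁)) u₂) r = rowLeft k C₀ u₂ r :=
        rowLeft_congr (fun _ _ => Iff.rfl) (fun s hs => hyne s (by omega))
      -- In the other order `y` bumps. Cell `q` is then empty and receives the nonpositive `b₁`, so
      -- the search goes on to the same open space `r` that `x` found.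
      have h8 := RowStep.bump (k := k) (C := insert (p₁ + 1 + 1) C₀) (r := r) hu₂q hu₂q1
        (by simp [hqC₀]) (Set.mem_insert _ _) (by
          rw [hset]
          refine ⟨by omega, by rw [hLr]; exact h6.2.1, fun s h9 h10 => ?_⟩
          rcases Nat.lt_or_ge s (p₁ + 1) with h11 | h11
          · rw [hyne s h11]; exact h6.2.2 s h9 h11
          · obtain rfl : s = p₁ + 1 := by omega
            rw [hyq]; exact ⟨hqC₀, hb₁⟩)
      rw [hset, hLr, hyne r hr] at h8
      obtain ⟨rfl, rfl⟩ := t₃.unique hu2.inj h8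
      exact ⟨rfl, .first (not_lt.2 o1) hb₁b⟩
  · obtain ⟨rfl, rfl⟩ : D₂ = insert q C₀ ∧ g₂ = (a', b) := by
      refine s₂.unique hzinj (.pass fun s h1 h2 h3 => ?_)
      obtain rfl := hzinj (h1.trans hzp.symm)
      obtain rfl := hzinj (h2.trans hzq.symm)
      refine absurd ⟨rfl, fun hc => h3 (Set.mem_insert_of_mem _ ?_)⟩ hact
      exact (hm.agree s (by omega)).2 hc
    obtain ⟨rfl, rfl⟩ := s₃.eq_of_mem hu2 hu₂q (Set.mem_insert _ _)
    have hc : rowLeft k E₁ u q ≠ a' := by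
      intro hc
      obtain ⟨h1, h2, -⟩ := h.rowLeft_ne hpq (by rwa [hp]) (fun h3 _ => by rwa [h3])
        (hc.trans hp.symm)
      exact hact ⟨h1.symm, h2⟩
    have hLq : rowLeft k C₀ (Exchange.act (some (a', b₁)) u₂) q = rowLeft k E₁ u q := by
      have h1 : rowLeft k E₁ (Exchange.act (some (a', b)) u) q =
          Equiv.swap a' b (rowLeft k E₁ u q) := rowLeft_comp _ hfix q
      rw [Equiv.swap_apply_of_ne_of_ne hc (by have := hm.left; omega)] at h1
      rw [← h1]
      refine rowLeft_congr (fun s hs => hm.agree s (by omega)) (fun s hs => ?_)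
      rw [hyne s hs, hu₂, act_apply, act_apply, hm.act_eq s hs.le]
    -- In the other order `y` removes the crossing at `q + 1` and fills `q` at once, since the label
    -- on the left of `q` is positive.
    have h8 := RowStep.bump (k := k) (C := insert (q + 1) C₀) (r := q) hu₂q hu₂q1
      (by simp [hqC₀]) (Set.mem_insert _ _) (by
        rw [hset]
        refine ⟨by omega, by rw [hLq]; exact hm.left, fun s h9 h10 => ?_⟩
        obtain rfl : s = q := by omega
        rw [hyq]; exact ⟨hqC₀, hb₁⟩)
    rw [hset, hLq, hyq] at h8
    obtain ⟨rfl, rfl⟩ := t₃.unique hu2.inj h8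
    rw [hg₁]
    exact ⟨rfl, .braid hb₁b⟩
end

/-! ### The braid relation in one row, and the three relations together. -/

section
variable {k : ℤ} {C : Set ℕ} {u : ℕ → ℤ}

/-- The labels `a`, `c`, `b`, `d` enter at positions α < β < γ < δ, and `a < c`. All exchanges pass
except possibly `(c, b)` on one side and `(c, d)` on the other, which remove the same crossing at γ.
On the first side, the crossing goes to β, and `(a, b)` may bump it again; on the second side `(c,
d)` then goes directly to the final place. With this second bump the relation becomes `first`, in
all other cases it stays `braid`. -/
theorem KnuthRel.row_braid (h : IsRow k C u) {a b c d : ℤ} {D₁ D₂ D₃ E₁ E₂ E₃ : Set ℕ}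
    {g₁ g₂ g₃ f₁ f₂ f₃ : ℤ × ℤ} (hdb : d < b)
    (v₁ : Exchange.Valid (some (c, b)) u)
    (v₂ : Exchange.Valid (some (a, b)) (Exchange.act (some (c, b)) u))
    (w₁ : Exchange.Valid (some (a, b)) u)
    (w₂ : Exchange.Valid (some (a, d)) (Exchange.act (some (a, b)) u))
    (s₁ : RowStep k C u (some (c, b)) D₁ g₁)
    (s₂ : RowStep k D₁ (Exchange.act (some (c, b)) u) (some (a, b)) D₂ g₂)
    (s₃ : RowStep k D₂ (Exchange.act (some (a, b)) (Exchange.act (some (c, b)) u))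
      (some (a, d)) D₃ g₃)
    (t₁ : RowStep k C u (some (a, b)) E₁ f₁)
    (t₂ : RowStep k E₁ (Exchange.act (some (a, b)) u) (some (a, d)) E₂ f₂)
    (t₃ : RowStep k E₂ (Exchange.act (some (a, d)) (Exchange.act (some (a, b)) u))
      (some (c, d)) E₃ f₃) :
    D₃ = E₃ ∧ KnuthRel (some g₁) (some g₂) (some g₃) (some f₁) (some f₂) (some f₃) := by
  have hW₁ := h.toIsState.act h.pos v₁
  have hW₂ := hW₁.act h.pos v₂
  have hT₁ := h.toIsState.act h.pos w₁
  have hT₂ := hT₁.act h.pos w₂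
  have hrowD₁ := (s₁.isRow h v₁).1
  -- positions of the strands
  obtain ⟨β, γ, hβγ, hβ, hγ, hbet₁⟩ : ∃ β γ, β < γ ∧ u β = c ∧ u γ = b ∧
      ∀ s, β < s → s < γ → c < u s := v₁.2.2
  obtain ⟨α, γ', hαγ, hα, hγ', hbet₂⟩ : ∃ α γ, α < γ ∧ u α = a ∧ u γ = b ∧
      ∀ s, α < s → s < γ → a < u s := w₁.2.2
  obtain rfl : γ = γ' := h.inj (hγ.trans hγ'.symm)
  have ha : 0 < a := w₁.1
  have hb : b ≤ 0 := w₁.2.1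
  have hc : 0 < c := v₁.1
  have hd : d ≤ 0 := w₂.2.1
  have hwβ : Exchange.act (some (c, b)) u β = b := act_left hβ
  have hwγ : Exchange.act (some (c, b)) u γ = c := act_right hγ
  have hαβ : α < β := by
    obtain ⟨p, q, hpq, hp, hq, -⟩ := v₂.2.2
    simp only at hp hq
    obtain rfl : q = β := hW₁.inj (hq.trans hwβ.symm)
    rw [act_of_pos_ne h.inj hβ hγ hpq.ne (by omega)] at hp
    obtain rfl : p = α := h.inj (hp.trans hα.symm)
    exact hpq
  have hac : a < c := hβ ▸ hbet₂ β hαβ hβγ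
  have htα : Exchange.act (some (a, b)) u α = b := act_left hα
  have htγ : Exchange.act (some (a, b)) u γ = a := act_right hγ
  have htne : ∀ s, s ≠ α → s ≠ γ → Exchange.act (some (a, b)) u s = u s := fun s =>
    act_of_pos_ne h.inj hα hγ
  obtain ⟨δ, hγδ, hδ⟩ : ∃ δ, γ < δ ∧ u δ = d := by
    obtain ⟨p, q, hpq, hp, hq, -⟩ := w₂.2.2
    simp only at hp hq
    obtain rfl : p = γ := hT₁.inj (hp.trans htγ.symm)
    refine ⟨q, hpq, ?_⟩
    rwa [htne q (by omega) (by omega)] at hq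
  have hwne : ∀ s, s ≠ β → s ≠ γ → Exchange.act (some (c, b)) u s = u s := fun s =>
    act_of_pos_ne h.inj hβ hγ
  have hwα : Exchange.act (some (c, b)) u α = a := by rw [hwne α (by omega) (by omega), hα]
  have hwδ : Exchange.act (some (c, b)) u δ = d := by rw [hwne δ (by omega) (by omega), hδ]
  set w₁' := Exchange.act (some (c, b)) u with hw₁'
  have hyα : Exchange.act (some (a, b)) w₁' α = b := act_left hwα
  have hyβ : Exchange.act (some (a, b)) w₁' β = a := act_right hwβ
  have hyne : ∀ s, s ≠ α → s ≠ β → Exchange.act (some (a, b)) w₁' s = w₁' s := fun s =>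
    act_of_pos_ne hW₁.inj hwα hwβ
  have hyδ : Exchange.act (some (a, b)) w₁' δ = d := by rw [hyne δ (by omega) (by omega), hwδ]
  set w₂' := Exchange.act (some (a, b)) w₁' with hw₂'
  have htβ : Exchange.act (some (a, b)) u β = c := by rw [htne β (by omega) (by omega), hβ]
  have htδ : Exchange.act (some (a, b)) u δ = d := by rw [htne δ (by omega) (by omega), hδ]
  set t₁' := Exchange.act (some (a, b)) u with ht₁'
  have hxγ : Exchange.act (some (a, d)) t₁' γ = d := act_left htγ
  have hxne : ∀ s, s ≠ γ → s ≠ δ → Exchange.act (some (a, d)) t₁' s = t₁' s := fun s =>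
    act_of_pos_ne hT₁.inj htγ htδ
  have hxβ : Exchange.act (some (a, d)) t₁' β = c := by rw [hxne β (by omega) (by omega), htβ]
  set t₂' := Exchange.act (some (a, d)) t₁' with ht₂'
  have hzβ : Exchange.act (some (c, d)) t₂' β = d := act_left hxβ
  have hzne : ∀ s < β, Exchange.act (some (c, d)) t₂' s = t₁' s := fun s hs => by
    rw [act_of_pos_ne hT₂.inj hxβ hxγ (by omega) (by omega), hxne s (by omega) (by omega)]
  obtain ⟨rfl, rfl⟩ := t₁.eq_of_ne h.toIsState hα hγ (by omega)
  obtain ⟨rfl, rfl⟩ : E₂ = E₁ ∧ f₂ = (a, d) := by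
    refine t₂.unique hT₁.inj (.pass fun s h1 _ h3 => ?_)
    obtain rfl := hT₁.inj (h1.trans htγ.symm)
    -- Before the exchange, the nonpositive label `b` entered cell γ; since it bends there, the next
    -- cell holds no crossing.
    exact h.notMem_succ h3 (by omega)
  obtain ⟨rfl, rfl⟩ := s₃.eq_of_ne hW₂ hyβ hyδ (by omega)
  by_cases hact : β + 1 = γ ∧ β ∉ E₂ ∧ γ ∈ E₂
  · obtain ⟨rfl, hβC, hγC⟩ := hact
    have hle : a ≤ rowLeft k E₂ u β := by
      have := h.le_rowLeft (p := α) (q := β) (fun s h1 h2 => by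
        rw [hα]; exact hbet₂ s h1 (by omega)) hαβ le_rfl
      rwa [hα] at this
    have hset : insert β (E₂ \ {β + 1}) \ {β} = E₂ \ {β + 1} := by
      ext s
      simp only [Set.mem_sdiff, Set.mem_insert_iff, Set.mem_singleton_iff]
      constructor
      · rintro ⟨h1 | h1, h2⟩
        · exact absurd h1 h2
        · exact h1
      · intro h1
        exact ⟨Or.inr h1, fun h2 => hβC (h2 ▸ h1.1)⟩
    have hLw : rowLeft k (E₂ \ {β + 1}) w₁' β = rowLeft k E₂ u β :=
      rowLeft_erase_of_le h.toIsState hβ hγ le_rfl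
    -- The label on the left of β is at least `a`, hence positive, while `b` now enters from below:
    -- the search stops at β immediately.
    have h1 := RowStep.bump (k := k) (r := β) hβ hγ hβC hγC
      ⟨by omega, by rw [hLw]; omega, fun s h1 h2 => by
        obtain rfl : s = β := by omega
        exact ⟨fun hm => hβC hm.1, by rw [← hw₁', hwβ]; exact hb⟩⟩
    rw [← hw₁', hLw, hwβ] at h1
    obtain ⟨rfl, rfl⟩ := s₁.unique h.inj h1
    by_cases hact' : α + 1 = β ∧ α ∉ E₂
    · obtain ⟨rfl, hαC⟩ := hact'
      have o1 := s₂.le_snd hrowD₁ v₂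
      cases s₂ with
      | pass h2 =>
        exact absurd (Set.mem_insert _ _) (h2 α hwα hwβ (by simp [hαC]))
      | bump h2 h3 h4 h5 h6 =>
        rename_i p r
        obtain rfl : p = α := hW₁.inj (h2.trans hwα.symm)
        rw [hset] at h6 ⊢
        have hr := h6.1
        simp only at hr
        have hagree : ∀ s < p + 1, Exchange.act (some (c, d)) t₂' s = w₂' s := by
          intro s hs
          rw [hzne s hs]
          by_cases h7 : s = p
          · subst h7; rw [htα, hyα]
          · rw [htne s h7 (by omega), hyne s h7 (by omega), hwne s (by omega) (by omega)]
        have hL : rowLeft k (E₂ \ {p + 1 + 1}) (Exchange.act (some (c, d)) t₂') r =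
            rowLeft k (E₂ \ {p + 1 + 1}) w₂' r :=
          rowLeft_congr (fun _ _ => Iff.rfl) (fun s hs => hagree s (by omega))
        have h8 := RowStep.bump (k := k) (r := r) hxβ hxγ hβC hγC
          ⟨by omega, by rw [hL]; exact h6.2.1, fun s h7 h8 => by
            rcases Nat.lt_or_ge s (p + 1) with h9 | h9
            · rw [hagree s h9]; exact h6.2.2 s h7 h9
            · obtain rfl : s = p + 1 := by omega
              rw [hzβ]; exact ⟨fun hm => hβC hm.1, hd⟩⟩
        rw [hL, hagree r hr] at h8
        obtain ⟨rfl, rfl⟩ := t₃.unique hT₂.inj h8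
        rw [rowLeft_succ_notMem hαC, hα]
        exact ⟨rfl, .first (not_lt.2 o1) hdb⟩
    · obtain ⟨rfl, rfl⟩ : D₃ = insert β (E₂ \ {β + 1}) ∧ g₂ = (a, b) := by
        refine s₂.unique hW₁.inj (.pass fun s h1 h2 h3 => ?_)
        obtain rfl := hW₁.inj (h1.trans hwα.symm)
        obtain rfl := hW₁.inj (h2.trans hwβ.symm)
        exact absurd ⟨rfl, fun hm => h3 (Set.mem_insert_of_mem _ ⟨hm, by simp; omega⟩)⟩ hact'
      have hne : rowLeft k E₂ u β ≠ a := by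
        intro hL
        obtain ⟨h1, h2, -⟩ := h.rowLeft_ne (p := α) (q := β) hαβ (fun s h1 h2 => by
          rw [hα]; exact hbet₂ s h1 (by omega)) (fun h3 _ => by rwa [h3]) (hL.trans hα.symm)
        exact hact' ⟨h1.symm, h2⟩
      have hak : a < k := hα ▸ h.lt α
      have hfix : Equiv.swap a b k = k :=
        Equiv.swap_apply_of_ne_of_ne (by omega) (by have := h.pos; omega)
      have hL : rowLeft k (E₂ \ {β + 1}) (Exchange.act (some (c, d)) t₂') β =
          rowLeft k E₂ u β := by
        have h1 : rowLeft k E₂ t₁' β = Equiv.swap a b (rowLeft k E₂ u β) :=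
          rowLeft_comp _ hfix β
        rw [Equiv.swap_apply_of_ne_of_ne hne (by omega)] at h1
        rw [← h1]
        exact rowLeft_congr (fun s hs => by simp; omega) hzne
      have h8 := RowStep.bump (k := k) (r := β) hxβ hxγ hβC hγC
        ⟨by omega, by rw [hL]; omega, fun s h7 h8 => by
          obtain rfl : s = β := by omega
          rw [hzβ]; exact ⟨fun hm => hβC hm.1, hd⟩⟩
      rw [hL, hzβ] at h8
      obtain ⟨rfl, rfl⟩ := t₃.unique hT₂.inj h8
      exact ⟨rfl, .braid hdb⟩
  · have hpass : ∀ v : ℕ → ℤ, ∀ e : ℤ, Function.Injective v → v β = c → v γ = e →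
        ∀ p, v p = c → v (p + 1) = e → p ∉ E₂ → p + 1 ∉ E₂ := by
      intro v e hv h1 h2 p h3 h4 h5
      obtain rfl := hv (h3.trans h1.symm)
      obtain rfl := hv (h4.trans h2.symm)
      exact fun h6 => hact ⟨rfl, h5, h6⟩
    obtain ⟨rfl, rfl⟩ := s₁.unique h.inj (.pass (hpass u b h.inj hβ hγ))
    obtain ⟨rfl, rfl⟩ := t₃.unique hT₂.inj (.pass (hpass t₂' d hT₂.inj hxβ hxγ))
    obtain ⟨rfl, rfl⟩ : D₃ = E₃ ∧ g₂ = (a, b) := by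
      refine s₂.unique hW₁.inj (.pass fun s h1 h2 h3 h4 => ?_)
      obtain rfl := hW₁.inj (h1.trans hwα.symm)
      obtain rfl := hW₁.inj (h2.trans hwβ.symm)
      -- Otherwise `a` would cross the larger label `c` from the left.
      have := (h.cross _ h4).2
      rw [rowLeft_succ_notMem h3, hα, hβ] at this
      omega
    exact ⟨rfl, .braid hdb⟩

/-- The exchanges `e₁`, `e₂`, `e₃` may be performed one after the other. -/
def ValidChain (e₁ e₂ e₃ : Exchange) (u : ℕ → ℤ) : Prop :=
  e₁.Valid u ∧ e₂.Valid (e₁.act u) ∧ e₃.Valid (e₂.act (e₁.act u))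

/-- The effect of three exchanges on a row. -/
def RowSteps (k : ℤ) (C : Set ℕ) (u : ℕ → ℤ) (e₁ e₂ e₃ : Exchange) (D : Set ℕ)
    (f₁ f₂ f₃ : ℤ × ℤ) : Prop :=
  ∃ C₁ C₂, RowStep k C u e₁ C₁ f₁ ∧ RowStep k C₁ (e₁.act u) e₂ C₂ f₂ ∧
    RowStep k C₂ (e₂.act (e₁.act u)) e₃ D f₃

/-- Row steps preserve the elementary relations. -/
theorem KnuthRel.rowSteps {e₁ e₂ e₃ e₁' e₂' e₃' : Exchange} {D D' : Set ℕ}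
    {f₁ f₂ f₃ f₁' f₂' f₃' : ℤ × ℤ} (hK : KnuthRel e₁ e₂ e₃ e₁' e₂' e₃') (h : IsRow k C u)
    (v : ValidChain e₁ e₂ e₃ u) (v' : ValidChain e₁' e₂' e₃' u)
    (hs : RowSteps k C u e₁ e₂ e₃ D f₁ f₂ f₃) (hs' : RowSteps k C u e₁' e₂' e₃' D' f₁' f₂' f₃') :
    D = D' ∧ KnuthRel (some f₁) (some f₂) (some f₃) (some f₁') (some f₂') (some f₃') := by
  obtain ⟨C₁, C₂, s₁, s₂, s₃⟩ := hs
  obtain ⟨C₁', C₂', t₁, t₂, t₃⟩ := hs'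
  cases hK with
  | first h1 h2 =>
    obtain ⟨rfl, rfl⟩ := s₁.unique h.inj t₁
    exact KnuthRel.row_first h h1 h2 v.1 v.2.1 v'.2.1 s₁ s₂ s₃ t₂ t₃
  | last h1 h2 => exact KnuthRel.row_last h h1 h2 v.1 v'.1 v.2.1 v'.2.1 v.2.2 s₁ s₂ s₃ t₁ t₂ t₃
  | braid h1 => exact KnuthRel.row_braid h h1 v.1 v.2.1 v'.1 v'.2.1 s₁ s₂ s₃ t₁ t₂ t₃
end

/-! ### The labels in a table -/

/-- The crossings in row `k`, numbered from the left. -/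
def rowCells (n : ℕ) (R : Finset (ℤ × ℤ)) (k : ℤ) : Set ℕ := {p | ((n : ℤ) - p, k) ∈ R}

/-- The labels entering row `m + j + 1` from below, if there are no crossings in the rows up
to `m`. -/
noncomputable def labelsFrom (n : ℕ) (R : Finset (ℤ × ℤ)) (m : ℤ) : ℕ → ℕ → ℤ
  | 0 => fun p => m - p
  | j + 1 => rowTop (m + j + 1) (rowCells n R (m + j + 1)) (labelsFrom n R m j)

section
variable {n : ℕ} {R : Finset (ℤ × ℤ)} {m a : ℤ} {s : EntrySide} {i k : ℤ} {j p : ℕ}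

theorem mem_rowCells : p ∈ rowCells n R k ↔ ((n : ℤ) - p, k) ∈ R := Iff.rfl

/-- The label of the strand entering a cell, in terms of `labelsFrom`. -/
def HasLabel (n : ℕ) (R : Finset (ℤ × ℤ)) (m a : ℤ) : EntrySide → ℤ → ℤ → Prop
  | .left, i, k => ∃ p : ℕ, i = n - p ∧ k ≤ n ∧ (k ≤ m → a = k - p) ∧
      ∀ j : ℕ, k = m + j + 1 → a = rowLeft k (rowCells n R k) (labelsFrom n R m j) p
  | .bottom, i, k => ∃ p : ℕ, i = n - p ∧ k ≤ n + 1 ∧ (k ≤ m → a = k - 1 - p) ∧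
      ∀ j : ℕ, k = m + j + 1 → a = labelsFrom n R m j p

/-- Induction along the strand. In the rows up to `m` strands only bend, so they stay on
antidiagonals and the label is determined by the row and column. -/
theorem StrandEnters.hasLabel (hR : ∀ c ∈ R, m < c.2) (h : StrandEnters n R a s i k) :
    HasLabel n R m a s i k := by
  induction h with
  | start h => exact ⟨0, by simp, h, by simp, fun j _ => rfl⟩
  | crossRight h1 h2 ih =>
    obtain ⟨p, rfl, h3, h4, h5⟩ := ih
    have h6 := hR _ h2
    simp only at h6
    refine ⟨p + 1, by push_cast; ring, h3, fun h7 => by omega, fun j hj => ?_⟩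
    rw [rowLeft_succ_mem (mem_rowCells.2 h2)]
    exact h5 j hj
  | @bendUp i k h1 h2 ih =>
    obtain ⟨p, rfl, h3, h4, h5⟩ := ih
    refine ⟨p, rfl, by omega, fun h6 => by have := h4 (by omega); omega, fun j hj => ?_⟩
    cases j with
    | zero =>
      have h6 := h4 (by simp at hj; omega)
      simp only [labelsFrom]
      simp at hj
      omega
    | succ j =>
      push_cast at hj
      have h6 := h5 j (by omega)
      rw [labelsFrom, show m + (j : ℤ) + 1 = k by omega, rowTop_notMem]
      · exact h6
      · exact h2
  | @crossUp i k h1 h2 h3 ih =>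
    obtain ⟨p, rfl, h3', h4, h5⟩ := ih
    have h6 := hR _ h3
    simp only at h6
    refine ⟨p, rfl, by omega, fun h6 => by omega, fun j hj => ?_⟩
    cases j with
    | zero => simp at hj; omega
    | succ j =>
      push_cast at hj
      have h6 := h5 j (by omega)
      rw [labelsFrom, show m + (j : ℤ) + 1 = k by omega, rowTop_mem]
      · exact h6
      · exact h3
  | bendRight h1 h2 h3 ih =>
    obtain ⟨p, rfl, h3', h4, h5⟩ := ih
    refine ⟨p + 1, by push_cast; ring, h2, fun h6 => by have := h4 h6; push_cast; omega,
      fun j hj => ?_⟩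
    rw [rowLeft_succ_notMem (fun h => h3 (mem_rowCells.1 h))]
    exact h5 j hj

theorem strandEnters_low (hR : ∀ c ∈ R, m < c.2) (hm : m ≤ n) (p : ℕ) :
    (∀ k ≤ m, StrandEnters n R (k - p) .left ((n : ℤ) - p) k) ∧
      ∀ k ≤ m, StrandEnters n R (k - p) .bottom ((n : ℤ) - p) (k + 1) := by
  have key : ∀ p : ℕ, (∀ k ≤ m, StrandEnters n R (k - p) .left ((n : ℤ) - p) k) →
      ∀ k ≤ m, StrandEnters n R (k - p) .bottom ((n : ℤ) - p) (k + 1) := by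
    intro p h k hk
    refine .bendUp (h k hk) fun hc => ?_
    have := hR _ hc
    simp only at this
    omega
  induction p with
  | zero =>
    have h : ∀ k ≤ m, StrandEnters n R (k - (0 : ℕ)) .left ((n : ℤ) - (0 : ℕ)) k := by
      intro k hk
      simpa using StrandEnters.start (n := n) (R := R) (a := k) (by omega)
    exact ⟨h, key 0 h⟩
  | succ p ih =>
    have h : ∀ k ≤ m, StrandEnters n R (k - (p + 1 : ℕ)) .left ((n : ℤ) - (p + 1 : ℕ)) k := by
      intro k hk
      have h1 := ih.2 (k - 1) (by omega)
      rw [show k - 1 + 1 = k by ring] at h1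
      have h2 := h1.bendRight (by omega) fun hc => by
        have := hR _ hc
        simp only at this
        omega
      convert h2 using 1 <;> push_cast <;> ring
    exact ⟨h, key _ h⟩

/-- The converse of `StrandEnters.hasLabel`. The level `m` is kept general because the positivity of
the rows of an rc-graph is itself derived from this description of the labels. -/
theorem strandEnters_labelsFrom (hR : ∀ c ∈ R, m < c.2) (hm : m ≤ n) (j : ℕ)
    (hj : m + j + 1 ≤ n + 1) (p : ℕ) :
    StrandEnters n R (labelsFrom n R m j p) .bottom ((n : ℤ) - p) (m + j + 1) ∧
      (m + j + 1 ≤ n → StrandEnters n R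
        (rowLeft (m + j + 1) (rowCells n R (m + j + 1)) (labelsFrom n R m j) p)
        .left ((n : ℤ) - p) (m + j + 1)) := by
  induction j generalizing p with
  | zero =>
    have h1 : ∀ p : ℕ, StrandEnters n R (labelsFrom n R m 0 p) .bottom ((n : ℤ) - p)
        (m + (0 : ℕ) + 1) := fun p => by simpa [labelsFrom] using (strandEnters_low hR hm p).2 m le_rfl
    refine ⟨h1 p, fun hk => ?_⟩
    induction p with
    | zero => simpa [rowLeft] using StrandEnters.start hk
    | succ p ih =>
      have e : (n : ℤ) - (p + 1 : ℕ) = n - p - 1 := by push_cast; ring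
      rw [e]
      by_cases hc : p ∈ rowCells n R (m + (0 : ℕ) + 1)
      · rw [rowLeft_succ_mem hc]
        exact ih.crossRight hc
      · rw [rowLeft_succ_notMem hc]
        exact (h1 p).bendRight hk hc
  | succ j ihj =>
    have h1 : ∀ p : ℕ, StrandEnters n R (labelsFrom n R m (j + 1) p) .bottom ((n : ℤ) - p)
        (m + (j + 1 : ℕ) + 1) := by
      intro p
      push_cast at hj
      obtain ⟨h2, h3⟩ := ihj (by omega) p
      rw [show m + ((j + 1 : ℕ) : ℤ) + 1 = m + j + 1 + 1 by push_cast; ring]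
      by_cases hc : p ∈ rowCells n R (m + j + 1)
      · rw [labelsFrom, rowTop_mem hc]
        exact h2.crossUp (by omega) hc
      · rw [labelsFrom, rowTop_notMem hc]
        exact (h3 (by omega)).bendUp hc
    refine ⟨h1 p, fun hk => ?_⟩
    induction p with
    | zero => simpa [rowLeft] using StrandEnters.start hk
    | succ p ih =>
      have e : (n : ℤ) - (p + 1 : ℕ) = n - p - 1 := by push_cast; ring
      rw [e]
      by_cases hc : p ∈ rowCells n R (m + (j + 1 : ℕ) + 1)
      · rw [rowLeft_succ_mem hc]
        exact ih.crossRight hc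
      · rw [rowLeft_succ_notMem hc]
        exact (h1 p).bendRight hk hc

theorem labelsFrom_le (n : ℕ) (R : Finset (ℤ × ℤ)) (m : ℤ) (j p : ℕ) :
    labelsFrom n R m j p ≤ m + j := by
  induction j generalizing p with
  | zero => simp [labelsFrom]
  | succ j ih =>
    by_cases hc : p ∈ rowCells n R (m + j + 1)
    · rw [labelsFrom, rowTop_mem hc]
      have := ih p
      push_cast; omega
    · rw [labelsFrom, rowTop_notMem hc]
      rcases rowLeft_eq_or (k := m + j + 1) (C := rowCells n R (m + j + 1))
        (u := labelsFrom n R m j) p with h | ⟨s, -, h⟩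
      · push_cast; omega
      · have := ih s
        push_cast; omega

/-- The labels entering row `j + 1` from below. -/
noncomputable def labels (n : ℕ) (R : Finset (ℤ × ℤ)) (j : ℕ) : ℕ → ℤ := labelsFrom n R 0 j

theorem labels_zero (p : ℕ) : labels n R 0 p = -p := by simp [labels, labelsFrom]

theorem labels_succ (j : ℕ) :
    labels n R (j + 1) = rowTop (j + 1) (rowCells n R (j + 1)) (labels n R j) := by
  simp [labels, labelsFrom]

theorem labels_lt (n : ℕ) (R : Finset (ℤ × ℤ)) (j p : ℕ) : labels n R j p < j + 1 := by
  have := labelsFrom_le n R 0 j p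
  rw [labels]
  omega

theorem strandEnters_left_iff (hR : ∀ c ∈ R, 0 < c.2) (hj : j < n) :
    StrandEnters n R a .left ((n : ℤ) - p) (j + 1) ↔
      a = rowLeft (j + 1) (rowCells n R (j + 1)) (labels n R j) p := by
  constructor
  · intro h
    obtain ⟨p', h1, -, -, h2⟩ := h.hasLabel hR
    obtain rfl : p = p' := by omega
    exact h2 j (by omega)
  · rintro rfl
    have := (strandEnters_labelsFrom (n := n) hR (by omega) j (by omega) p).2 (by omega)
    simpa [labels] using this

theorem strandEnters_bottom_iff (hR : ∀ c ∈ R, 0 < c.2) (hj : j < n) :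
    StrandEnters n R a .bottom ((n : ℤ) - p) (j + 1) ↔ a = labels n R j p := by
  constructor
  · intro h
    obtain ⟨p', h1, -, -, h2⟩ := h.hasLabel hR
    obtain rfl : p = p' := by omega
    exact h2 j (by omega)
  · rintro rfl
    have := (strandEnters_labelsFrom (n := n) hR (by omega) j (by omega) p).1
    simpa [labels] using this

/-- An rc-graph has crossings only in the rows with positive numbers. -/
theorem RCGraph.pos_of_mem (U : RCGraph n) : ∀ c ∈ U.cells, 0 < c.2 := by
  intro c hc
  by_contra hneg
  -- Start below all crossings. The labels in a row never exceed its number, so a crossing in a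
  -- nonpositive row would involve two nonpositive labels.
  obtain ⟨m, hm0, hm⟩ : ∃ m : ℤ, m ≤ 0 ∧ ∀ d ∈ U.cells, m < d.2 := by
    obtain ⟨m, hm⟩ := (U.cells.image Prod.snd).bddBelow
    refine ⟨min (m - 1) 0, by omega, fun d hd => ?_⟩
    have := hm (Finset.mem_coe.2 (Finset.mem_image_of_mem Prod.snd hd))
    omega
  obtain ⟨h1, h2⟩ := U.le_of_mem c hc
  obtain ⟨p, hp⟩ : ∃ p : ℕ, c.1 = n - p := ⟨(n - c.1).toNat, by omega⟩
  obtain ⟨j, hj⟩ : ∃ j : ℕ, c.2 = m + j + 1 :=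
    ⟨(c.2 - m - 1).toNat, by have := hm c hc; omega⟩
  obtain ⟨h3, h4⟩ := strandEnters_labelsFrom (n := n) hm (by omega) j (by omega) p
  have h5 := labelsFrom_le n U.cells m j
  refine U.nonpos_not_cross _ _ c ?_ ?_ ⟨hc, Or.inl ⟨hp ▸ hj ▸ h4 (by omega), hp ▸ hj ▸ h3⟩⟩
  · rcases rowLeft_eq_or (k := m + j + 1) (C := rowCells n U.cells (m + j + 1))
      (u := labelsFrom n U.cells m j) p with h | ⟨s, -, h⟩
    · rw [hj, h]; omega
    · have := h5 s; rw [hj, h]; omega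
  · have := h5 p; omega

/-- The strands `a` and `b` cross at the cell `p` of row `j + 1`. -/
def CrossAt (n : ℕ) (R : Finset (ℤ × ℤ)) (a b : ℤ) (j p : ℕ) : Prop :=
  p ∈ rowCells n R (j + 1) ∧
    (a = rowLeft (j + 1) (rowCells n R (j + 1)) (labels n R j) p ∧ b = labels n R j p ∨
      b = rowLeft (j + 1) (rowCells n R (j + 1)) (labels n R j) p ∧ a = labels n R j p)

theorem strandsCross_iff (hR : ∀ c ∈ R, 0 < c.2) {b : ℤ} (hj : j < n) :
    StrandsCross n R a b ((n : ℤ) - p, (j : ℤ) + 1) ↔ CrossAt n R a b j p := by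
  simp only [StrandsCross, CrossAt, strandEnters_left_iff hR hj, strandEnters_bottom_iff hR hj,
    mem_rowCells]

theorem StrandsCross.exists_eq (hR : ∀ c ∈ R, 0 < c.2) {b : ℤ} {c : ℤ × ℤ}
    (h : StrandsCross n R a b c) : ∃ j p : ℕ, j < n ∧ c = ((n : ℤ) - p, (j : ℤ) + 1) := by
  have h0 := hR c h.1
  obtain ⟨c1, c2⟩ := c
  simp only at h0
  have h1 : ∃ a, StrandEnters n R a .left c1 c2 := by
    rcases h.2 with ⟨h1, -⟩ | ⟨h1, -⟩
    · exact ⟨_, h1⟩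
    · exact ⟨_, h1⟩
  obtain ⟨a', h1⟩ := h1
  obtain ⟨p, h2, h3, -⟩ := h1.hasLabel hR
  refine ⟨(c2 - 1).toNat, p, by omega, ?_⟩
  rw [Prod.mk.injEq]
  omega

/-! ### Reduced tables -/

/-- The labels met on the way from the top left to the bottom right, when the first `p` cells of
a row have been processed. -/
noncomputable def rowFront (k : ℤ) (C : Set ℕ) (u : ℕ → ℤ) (p r : ℕ) : ℤ :=
  if r < p then rowTop k C u r else if r = p then rowLeft k C u p else u (r - 1)

section
variable {C : Set ℕ} {u : ℕ → ℤ}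

theorem rowFront_succ_notMem (hp : p ∉ C) (r : ℕ) :
    rowFront k C u (p + 1) r = rowFront k C u p r := by
  rcases lt_trichotomy r p with h | rfl | h
  · simp [rowFront, h, h.trans (Nat.lt_succ_self p)]
  · simp [rowFront, rowTop_notMem hp]
  · rcases Nat.lt_or_ge (p + 1) r with h1 | h1
    · simp [rowFront, h.not_gt, h.ne', h1.not_gt, h1.ne']
    · obtain rfl : r = p + 1 := by omega
      simp [rowFront, rowLeft_succ_notMem hp]

/-- A crossing acts on the front as an adjacent transposition, so the order of two labels on the
front records whether their strands have crossed. -/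
theorem rowFront_succ_mem (hp : p ∈ C) (r : ℕ) :
    rowFront k C u (p + 1) r = rowFront k C u p (Equiv.swap p (p + 1) r) := by
  by_cases h1 : r = p
  · subst h1; simp [rowFront, rowTop_mem hp]
  by_cases h2 : r = p + 1
  · subst h2; simp [rowFront, rowLeft_succ_mem hp]
  rw [Equiv.swap_apply_of_ne_of_ne h1 h2]
  rcases Nat.lt_or_ge r p with h | h
  · simp [rowFront, h, h.trans (Nat.lt_succ_self p)]
  · have h3 : ¬ r < p := by omega
    have h4 : ¬ r < p + 1 := by omega
    simp [rowFront, h1, h2, h3, h4]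

theorem rowFront_self : rowFront k C u p p = rowLeft k C u p := by simp [rowFront]

theorem rowFront_self_succ : rowFront k C u p (p + 1) = u p := by simp [rowFront]

theorem rowFront_of_lt {r : ℕ} (h : r < p) : rowFront k C u p r = rowTop k C u r := by
  simp [rowFront, h]

theorem IsState.rowFront_injective (h : IsState k u) (p : ℕ) :
    Function.Injective (rowFront k C u p) := by
  induction p with
  | zero =>
    intro r s hrs
    rcases r with _ | r <;> rcases s with _ | s
    · rfl
    · exact absurd hrs (by simpa [rowFront, rowLeft] using (h.lt s).ne')
    · exact absurd hrs (by simpa [rowFront, rowLeft] using (h.lt r).ne)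
    · simp only [rowFront, Nat.not_lt_zero, if_false, Nat.succ_ne_zero, Nat.add_sub_cancel] at hrs
      rw [h.inj hrs]
  | succ p ih =>
    intro r s hrs
    by_cases hp : p ∈ C
    · rw [rowFront_succ_mem hp, rowFront_succ_mem hp] at hrs
      exact (Equiv.swap p (p + 1)).injective (ih hrs)
    · rw [rowFront_succ_notMem hp, rowFront_succ_notMem hp] at hrs
      exact ih hrs

/-- In a reduced row, strands in increasing order stay in this order. -/
theorem IsRow.front_mono (h : IsRow k C u) {r s q : ℕ} (hrs : r < s)
    (hlt : rowFront k C u p r < rowFront k C u p s) (hpq : p ≤ q) :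
    ∃ r' s', r' < s' ∧ rowFront k C u q r' = rowFront k C u p r ∧
      rowFront k C u q s' = rowFront k C u p s := by
  induction q, hpq using Nat.le_induction with
  | base => exact ⟨r, s, hrs, rfl, rfl⟩
  | succ q hq ih =>
    obtain ⟨r', s', h1, h2, h3⟩ := ih
    by_cases hm : q ∈ C
    · refine ⟨Equiv.swap q (q + 1) r', Equiv.swap q (q + 1) s', ?_, ?_, ?_⟩
      · have h4 : ¬ (r' = q ∧ s' = q + 1) := by
          rintro ⟨rfl, rfl⟩
          rw [rowFront_self] at h2
          rw [rowFront_self_succ] at h3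
          have := (h.cross _ hm).2
          omega
        rw [Equiv.swap_apply_def, Equiv.swap_apply_def]
        split_ifs <;> omega
      · rw [rowFront_succ_mem hm, Equiv.swap_apply_self, h2]
      · rw [rowFront_succ_mem hm, Equiv.swap_apply_self, h3]
    · exact ⟨r', s', h1, by rw [rowFront_succ_notMem hm, h2], by rw [rowFront_succ_notMem hm, h3]⟩

theorem IsRow.top_mono (h : IsRow k C u) {r s : ℕ} (hrs : r < s)
    (hlt : rowFront k C u p r < rowFront k C u p s) :
    ∃ r' s', r' < s' ∧ rowTop k C u r' = rowFront k C u p r ∧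
      rowTop k C u s' = rowFront k C u p s := by
  obtain ⟨M, hM⟩ := h.fin.bddAbove
  -- Beyond the last crossing the front is constant, and its processed part is `rowTop`.
  obtain ⟨r', s', h1, h2, h3⟩ := h.front_mono hrs hlt (le_max_left p (M + 1))
  have key : ∀ q, max p (M + 1) ≤ q → ∀ t, rowFront k C u q t =
      rowFront k C u (max p (M + 1)) t := by
    intro q hq t
    induction q, hq using Nat.le_induction with
    | base => rfl
    | succ q hq ih =>
      rw [rowFront_succ_notMem (fun hm => by have := hM hm; omega), ih]
  have h4 := key (max p (M + 1) + s' + 1) (by omega)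
  refine ⟨r', s', h1, ?_, ?_⟩
  · rw [← h2, ← h4, rowFront_of_lt (by omega)]
  · rw [← h3, ← h4, rowFront_of_lt (by omega)]
end

/-- All rows of `R` are reduced, and strands with nonpositive labels do not cross. -/
def ReducedTable (n : ℕ) (R : Finset (ℤ × ℤ)) : Prop :=
  ∀ j < n, IsRow (j + 1) (rowCells n R (j + 1)) (labels n R j)

theorem finite_rowCells : (rowCells n R k).Finite := by
  refine ((R.finite_toSet.preimage (f := fun p : ℕ => ((n : ℤ) - p, k)) ?_))
  intro p _ q _ h
  simp only [Prod.mk.injEq] at h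
  omega

/-- Strands which are in increasing order have crossed. -/
theorem exists_crossAt_front {a b : ℤ} (j : ℕ)
    (hprev : ∀ r s, r < s → labels n R j r < labels n R j s →
      ∃ j' < j, ∃ p', CrossAt n R (labels n R j r) (labels n R j s) j' p') (p r s : ℕ)
    (hrs : r < s) (ha : rowFront (j + 1) (rowCells n R (j + 1)) (labels n R j) p r = a)
    (hb : rowFront (j + 1) (rowCells n R (j + 1)) (labels n R j) p s = b) (hab : a < b) :
    ∃ j' p', (j' < j ∨ j' = j ∧ p' < p) ∧ CrossAt n R a b j' p' := by
  induction p generalizing r s with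
  | zero =>
    obtain ⟨s, rfl⟩ : ∃ t, s = t + 1 := ⟨s - 1, by omega⟩
    simp only [rowFront, Nat.not_lt_zero, if_false, Nat.succ_ne_zero, Nat.add_sub_cancel] at ha hb
    rcases r with _ | r
    · simp only [if_true, rowLeft] at ha
      -- The label starting in this row is larger than all the others, so it is not the first one of
      -- an increasing pair.
      have := labels_lt n R j s
      omega
    · simp only [Nat.succ_ne_zero, if_false, Nat.add_sub_cancel] at ha
      obtain ⟨j', h1, p', h2⟩ := hprev r s (by omega) (by omega)
      exact ⟨j', p', Or.inl h1, ha ▸ hb ▸ h2⟩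
  | succ p ih =>
    by_cases hp : p ∈ rowCells n R (j + 1)
    · rw [rowFront_succ_mem hp] at ha hb
      by_cases hc : r = p ∧ s = p + 1
      · obtain ⟨rfl, rfl⟩ := hc
        rw [Equiv.swap_apply_left, rowFront_self_succ] at ha
        rw [Equiv.swap_apply_right, rowFront_self] at hb
        exact ⟨j, r, Or.inr ⟨rfl, by omega⟩, hp, Or.inr ⟨hb.symm, ha.symm⟩⟩
      · obtain ⟨j', p', h1, h2⟩ := ih _ _ (by
          rw [Equiv.swap_apply_def, Equiv.swap_apply_def]
          split_ifs <;> omega) ha hb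
        exact ⟨j', p', by omega, h2⟩
    · rw [rowFront_succ_notMem hp] at ha hb
      obtain ⟨j', p', h1, h2⟩ := ih _ _ hrs ha hb
      exact ⟨j', p', by omega, h2⟩

theorem exists_crossAt (j : ℕ) : ∀ r s, r < s → labels n R j r < labels n R j s →
    ∃ j' < j, ∃ p', CrossAt n R (labels n R j r) (labels n R j s) j' p' := by
  induction j with
  | zero =>
    intro r s hrs hlt
    rw [labels_zero, labels_zero] at hlt
    omega
  | succ j ih =>
    intro r s hrs hlt
    obtain ⟨j', p', h1, h2⟩ := exists_crossAt_front j ih (s + 1) r s hrs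
      (rowFront_of_lt (by omega)) (rowFront_of_lt (by omega)) (by rwa [labels_succ] at hlt)
    rw [labels_succ]
    exact ⟨j', by omega, p', h2⟩

theorem isState_labels_zero : IsState 1 (labels n R 0) := by
  refine ⟨fun p q h => ?_, fun p => ?_, fun p q hpq _ _ => ?_, 0, fun p _ => ?_⟩
  · simpa [labels_zero] using h
  · rw [labels_zero]; omega
  · rw [labels_zero, labels_zero]; omega
  · rw [labels_zero]; omega

/-- If the lower label at a crossing were the larger one, the pair would be increasing just before
the crossing, hence would have crossed already. The rows are treated upwards, since one reduced row
provides the `IsState` of the next. -/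
theorem reducedTable_of_noDoubleCrossing (hR : ∀ c ∈ R, 0 < c.2) (h1 : NoDoubleCrossing n R)
    (h2 : ∀ (a b : ℤ) (c : ℤ × ℤ), a ≤ 0 → b ≤ 0 → ¬ StrandsCross n R a b c) :
    ReducedTable n R := by
  have hst : ∀ j < n, IsState (j + 1) (labels n R j) →
      IsRow (j + 1) (rowCells n R (j + 1)) (labels n R j) := by
    intro j hj hs
    refine ⟨hs, by omega, finite_rowCells, fun p hp => ?_⟩
    have hcross : CrossAt n R (rowLeft (j + 1) (rowCells n R (j + 1)) (labels n R j) p)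
        (labels n R j p) j p := ⟨hp, Or.inl ⟨rfl, rfl⟩⟩
    have hlt : labels n R j p < rowLeft (j + 1) (rowCells n R (j + 1)) (labels n R j) p := by
      rcases lt_trichotomy (labels n R j p)
        (rowLeft (j + 1) (rowCells n R (j + 1)) (labels n R j) p) with h | h | h
      · exact h
      · exact absurd (hs.rowLeft_eq h.symm).1 (lt_irrefl p)
      · obtain ⟨j', p', h3, h4⟩ := exists_crossAt_front j (exists_crossAt j) p p (p + 1)
          (Nat.lt_succ_self p) rowFront_self rowFront_self_succ h
        have h5 := h1 _ _ _ _ ((strandsCross_iff hR hj).2 hcross)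
          ((strandsCross_iff hR (by omega)).2 h4)
        rw [Prod.mk.injEq] at h5
        omega
    refine ⟨?_, hlt⟩
    by_contra hle
    exact h2 _ _ _ (not_lt.1 hle) (by omega) ((strandsCross_iff hR hj).2 hcross)
  intro j hj
  refine hst j hj ?_
  induction j with
  | zero => simpa using isState_labels_zero
  | succ j ih =>
    rw [labels_succ]
    have := (hst j (by omega) (ih (by omega))).isState_rowTop
    push_cast
    exact this

theorem CrossAt.lt (h : ReducedTable n R) {a b : ℤ} (hj : j < n) (hc : CrossAt n R a b j p) :
    min a b = labels n R j p ∧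
      max a b = rowLeft (j + 1) (rowCells n R (j + 1)) (labels n R j) p ∧ min a b < max a b ∧
      0 < max a b := by
  obtain ⟨hp, hc⟩ := hc
  obtain ⟨h1, h2⟩ := (h j hj).cross p hp
  rcases hc with ⟨rfl, rfl⟩ | ⟨rfl, rfl⟩ <;> omega

theorem ReducedTable.labels_mono (h : ReducedTable n R) {j' : ℕ} (hjj : j ≤ j') (hj' : j' ≤ n) {r s : ℕ}
    (hrs : r < s) (hlt : labels n R j r < labels n R j s) :
    ∃ r' s', r' < s' ∧ labels n R j' r' = labels n R j r ∧ labels n R j' s' = labels n R j s := by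
  induction j', hjj using Nat.le_induction with
  | base => exact ⟨r, s, hrs, rfl, rfl⟩
  | succ j' hj ih =>
    obtain ⟨r', s', h1, h2, h3⟩ := ih (by omega)
    have e : ∀ t, rowFront (j' + 1) (rowCells n R (j' + 1)) (labels n R j') 0 (t + 1) =
        labels n R j' t := fun t => by simp [rowFront]
    obtain ⟨r'', s'', h4, h5, h6⟩ := (h j' (by omega)).top_mono (p := 0) (r := r' + 1)
      (s := s' + 1) (by omega) (by rw [e, e, h2, h3]; exact hlt)
    rw [e] at h5 h6
    rw [labels_succ]
    exact ⟨r'', s'', h4, h5.trans h2, h6.trans h3⟩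

/-- After a crossing the two labels are in increasing order on the front and remain so, whereas a
crossing in a reduced row takes a decreasing pair. -/
theorem ReducedTable.not_crossAt_twice (h : ReducedTable n R) {a b : ℤ} {j' p' : ℕ} (hj' : j' < n)
    (hlt : j < j' ∨ j = j' ∧ p < p') (h1 : CrossAt n R a b j p) : ¬ CrossAt n R a b j' p' := by
  intro h2
  have hj : j < n := by omega
  obtain ⟨h3, h4, h5, -⟩ := h1.lt h hj
  obtain ⟨h6, h7, -⟩ := h2.lt h hj'
  have e1 : rowFront (j + 1) (rowCells n R (j + 1)) (labels n R j) (p + 1) p = min a b := by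
    rw [rowFront_of_lt (by omega), rowTop_mem h1.1, h3]
  have e2 : rowFront (j + 1) (rowCells n R (j + 1)) (labels n R j) (p + 1) (p + 1) =
      max a b := by
    rw [rowFront_self, rowLeft_succ_mem h1.1, h4]
  have key : ∃ r s, r < s ∧
      rowFront (j' + 1) (rowCells n R (j' + 1)) (labels n R j') p' r = min a b ∧
      rowFront (j' + 1) (rowCells n R (j' + 1)) (labels n R j') p' s = max a b := by
    rcases hlt with hlt | ⟨rfl, hlt⟩
    · obtain ⟨r, s, h8, h9, h10⟩ := (h j hj).top_mono (Nat.lt_succ_self p)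
        (by rw [e1, e2]; exact h5)
      rw [← labels_succ, e1] at h9
      rw [← labels_succ, e2] at h10
      obtain ⟨r', s', h11, h12, h13⟩ := h.labels_mono (j := j + 1) (j' := j') (by omega)
        (by omega) h8 (by omega)
      have e : ∀ t, rowFront (j' + 1) (rowCells n R (j' + 1)) (labels n R j') 0 (t + 1) =
          labels n R j' t := fun t => by simp [rowFront]
      obtain ⟨r'', s'', h14, h15, h16⟩ := (h j' hj').front_mono (p := 0) (r := r' + 1)
        (s := s' + 1) (q := p') (by omega) (by rw [e, e]; omega) (by omega)
      rw [e] at h15 h16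
      exact ⟨r'', s'', h14, by omega, by omega⟩
    · obtain ⟨r, s, h8, h9, h10⟩ := (h j hj).front_mono (Nat.lt_succ_self p)
        (by rw [e1, e2]; exact h5) hlt
      exact ⟨r, s, h8, h9.trans e1, h10.trans e2⟩
  obtain ⟨r, s, h8, h9, h10⟩ := key
  have hinj := (h j' hj').toIsState.rowFront_injective (C := rowCells n R (j' + 1)) p'
  have e3 : s = p' := hinj (by rw [h10, rowFront_self, h7])
  have e4 : r = p' + 1 := hinj (by rw [h9, rowFront_self_succ, h6])
  omega

theorem ReducedTable.noDoubleCrossing (hR : ∀ c ∈ R, 0 < c.2) (h : ReducedTable n R) :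
    NoDoubleCrossing n R := by
  intro a b c d h1 h2
  obtain ⟨j, p, hj, rfl⟩ := h1.exists_eq hR
  obtain ⟨j', p', hj', rfl⟩ := h2.exists_eq hR
  rw [strandsCross_iff hR hj] at h1
  rw [strandsCross_iff hR hj'] at h2
  have h3 : ¬ (j < j' ∨ j = j' ∧ p < p') := fun h3 => h.not_crossAt_twice hj' h3 h1 h2
  have h4 : ¬ (j' < j ∨ j' = j ∧ p' < p) := fun h4 => h.not_crossAt_twice hj h4 h2 h1
  rw [Prod.mk.injEq]
  omega

theorem ReducedTable.nonpos_not_cross (hR : ∀ c ∈ R, 0 < c.2) (h : ReducedTable n R) (a b : ℤ)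
    (c : ℤ × ℤ) (ha : a ≤ 0) (hb : b ≤ 0) : ¬ StrandsCross n R a b c := by
  intro h1
  obtain ⟨j, p, hj, rfl⟩ := h1.exists_eq hR
  rw [strandsCross_iff hR hj] at h1
  have := (h1.lt h hj).2.2.2
  omega

theorem RCGraph.reducedTable (U : RCGraph n) : ReducedTable n U.cells :=
  reducedTable_of_noDoubleCrossing U.pos_of_mem U.noDoubleCrossing U.nonpos_not_cross
end

/-! ### Insertion row by row -/

section
variable {n : ℕ} {R D U : Finset (ℤ × ℤ)} {a b : ℤ} {j p r : ℕ}

/-- All cells of `R` are in columns and rows `≤ n` and in rows with positive numbers. -/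
def TableIn (n : ℕ) (R : Finset (ℤ × ℤ)) : Prop := ∀ c ∈ R, c.1 ≤ n ∧ 0 < c.2 ∧ c.2 ≤ n

theorem RCGraph.tableIn (U : RCGraph n) : TableIn n U.cells := fun c hc =>
  ⟨(U.le_of_mem c hc).1, U.pos_of_mem c hc, (U.le_of_mem c hc).2⟩

theorem TableIn.ext (hD : TableIn n D) (hU : TableIn n U)
    (h : ∀ j < n, rowCells n D (j + 1) = rowCells n U (j + 1)) : D = U := by
  have key : ∀ D U : Finset (ℤ × ℤ), TableIn n D →
      (∀ j < n, rowCells n D (j + 1) = rowCells n U (j + 1)) → D ⊆ U := by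
    intro D U hD h c hc
    obtain ⟨h1, h2, h3⟩ := hD c hc
    have h4 := h (c.2 - 1).toNat (by omega)
    have h5 : (n - c.1).toNat ∈ rowCells n D (((c.2 - 1).toNat : ℕ) + 1) := by
      rw [mem_rowCells]
      convert hc using 1
      ext <;> simp <;> omega
    rw [h4, mem_rowCells] at h5
    convert h5 using 1
    ext <;> simp <;> omega
  exact subset_antisymm (key D U hD h) (key U D hU fun j hj => (h j hj).symm)

theorem rowCells_insert_self :
    rowCells n (insert ((n : ℤ) - r, (j : ℤ) + 1) D) (j + 1) =
      insert r (rowCells n D (j + 1)) := by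
  ext s
  simp [rowCells]

theorem rowCells_insert_of_ne {j' : ℕ} (h : j' ≠ j) :
    rowCells n (insert ((n : ℤ) - r, (j : ℤ) + 1) D) (j' + 1) = rowCells n D (j' + 1) := by
  ext s
  simp [rowCells, h]

theorem rowCells_erase_self :
    rowCells n (D.erase ((n : ℤ) - r, (j : ℤ) + 1)) (j + 1) = rowCells n D (j + 1) \ {r} := by
  ext s
  simp [rowCells, and_comm]

theorem rowCells_erase_of_ne {j' : ℕ} (h : j' ≠ j) :
    rowCells n (D.erase ((n : ℤ) - r, (j : ℤ) + 1)) (j' + 1) = rowCells n D (j' + 1) := by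
  ext s
  simp [rowCells, h]

theorem labels_congr_of_le {j₀ : ℕ} (hj : j₀ ≤ j) (h0 : labels n D j₀ = labels n U j₀)
    (h : ∀ j', j₀ ≤ j' → j' < j → rowCells n D (j' + 1) = rowCells n U (j' + 1)) :
    labels n D j = labels n U j := by
  induction j, hj using Nat.le_induction with
  | base => exact h0
  | succ j hj ih =>
    rw [labels_succ, labels_succ, h j hj (by omega), ih fun j' h1 h2 => h j' h1 (by omega)]

theorem labels_congr (h : ∀ j' < j, rowCells n D (j' + 1) = rowCells n U (j' + 1)) :
    labels n D j = labels n U j :=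
  labels_congr_of_le (Nat.zero_le j) (by funext p; rw [labels_zero, labels_zero])
    fun j' _ => h j'

/-- The labels starting in the rows passed are greater than `j₀`, so the exchange fixes them and
`rowTop_comp` applies in each row. -/
theorem labels_act {j₀ : ℕ} (hj : j₀ ≤ j) (ha : a ≤ j₀) (hb : b ≤ 0)
    (h0 : labels n U j₀ = Exchange.act (some (a, b)) (labels n D j₀))
    (h : ∀ j', j₀ ≤ j' → j' < j → rowCells n U (j' + 1) = rowCells n D (j' + 1)) :
    labels n U j = Exchange.act (some (a, b)) (labels n D j) := by
  induction j, hj using Nat.le_induction with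
  | base => exact h0
  | succ j hj ih =>
    rw [labels_succ, labels_succ, h j hj (by omega), ih fun j' h1 h2 => h j' h1 (by omega)]
    funext p
    exact rowTop_comp _ (Equiv.swap_apply_of_ne_of_ne (by omega) (by omega)) p

/-- The cell `r` of row `j + 1` is an open space. -/
def OpenAt (n : ℕ) (D : Finset (ℤ × ℤ)) (j r : ℕ) : Prop :=
  r ∉ rowCells n D (j + 1) ∧
    0 < rowLeft (j + 1) (rowCells n D (j + 1)) (labels n D j) r ∧ labels n D j r ≤ 0

theorem isOpenSpace_iff (hD : TableIn n D) (hj : j < n) :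
    IsOpenSpace n D ((n : ℤ) - r) (j + 1) ↔ OpenAt n D j r := by
  have hD' : ∀ c ∈ D, 0 < c.2 := fun c hc => (hD c hc).2.1
  simp only [IsOpenSpace, strandEnters_left_iff hD' hj, strandEnters_bottom_iff hD' hj, OpenAt,
    mem_rowCells]
  constructor
  · rintro ⟨-, -, h1, x, y, h2, h3, rfl, rfl⟩
    exact ⟨h1, h2, h3⟩
  · rintro ⟨h1, h2, h3⟩
    exact ⟨by omega, by omega, h1, _, _, h2, h3, rfl, rfl⟩

theorem IsBlock.openAt {P : ℕ → Prop}
    (h : IsBlock (j + 1) (rowCells n D (j + 1)) (labels n D j) P r) : OpenAt n D j r :=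
  ⟨(h.2.2 r le_rfl h.1).1, h.2.1, (h.2.2 r le_rfl h.1).2⟩

theorem IsBlock.le_of_openAt {P : ℕ → Prop} (hP : ∀ s t, s ≤ t → P t → P s)
    (h : IsBlock (j + 1) (rowCells n D (j + 1)) (labels n D j) P r) {s : ℕ} (hs : P s)
    (ho : OpenAt n D j s) : s ≤ r := by
  by_contra hlt
  obtain ⟨s, rfl⟩ : ∃ t, s = t + 1 := ⟨s - 1, by omega⟩
  obtain ⟨h1, h2⟩ := h.2.2 s (by omega) (hP _ _ (by omega) hs)
  have := ho.2.1
  rw [rowLeft_succ_notMem h1] at this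
  omega

theorem IsBlock.isLeast_lt (hD : TableIn n D) (hj : j < n)
    (h : IsBlock (j + 1) (rowCells n D (j + 1)) (labels n D j) (· < p) r) :
    IsLeast {x : ℤ | (n : ℤ) - p < x ∧ IsOpenSpace n D x (j + 1)} ((n : ℤ) - r) := by
  have hr := h.1
  simp only at hr
  refine ⟨⟨by omega, (isOpenSpace_iff hD hj).2 h.openAt⟩, ?_⟩
  rintro x ⟨h1, h2⟩
  obtain ⟨s, rfl⟩ : ∃ s : ℕ, x = n - s := ⟨(n - x).toNat, by have := h2.1; omega⟩
  have := h.le_of_openAt (fun s t h h' => lt_of_le_of_lt h h') (by omega : s < p)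
    ((isOpenSpace_iff hD hj).1 h2)
  omega

theorem IsBlock.isLeast (hD : TableIn n D) (hj : j < n)
    (h : IsBlock (j + 1) (rowCells n D (j + 1)) (labels n D j) (fun _ => True) r) :
    IsLeast {x : ℤ | IsOpenSpace n D x (j + 1)} ((n : ℤ) - r) := by
  refine ⟨(isOpenSpace_iff hD hj).2 h.openAt, ?_⟩
  intro x h2
  obtain ⟨s, rfl⟩ : ∃ s : ℕ, x = n - s := ⟨(n - x).toNat, by have := h2.1; omega⟩
  have := h.le_of_openAt (fun s t h h' => trivial) trivial ((isOpenSpace_iff hD hj).1 h2)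
  omega

/-- The exchanges `f j`, `j ≥ j₀`, of the labels leaving row `j + 1` are passed upwards, and turn
the rows of `D` above row `j₀ + 1` into those of `U`. -/
def Propagates (n : ℕ) (D U : Finset (ℤ × ℤ)) (j₀ : ℕ) (f : ℕ → ℤ × ℤ) : Prop :=
  ∀ j, j₀ < j → j < n → RowStep (j + 1) (rowCells n D (j + 1)) (labels n D j)
    (some (f (j - 1))) (rowCells n U (j + 1)) (f j)

theorem tableIn_insert (hD : TableIn n D) (hj : j < n) :
    TableIn n (insert ((n : ℤ) - r, (j : ℤ) + 1) D) := by
  intro c hc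
  rcases Finset.mem_insert.1 hc with rfl | hc
  · simp only; omega
  · exact hD c hc

theorem OpenAt.insert_row (hD : ReducedTable n D) (hj : j < n) (ho : OpenAt n D j r) :
    IsRow (j + 1) (insert r (rowCells n D (j + 1))) (labels n D j) ∧
      Exchange.Valid (some (rowLeft (j + 1) (rowCells n D (j + 1)) (labels n D j) r,
        labels n D j r)) (labels n D (j + 1)) ∧
      rowTop (j + 1) (insert r (rowCells n D (j + 1))) (labels n D j) =
        Exchange.act (some (rowLeft (j + 1) (rowCells n D (j + 1)) (labels n D j) r,
          labels n D j r)) (labels n D (j + 1)) := by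
  rw [labels_succ]
  exact (hD j hj).insert_open ho.1 ho.2.1 ho.2.2

theorem crossAt_act {j₀ : ℕ} (hj : j₀ ≤ j) (ha : a ≤ j₀) (hb : b ≤ 0)
    (hlab : labels n U j = Exchange.act (some (a, b)) (labels n D j))
    (hrow : rowCells n U (j + 1) = rowCells n D (j + 1)) :
    CrossAt n U a b j p ↔ CrossAt n D a b j p := by
  have hfix : Equiv.swap a b ((j : ℤ) + 1) = (j : ℤ) + 1 :=
    Equiv.swap_apply_of_ne_of_ne (by omega) (by omega)
  have hL : rowLeft (j + 1) (rowCells n D (j + 1)) (Exchange.act (some (a, b)) (labels n D j)) p =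
      Equiv.swap a b (rowLeft (j + 1) (rowCells n D (j + 1)) (labels n D j) p) :=
    rowLeft_comp _ hfix p
  have hu : Exchange.act (some (a, b)) (labels n D j) p = Equiv.swap a b (labels n D j p) := rfl
  have e1 : ∀ x : ℤ, a = Equiv.swap a b x ↔ b = x := fun x => by
    rw [← Equiv.symm_apply_eq]; simp
  have e2 : ∀ x : ℤ, b = Equiv.swap a b x ↔ a = x := fun x => by
    rw [← Equiv.symm_apply_eq]; simp
  rw [CrossAt, CrossAt, hlab, hrow, hL, hu, e1, e2, e1, e2]
  tauto

/-- The strand `b` enters the cell `p + 1` of row `j + 1` from below and crosses there the strand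
`a`, which enters the row from below in column `p`. -/
def ActiveAt (n : ℕ) (D : Finset (ℤ × ℤ)) (a b : ℤ) (j p : ℕ) : Prop :=
  labels n D j p = a ∧ labels n D j (p + 1) = b ∧ p ∉ rowCells n D (j + 1) ∧
    p + 1 ∈ rowCells n D (j + 1)

theorem ActiveAt.crossAt (h : ActiveAt n D a b j p) : CrossAt n D a b j (p + 1) :=
  ⟨h.2.2.2, Or.inl ⟨by rw [rowLeft_succ_notMem h.2.2.1, h.1], h.2.1.symm⟩⟩

theorem CrossAt.symm (h : CrossAt n D a b j p) : CrossAt n D b a j p := ⟨h.1, h.2.symm⟩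

/-- The table after adding a crossing at an open space, and the exchange passed upwards. -/
theorem reduced_insert (hD : ReducedTable n D) {j₀ : ℕ} (hj₀ : j₀ < n) (ho : OpenAt n D j₀ r)
    {x : ℤ} {y : ℤ} (hx : x = rowLeft (j₀ + 1) (rowCells n D (j₀ + 1)) (labels n D j₀) r)
    (hy : y = labels n D j₀ r) {T : Finset (ℤ × ℤ)}
    (hT : ∀ j < j₀, rowCells n T (j + 1) = rowCells n D (j + 1))
    (hT₀ : rowCells n T (j₀ + 1) = insert r (rowCells n D (j₀ + 1))) {j₁ : ℕ} (hj₁ : j₁ ≤ n)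
    (hT₁ : ∀ j, j₀ < j → j < j₁ → rowCells n T (j + 1) = rowCells n D (j + 1)) :
    (∀ j ≤ j₀, labels n T j = labels n D j) ∧
      (∀ j, j₀ < j → j ≤ j₁ → labels n T j = Exchange.act (some (x, y)) (labels n D j)) ∧
      ((∀ j, j₀ < j → j < j₁ → ∀ p, ¬ ActiveAt n D x y j p) →
        (∀ j < j₁, IsRow (j + 1) (rowCells n T (j + 1)) (labels n T j)) ∧
        ∀ j, j₀ < j → j ≤ j₁ → Exchange.Valid (some (x, y)) (labels n D j)) := by
  have hlow : ∀ j ≤ j₀, labels n T j = labels n D j := fun j hj =>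
    labels_congr fun j' hj' => hT j' (by omega)
  obtain ⟨h1, h2, h3⟩ := ho.insert_row hD hj₀
  rw [← hx, ← hy] at h2 h3
  have hxle : x ≤ (j₀ + 1 : ℕ) := by
    obtain ⟨-, -, p, -, -, h4, -⟩ := h2
    have := labelsFrom_le n D 0 (j₀ + 1) p
    simp only [labels] at h4
    omega
  have hup : labels n T (j₀ + 1) = Exchange.act (some (x, y)) (labels n D (j₀ + 1)) := by
    rw [labels_succ, hT₀, hlow j₀ le_rfl, h3]
  have hupj : ∀ j, j₀ < j → j ≤ j₁ →
      labels n T j = Exchange.act (some (x, y)) (labels n D j) := fun j hj hj' =>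
    labels_act (j₀ := j₀ + 1) hj hxle h2.2.1 hup fun j' h4 h5 => hT₁ j' (by omega) (by omega)
  refine ⟨hlow, hupj, fun hact => ?_⟩
  have hv : ∀ j, j₀ < j → j ≤ j₁ → Exchange.Valid (some (x, y)) (labels n D j) := by
    intro j hj hj'
    induction j, hj using Nat.le_induction with
    | base => exact h2
    | succ j hj ih =>
      have h4 := (hD j (by omega)).act_of_pass (ih (by omega)) fun p e1 e2 e3 e4 =>
        hact j hj (by omega) p ⟨e1, e2, e3, e4⟩
      rw [labels_succ]
      exact h4.2.1
  refine ⟨fun j hj => ?_, hv⟩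
  rcases lt_trichotomy j j₀ with h4 | rfl | h4
  · rw [hlow j h4.le, hT j h4]; exact hD j (by omega)
  · rw [hlow j le_rfl, hT₀]; exact h1
  · rw [hupj j h4 hj.le, hT₁ j h4 hj]
    exact ((hD j (by omega)).act_of_pass (hv j h4 hj.le) fun p e1 e2 e3 e4 =>
      hact j h4 hj p ⟨e1, e2, e3, e4⟩).1

/-- Induction on a bound for the rows that remain, as each removed crossing lies in a higher row
than the added one. The new crossing exchanges the labels `x` and `y` above row `j₀ + 1`. If the two
strands cross again, then, once this crossing is removed, the table is reduced and above that row
its labels are those of `D`, so the induction hypothesis applies. If not, every higher row lets the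
exchange pass and the algorithm stops. -/
theorem insertAt_spec (m : ℕ) : ∀ (D : Finset (ℤ × ℤ)) (j₀ r : ℕ), n - j₀ ≤ m → j₀ < n →
    TableIn n D → ReducedTable n D → OpenAt n D j₀ r →
    (∃ U, InsertAt n D ((n : ℤ) - r, (j₀ : ℤ) + 1) U) ∧
    ∀ U, InsertAt n D ((n : ℤ) - r, (j₀ : ℤ) + 1) U → TableIn n U ∧
      ∃ f : ℕ → ℤ × ℤ,
        f j₀ = (rowLeft (j₀ + 1) (rowCells n D (j₀ + 1)) (labels n D j₀) r, labels n D j₀ r) ∧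
        (∀ j < j₀, rowCells n U (j + 1) = rowCells n D (j + 1)) ∧
        rowCells n U (j₀ + 1) = insert r (rowCells n D (j₀ + 1)) ∧ Propagates n D U j₀ f := by
  induction m with
  | zero => intro D j₀ r h1 h2; omega
  | succ m ih =>
  intro D j₀ r hm hj₀ hin hD ho
  obtain ⟨x, hx⟩ : ∃ x, x = rowLeft (j₀ + 1) (rowCells n D (j₀ + 1)) (labels n D j₀) r := ⟨_, rfl⟩
  obtain ⟨y, hy⟩ : ∃ y, y = labels n D j₀ r := ⟨_, rfl⟩
  rw [← hx, ← hy]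
  obtain ⟨T, hTdef⟩ : ∃ T, T = insert ((n : ℤ) - r, (j₀ : ℤ) + 1) D := ⟨_, rfl⟩
  have hTin : TableIn n T := hTdef ▸ tableIn_insert hin hj₀
  have hTpos : ∀ c ∈ T, 0 < c.2 := fun c hc => (hTin c hc).2.1
  have hT₀ : rowCells n T (j₀ + 1) = insert r (rowCells n D (j₀ + 1)) := by
    rw [hTdef, rowCells_insert_self]
  have hT : ∀ j, j ≠ j₀ → rowCells n T (j + 1) = rowCells n D (j + 1) := fun j hj => by
    rw [hTdef, rowCells_insert_of_ne hj]
  obtain ⟨hlow, hup, hred⟩ := reduced_insert hD hj₀ ho hx hy (fun j hj => hT j hj.ne) hT₀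
    le_rfl (fun j hj _ => hT j hj.ne')
  by_cases hact : ∃ j, j₀ < j ∧ j < n ∧ ∃ p, ActiveAt n D x y j p
  · -- the first row in which the two strands cross again
    classical
    obtain ⟨j₁, ⟨hj₁, hj₁n, p, hp⟩, hmin⟩ : ∃ j₁, (j₀ < j₁ ∧ j₁ < n ∧ ∃ p, ActiveAt n D x y j₁ p) ∧
        ∀ j < j₁, ¬ (j₀ < j ∧ j < n ∧ ∃ p, ActiveAt n D x y j p) :=
      ⟨Nat.find hact, Nat.find_spec hact, fun j => Nat.find_min hact⟩
    have hmin' : ∀ j, j₀ < j → j < j₁ → ∀ p, ¬ ActiveAt n D x y j p := fun j h1 h2 p h3 =>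
      hmin j h2 ⟨h1, by omega, p, h3⟩
    obtain ⟨-, -, hred₁⟩ := reduced_insert hD hj₀ ho hx hy (fun j hj => hT j hj.ne) hT₀
      hj₁n.le (fun j hj _ => hT j hj.ne')
    obtain ⟨-, hval⟩ := hred₁ hmin'
    have hv₁ := hval j₁ hj₁ le_rfl
    have hxle : x ≤ (j₀ + 1 : ℕ) := by
      obtain ⟨-, -, p, -, -, h4, -⟩ := hval (j₀ + 1) (by omega) (by omega)
      have := labelsFrom_le n D 0 (j₀ + 1) p
      simp only [labels] at h4
      omega
    have hy0 : y ≤ 0 := hy ▸ ho.2.2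
    -- the two crossings
    have hc₀ : CrossAt n T x y j₀ r := by
      refine ⟨hT₀ ▸ Set.mem_insert _ _, Or.inl ⟨?_, ?_⟩⟩
      · rw [hT₀, rowLeft_insert_of_le le_rfl, hlow j₀ le_rfl, hx]
      · rw [hlow j₀ le_rfl, hy]
    have hiff : ∀ j, j₀ < j → j < n → ∀ p, CrossAt n T x y j p ↔ CrossAt n D x y j p :=
      fun j h1 h2 p => crossAt_act (j₀ := j₀ + 1) h1 hxle hy0 (hup j h1 h2.le) (hT j h1.ne')
    have hc₁ : CrossAt n T x y j₁ (p + 1) := (hiff j₁ hj₁ hj₁n _).2 hp.crossAt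
    have hnd : ¬ NoDoubleCrossing n T := by
      intro h
      have := h x y _ _ ((strandsCross_iff hTpos hj₀).2 hc₀) ((strandsCross_iff hTpos hj₁n).2 hc₁)
      rw [Prod.mk.injEq] at this
      omega
    obtain ⟨D', hD'def⟩ : ∃ D', D' = T.erase ((n : ℤ) - (p + 1 : ℕ), (j₁ : ℤ) + 1) := ⟨_, rfl⟩
    have hD'in : TableIn n D' := fun c hc => hTin c (Finset.mem_of_mem_erase (hD'def ▸ hc))
    have hrow₁ : rowCells n D' (j₁ + 1) = rowCells n D (j₁ + 1) \ {p + 1} := by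
      rw [hD'def, rowCells_erase_self, hT j₁ hj₁.ne']
    have hrow : ∀ j, j ≠ j₁ → rowCells n D' (j + 1) = rowCells n T (j + 1) := fun j hj => by
      rw [hD'def, rowCells_erase_of_ne hj]
    obtain ⟨hlow', hup', hred'⟩ := reduced_insert (T := D') hD hj₀ ho hx hy
      (fun j hj => by rw [hrow j (by omega), hT j hj.ne]) (by rw [hrow j₀ (by omega), hT₀])
      hj₁n.le (fun j hj hj' => by rw [hrow j hj'.ne, hT j hj.ne'])
    obtain ⟨hred₂, -⟩ := hred' hmin'
    obtain ⟨e1, e2, e3, e4⟩ := hp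
    obtain ⟨herow, hetop⟩ := (hD j₁ hj₁n).erase hv₁.1 hv₁.2.1 e1 e2 e3 e4
    have hlab₁ := hup' j₁ hj₁ le_rfl
    have hlab : ∀ j, j₁ < j → labels n D' j = labels n D j := fun j hj =>
      labels_congr_of_le (j₀ := j₁ + 1) hj (by rw [labels_succ, labels_succ, hrow₁, hlab₁, hetop])
        fun j' h1 _ => by rw [hrow j' (by omega), hT j' (by omega)]
    have hD'red : ReducedTable n D' := by
      intro j hj
      rcases lt_trichotomy j j₁ with h1 | rfl | h1
      · exact hred₂ j h1
      · rw [hrow₁, hlab₁]; exact herow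
      · rw [hrow j h1.ne', hT j (by omega), hlab j h1]; exact hD j hj
    obtain ⟨r', hr'⟩ := herow.exists_isBlock (p := p) (fun h => e3 h.1)
      (by rw [act_left e1]; exact hv₁.2.1)
    have hblock : IsBlock (j₁ + 1) (rowCells n D' (j₁ + 1)) (labels n D' j₁) (· < p + 1) r' := by
      rw [hrow₁, hlab₁]; exact hr'
    have hleast := hblock.isLeast_lt hD'in hj₁n
    obtain ⟨⟨U, hU⟩, hspec⟩ := ih D' j₁ r' (by omega) hj₁n hD'in hD'red hblock.openAt
    refine ⟨⟨U, ?_⟩, ?_⟩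
    · refine InsertAt.step (d := ((n : ℤ) - (p + 1 : ℕ), (j₁ : ℤ) + 1)) (a := x) (b := y)
        (i := (n : ℤ) - r') ?_ ?_ ?_ ?_ ?_ ?_
      · rwa [← hTdef]
      · rw [← hTdef]; exact (strandsCross_iff hTpos hj₀).2 hc₀
      · rw [← hTdef]; exact (strandsCross_iff hTpos hj₁n).2 hc₁
      · simp only; omega
      · rw [← hTdef, ← hD'def]; exact hleast
      · rw [← hTdef, ← hD'def]; exact hU
    · intro U' hU'
      cases hU' with
      | done h => exact absurd (hTdef ▸ h) hnd
      | step h1 h2 h3 h4 h5 h6 =>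
        rename_i d a' b' i
        rw [← hTdef] at h2 h3 h5 h6
        obtain ⟨j', p', hj', rfl⟩ := h3.exists_eq hTpos
        rw [strandsCross_iff hTpos hj₀] at h2
        rw [strandsCross_iff hTpos hj'] at h3
        simp only at h4 h5 h6
        -- The strands named by the algorithm are `x` and `y` in some order. Their second crossing
        -- is already one in `D`, where they cross at most once, so the removed cell is unique.
        have hc' : CrossAt n D x y j' p' := by
          rw [← hiff j' (by omega) hj']
          rcases hc₀.2 with ⟨q1, q2⟩ | ⟨q1, q2⟩ <;> rcases h2.2 with ⟨q3, q4⟩ | ⟨q3, q4⟩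
          · rw [q1, ← q3, q2, ← q4]; exact h3
          · rw [q1, ← q3, q2, ← q4]; exact h3.symm
          · rw [q1, ← q3, q2, ← q4]; exact h3.symm
          · rw [q1, ← q3, q2, ← q4]; exact h3
        have hcD : CrossAt n D x y j₁ (p + 1) := (hiff j₁ hj₁ hj₁n _).1 hc₁
        have q1 : ¬ (j' < j₁ ∨ j' = j₁ ∧ p' < p + 1) := fun q =>
          hD.not_crossAt_twice hj₁n q hc' hcD
        have q2 : ¬ (j₁ < j' ∨ j₁ = j' ∧ p + 1 < p') := fun q =>
          hD.not_crossAt_twice hj' q hcD hc'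
        obtain rfl : j' = j₁ := by omega
        obtain rfl : p' = p + 1 := by omega
        rw [← hD'def] at h5 h6
        obtain rfl := h5.unique hleast
        obtain ⟨hin', f, hf, hf1, hf2, hf3⟩ := hspec U' h6
        -- The exchange `(x, y)` is passed on until it becomes active; from there on the exchanges
        -- are those of the recursive call.
        refine ⟨hin', fun j => if j < j' then (x, y) else f j, by simp [hj₁], ?_, ?_, ?_⟩
        · intro j hj
          rw [hf1 j (by omega), hrow j (by omega), hT j (by omega)]
        · rw [hf1 j₀ hj₁, hrow j₀ (by omega), hT₀]
        · intro j q3 q4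
          rcases lt_trichotomy j j' with q5 | rfl | q5
          · rw [hf1 j q5, hrow j q5.ne, hT j q3.ne']
            simp only [q5, show j - 1 < j' by omega, if_true]
            exact .pass fun s q6 q7 q8 q9 => hmin' j q3 q5 s ⟨q6, q7, q8, q9⟩
          · rw [hf2, hrow₁]
            simp only [show j - 1 < j by omega, lt_irrefl, if_true, if_false, hf]
            rw [hrow₁, hlab₁]
            exact .bump e1 e2 e3 e4 hr'
          · have q6 := hf3 j q5 q4
            rw [hrow j q5.ne', hT j q3.ne', hlab j q5] at q6
            simp only [show ¬ j < j' by omega, show ¬ j - 1 < j' by omega, if_false]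
            exact q6
  · push Not at hact
    have hact' : ∀ j, j₀ < j → j < n → ∀ p, ¬ ActiveAt n D x y j p := hact
    obtain ⟨hTred, -⟩ := hred hact'
    have hnd : NoDoubleCrossing n T := ReducedTable.noDoubleCrossing hTpos hTred
    refine ⟨⟨T, hTdef ▸ InsertAt.done (hTdef ▸ hnd)⟩, ?_⟩
    intro U hU
    have hUT : U = T := by
      cases hU with
      | done h => exact hTdef.symm
      | step h1 => exact absurd (hTdef ▸ hnd) h1
    subst hUT
    refine ⟨hTin, fun _ => (x, y), rfl, fun j hj => hT j hj.ne, hT₀, fun j h1 h2 => ?_⟩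
    rw [hT j h1.ne']
    exact .pass fun s q6 q7 q8 q9 => hact' j h1 h2 s ⟨q6, q7, q8, q9⟩
end

/-! ### An insertion as a chain of row steps. -/

section
variable {n : ℕ} {R R' R₁ R₂ R₃ S₁ S₂ S₃ U U' : Finset (ℤ × ℤ)} {k : ℕ} {f f' g : ℕ → ℤ × ℤ}

/-- The exchange of the labels entering row `j + 1`, when the number `k` is inserted and `f`
records the exchanges of the labels leaving the rows. -/
def exchangeInto (k : ℕ) (f : ℕ → ℤ × ℤ) (j : ℕ) : Exchange :=
  if j + 1 = k then none else some (f (j - 1))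

theorem exchangeInto_self {j : ℕ} (h : j + 1 = k) : exchangeInto k f j = none := by
  simp [exchangeInto, h]

theorem exchangeInto_of_ne {j : ℕ} (h : j + 1 ≠ k) : exchangeInto k f j = some (f (j - 1)) := by
  simp [exchangeInto, h]

/-- `U` arises from `R` by inserting the number `k`, row by row. -/
structure InsertRows (n : ℕ) (R : Finset (ℤ × ℤ)) (k : ℕ) (U : Finset (ℤ × ℤ))
    (f : ℕ → ℤ × ℤ) : Prop where
  pos : 0 < k
  low : ∀ j, j + 1 < k → rowCells n U (j + 1) = rowCells n R (j + 1)
  step : ∀ j < n, k ≤ j + 1 → RowStep (j + 1) (rowCells n R (j + 1)) (labels n R j)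
    (exchangeInto k f j) (rowCells n U (j + 1)) (f j)

theorem InsertRows.labels_low (h : InsertRows n R k U f) {j : ℕ} (hj : j + 1 ≤ k) :
    labels n U j = labels n R j :=
  labels_congr fun j' hj' => h.low j' (by omega)

theorem InsertRows.labels_eq (h : InsertRows n R k U f) (hR : ReducedTable n R) {j : ℕ}
    (hj : j ≤ n) (hk : k ≤ j + 1) : (exchangeInto k f j).Valid (labels n R j) ∧
      labels n U j = (exchangeInto k f j).act (labels n R j) := by
  induction j with
  | zero =>
    -- For `j = 0` the letter can only be 1, which starts in this row; the truncated `j - 1` in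
    -- `exchangeInto` is not used.
    have := h.pos
    rw [exchangeInto_self (by omega)]
    exact ⟨trivial, h.labels_low (by omega)⟩
  | succ j ih =>
    by_cases he : j + 1 + 1 = k
    · rw [exchangeInto_self he]
      exact ⟨trivial, h.labels_low (by omega)⟩
    · obtain ⟨h1, h2⟩ := ih (by omega) (by omega)
      obtain ⟨h3, h4, h5⟩ := (h.step j (by omega) (by omega)).isRow (hR j (by omega)) h1
      rw [exchangeInto_of_ne he, labels_succ, labels_succ, h2]
      exact ⟨h4, h5⟩

theorem InsertRows.reducedTable (h : InsertRows n R k U f) (hR : ReducedTable n R) :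
    ReducedTable n U := by
  intro j hj
  rcases Nat.lt_or_ge (j + 1) k with h1 | h1
  · rw [h.low j h1, h.labels_low h1.le]
    exact hR j hj
  · obtain ⟨h2, h3⟩ := h.labels_eq hR hj.le h1
    rw [h3]
    exact ((h.step j hj h1).isRow (hR j hj) h2).1

/-- Row steps are deterministic and see only their own row and the labels coming from below, so
nothing in the higher rows matters. -/
theorem InsertRows.congr_below (h : InsertRows n R k U f) (h' : InsertRows n R' k U' f')
    (hR : ReducedTable n R) (m : ℕ)
    (hrow : ∀ j, j + 1 < m → rowCells n R (j + 1) = rowCells n R' (j + 1)) {j : ℕ} (hj : j < n)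
    (hm : j + 1 < m) : rowCells n U (j + 1) = rowCells n U' (j + 1) ∧
      (k ≤ j + 1 → f j = f' j) := by
  induction j using Nat.strong_induction_on with
  | _ j ih =>
    rcases Nat.lt_or_ge (j + 1) k with h1 | h1
    · exact ⟨by rw [h.low j h1, h'.low j h1, hrow j hm], fun h2 => by omega⟩
    · have h2 := h.step j hj h1
      have h3 := h'.step j hj h1
      have hlab : labels n R j = labels n R' j := labels_congr fun j' hj' => hrow j' (by omega)
      have he : exchangeInto k f j = exchangeInto k f' j := by
        by_cases he : j + 1 = k
        · rw [exchangeInto_self he, exchangeInto_self he]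
        · have := h.pos
          rw [exchangeInto_of_ne he, exchangeInto_of_ne he,
            (ih (j - 1) (by omega) (by omega) (by omega)).2 (by omega)]
      rw [← hrow j hm, ← hlab, ← he] at h3
      obtain ⟨h4, h5⟩ := h2.unique (hR j hj).inj h3
      exact ⟨h4, fun _ => h5⟩

/-- In row `k₂` the second letter is just starting, which counts as infinitely far to the right;
`RowStep.asc` carries this order upwards. -/
theorem InsertRows.asc {k₁ k₂ : ℕ} (h₁ : InsertRows n R k₁ R₁ f) (h₂ : InsertRows n R₁ k₂ R₂ g)
    (hR : ReducedTable n R) (hk : k₁ ≤ k₂) {j : ℕ} (hj : j < n) (hkj : k₂ ≤ j + 1) :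
    (exchangeInto k₁ f j).Asc (exchangeInto k₂ g j) ∧
      Exchange.Asc (some (f j)) (some (g j)) := by
  have hR₁ := h₁.reducedTable hR
  induction j with
  | zero =>
    have e : (exchangeInto k₁ f 0).Asc (exchangeInto k₂ g 0) := by
      rw [exchangeInto_self (k := k₂) (by have := h₂.pos; omega)]; trivial
    obtain ⟨v₁, l₁⟩ := h₁.labels_eq hR hj.le (by omega)
    obtain ⟨v₂, -⟩ := h₂.labels_eq hR₁ hj.le hkj
    have s₂ := h₂.step 0 hj hkj
    rw [l₁] at v₂ s₂
    exact ⟨e, RowStep.asc (hR 0 hj) v₁ v₂ (h₁.step 0 hj (by omega)) s₂ e⟩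
  | succ j ih =>
    have e : (exchangeInto k₁ f (j + 1)).Asc (exchangeInto k₂ g (j + 1)) := by
      by_cases he : j + 1 + 1 = k₂
      · rw [exchangeInto_self (k := k₂) he]; trivial
      · rw [exchangeInto_of_ne he, exchangeInto_of_ne (by omega)]
        exact (ih (by omega) (by omega)).2
    obtain ⟨v₁, l₁⟩ := h₁.labels_eq hR hj.le (by omega)
    obtain ⟨v₂, -⟩ := h₂.labels_eq hR₁ hj.le hkj
    have s₂ := h₂.step (j + 1) hj hkj
    rw [l₁] at v₂ s₂
    exact ⟨e, RowStep.asc (hR _ hj) v₁ v₂ (h₁.step _ hj (by omega)) s₂ e⟩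

/-- In row `k₁` the first letter is just starting while the second insertion is already under way,
so the pair is not ascending there; `RowStep.desc` carries this upwards. -/
theorem InsertRows.desc {k₁ k₂ : ℕ} (h₁ : InsertRows n R k₁ R₁ f) (h₂ : InsertRows n R₁ k₂ R₂ g)
    (hR : ReducedTable n R) (hk : k₂ < k₁) {j : ℕ} (hj : j < n) (hkj : k₁ ≤ j + 1) :
    ¬ (exchangeInto k₁ f j).Asc (exchangeInto k₂ g j) ∧
      ¬ Exchange.Asc (some (f j)) (some (g j)) := by
  have hR₁ := h₁.reducedTable hR
  have hpos := h₂.pos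
  have key : ∀ j, j < n → k₁ ≤ j + 1 → ¬ (exchangeInto k₁ f j).Asc (exchangeInto k₂ g j) →
      ¬ Exchange.Asc (some (f j)) (some (g j)) := by
    intro j hj hkj e
    obtain ⟨v₁, l₁⟩ := h₁.labels_eq hR hj.le hkj
    obtain ⟨v₂, -⟩ := h₂.labels_eq hR₁ hj.le (by omega)
    have s₂ := h₂.step j hj (by omega)
    rw [l₁] at v₂ s₂
    exact not_lt.2 (RowStep.desc (hR j hj) v₁ v₂ (h₁.step j hj hkj) s₂ e)
  induction j with
  | zero => omega
  | succ j ih =>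
    have e : ¬ (exchangeInto k₁ f (j + 1)).Asc (exchangeInto k₂ g (j + 1)) := by
      rw [exchangeInto_of_ne (k := k₂) (by omega)]
      by_cases he : j + 1 + 1 = k₁
      · rw [exchangeInto_self he]; exact fun h => h
      · rw [exchangeInto_of_ne he]
        exact (ih (by omega) (by omega)).2
    exact ⟨e, key _ hj hkj e⟩

/-- If two insertions of three numbers agree below row `m`, and the exchanges entering row `m` are
related, then the results agree. -/
theorem InsertRows.eq_of_knuthRel {c₁ c₂ c₃ d₁ d₂ d₃ : ℕ} {f₁ f₂ f₃ g₁ g₂ g₃ : ℕ → ℤ × ℤ}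
    (hR : ReducedTable n R) (h₁ : InsertRows n R c₁ R₁ f₁) (h₂ : InsertRows n R₁ c₂ R₂ f₂)
    (h₃ : InsertRows n R₂ c₃ R₃ f₃) (k₁ : InsertRows n R d₁ S₁ g₁) (k₂ : InsertRows n S₁ d₂ S₂ g₂)
    (k₃ : InsertRows n S₂ d₃ S₃ g₃) (m : ℕ) (hc : c₁ ≤ m + 1 ∧ c₂ ≤ m + 1 ∧ c₃ ≤ m + 1)
    (hd : d₁ ≤ m + 1 ∧ d₂ ≤ m + 1 ∧ d₃ ≤ m + 1)
    (hK : KnuthRel (exchangeInto c₁ f₁ m) (exchangeInto c₂ f₂ m) (exchangeInto c₃ f₃ m)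
      (exchangeInto d₁ g₁ m) (exchangeInto d₂ g₂ m) (exchangeInto d₃ g₃ m)) {j : ℕ} (hmj : m ≤ j)
    (hj : j < n) : rowCells n R₃ (j + 1) = rowCells n S₃ (j + 1) := by
  have hR₁ := h₁.reducedTable hR
  have hR₂ := h₂.reducedTable hR₁
  have hS₁ := k₁.reducedTable hR
  have hS₂ := k₂.reducedTable hS₁
  have aux : ∀ {c₁ c₂ c₃ : ℕ} {f₁ f₂ f₃ : ℕ → ℤ × ℤ} {R₁ R₂ R₃ : Finset (ℤ × ℤ)},
      InsertRows n R c₁ R₁ f₁ → InsertRows n R₁ c₂ R₂ f₂ → InsertRows n R₂ c₃ R₃ f₃ →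
      ReducedTable n R₁ → ReducedTable n R₂ → c₁ ≤ m + 1 ∧ c₂ ≤ m + 1 ∧ c₃ ≤ m + 1 →
      ∀ j, m ≤ j → j < n →
      ValidChain (exchangeInto c₁ f₁ j) (exchangeInto c₂ f₂ j) (exchangeInto c₃ f₃ j)
        (labels n R j) ∧
      RowSteps (j + 1) (rowCells n R (j + 1)) (labels n R j) (exchangeInto c₁ f₁ j)
        (exchangeInto c₂ f₂ j) (exchangeInto c₃ f₃ j) (rowCells n R₃ (j + 1)) (f₁ j) (f₂ j)
        (f₃ j) := by
    intro c₁ c₂ c₃ f₁ f₂ f₃ R₁ R₂ R₃ h₁ h₂ h₃ hR₁ hR₂ hc j hmj hj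
    obtain ⟨v₁, l₁⟩ := h₁.labels_eq hR hj.le (by omega)
    obtain ⟨v₂, l₂⟩ := h₂.labels_eq hR₁ hj.le (by omega)
    obtain ⟨v₃, -⟩ := h₃.labels_eq hR₂ hj.le (by omega)
    have s₁ := h₁.step j hj (by omega)
    have s₂ := h₂.step j hj (by omega)
    have s₃ := h₃.step j hj (by omega)
    rw [l₁] at l₂ v₂ s₂
    rw [l₂] at v₃ s₃
    exact ⟨⟨v₁, v₂, v₃⟩, _, _, s₁, s₂, s₃⟩
  have step : ∀ j, m ≤ j → j < n →
      KnuthRel (exchangeInto c₁ f₁ j) (exchangeInto c₂ f₂ j) (exchangeInto c₃ f₃ j)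
        (exchangeInto d₁ g₁ j) (exchangeInto d₂ g₂ j) (exchangeInto d₃ g₃ j) →
      rowCells n R₃ (j + 1) = rowCells n S₃ (j + 1) ∧
        KnuthRel (some (f₁ j)) (some (f₂ j)) (some (f₃ j)) (some (g₁ j)) (some (g₂ j))
          (some (g₃ j)) := by
    intro j hmj hj hK
    obtain ⟨v, s⟩ := aux h₁ h₂ h₃ hR₁ hR₂ hc j hmj hj
    obtain ⟨v', s'⟩ := aux k₁ k₂ k₃ hS₁ hS₂ hd j hmj hj
    exact hK.rowSteps (hR j hj) v v' s s'
  have main : ∀ j, m ≤ j → j < n →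
      KnuthRel (exchangeInto c₁ f₁ j) (exchangeInto c₂ f₂ j) (exchangeInto c₃ f₃ j)
        (exchangeInto d₁ g₁ j) (exchangeInto d₂ g₂ j) (exchangeInto d₃ g₃ j) := by
    intro j hmj
    induction j, hmj using Nat.le_induction with
    | base => exact fun _ => hK
    | succ j hmj ih =>
      intro hj
      rw [exchangeInto_of_ne, exchangeInto_of_ne, exchangeInto_of_ne, exchangeInto_of_ne,
        exchangeInto_of_ne, exchangeInto_of_ne]
      · exact (step j hmj (by omega) (ih (by omega))).2
      all_goals omega
  exact (step j hmj hj (main j hmj hj)).1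

/-- The relation `y x z = y z x` for `x < y ≤ z`. -/
theorem InsertRows.knuth_first {x y z : ℕ} {f₁ f₂ f₃ g₂ g₃ : ℕ → ℤ × ℤ} (hxy : x < y)
    (hyz : y ≤ z) (hR : ReducedTable n R) (h₁ : InsertRows n R y R₁ f₁)
    (h₂ : InsertRows n R₁ x R₂ f₂) (h₃ : InsertRows n R₂ z R₃ f₃)
    (k₂ : InsertRows n R₁ z S₂ g₂) (k₃ : InsertRows n S₂ x S₃ g₃) :
    ∀ j < n, rowCells n R₃ (j + 1) = rowCells n S₃ (j + 1) := by
  intro j hj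
  have hR₁ := h₁.reducedTable hR
  have hlow : ∀ j, j < n → j + 1 < z → rowCells n R₂ (j + 1) = rowCells n S₃ (j + 1) ∧
      (x ≤ j + 1 → f₂ j = g₃ j) := fun j hj hjz =>
    h₂.congr_below k₃ hR₁ z (fun j' hj' => (k₂.low j' hj').symm) hj hjz
  rcases Nat.lt_or_ge (j + 1) z with hjz | hjz
  · rw [h₃.low j hjz]
    exact (hlow j hj hjz).1
  · obtain ⟨m, rfl⟩ : ∃ m, z = m + 1 := ⟨z - 1, by have := h₃.pos; omega⟩
    refine InsertRows.eq_of_knuthRel hR h₁ h₂ h₃ h₁ k₂ k₃ m (by omega) (by omega) ?_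
      (Nat.succ_le_succ_iff.1 hjz) hj
    -- Below row `z` the insertion of `z` changes nothing, so the exchange of `x` arrives at row `z`
    -- in the same form on both sides.
    have e : exchangeInto x g₃ m = exchangeInto x f₂ m := by
      have := h₂.pos
      rw [exchangeInto_of_ne (by omega), exchangeInto_of_ne (by omega),
        (hlow (m - 1) (by omega) (by omega)).2 (by omega)]
    rw [e, exchangeInto_self (k := m + 1) rfl, exchangeInto_self (k := m + 1) rfl]
    refine .first (h₁.desc h₂ hR hxy (by omega) hyz).1 ?_
    trivial

/-- The relation `z x y = x z y` for `x ≤ y < z`. -/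
theorem InsertRows.knuth_last {x y z : ℕ} {f₁ f₂ f₃ g₁ g₂ g₃ : ℕ → ℤ × ℤ} (hxy : x ≤ y)
    (hyz : y < z) (hR : ReducedTable n R) (h₁ : InsertRows n R z R₁ f₁)
    (h₂ : InsertRows n R₁ x R₂ f₂) (h₃ : InsertRows n R₂ y R₃ f₃)
    (k₁ : InsertRows n R x S₁ g₁) (k₂ : InsertRows n S₁ z S₂ g₂) (k₃ : InsertRows n S₂ y S₃ g₃) :
    ∀ j < n, rowCells n R₃ (j + 1) = rowCells n S₃ (j + 1) := by
  intro j hj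
  have hR₁ := h₁.reducedTable hR
  have hR₂ := h₂.reducedTable hR₁
  have hlow₁ : ∀ j, j < n → j + 1 < z → rowCells n R₂ (j + 1) = rowCells n S₁ (j + 1) ∧
      (x ≤ j + 1 → f₂ j = g₁ j) := fun j hj hjz =>
    h₂.congr_below k₁ hR₁ z (fun j' hj' => h₁.low j' hj') hj hjz
  have hlow : ∀ j, j < n → j + 1 < z → rowCells n R₃ (j + 1) = rowCells n S₃ (j + 1) ∧
      (y ≤ j + 1 → f₃ j = g₃ j) := fun j hj hjz =>
    -- The minimum with `n + 1` keeps the compared rows inside the table, where `hlow₁` is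
    -- available.
    h₃.congr_below k₃ hR₂ (min z (n + 1)) (fun j' hj' => by
      rw [(hlow₁ j' (by omega) (by omega)).1, k₂.low j' (by omega)]) hj (by omega)
  rcases Nat.lt_or_ge (j + 1) z with hjz | hjz
  · exact (hlow j hj hjz).1
  · obtain ⟨m, rfl⟩ : ∃ m, z = m + 1 := ⟨z - 1, by have := h₁.pos; omega⟩
    refine InsertRows.eq_of_knuthRel hR h₁ h₂ h₃ k₁ k₂ k₃ m (by omega) (by omega) ?_
      (Nat.succ_le_succ_iff.1 hjz) hj
    have hx := h₂.pos
    have e₁ : exchangeInto x g₁ m = exchangeInto x f₂ m := by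
      rw [exchangeInto_of_ne (by omega), exchangeInto_of_ne (by omega),
        (hlow₁ (m - 1) (by omega) (by omega)).2 (by omega)]
    have e₃ : exchangeInto y g₃ m = exchangeInto y f₃ m := by
      rw [exchangeInto_of_ne (by omega), exchangeInto_of_ne (by omega),
        (hlow (m - 1) (by omega) (by omega)).2 (by omega)]
    rw [e₁, e₃, exchangeInto_self (k := m + 1) rfl, exchangeInto_self (k := m + 1) rfl]
    refine .last (h₂.asc h₃ hR₁ hxy (by omega) (by omega)).1 ?_
    rw [exchangeInto_of_ne (by omega)]
    exact fun h => h
end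

/-! ### Well-definedness of insertion into rc-graphs. -/

namespace RCGraph
variable {n : ℕ} {R S S' U : RCGraph n} {k : ℕ}

theorem InsertLetter.exists_insertRows (hk : 1 ≤ k ∧ k ≤ n) (h : R.InsertLetter k U) :
    ∃ f, InsertRows n R.cells k U.cells f := by
  obtain ⟨j₀, rfl⟩ : ∃ j, k = j + 1 := ⟨k - 1, by omega⟩
  obtain ⟨i, hi, hU⟩ := h
  have hj₀ : j₀ < n := by omega
  obtain ⟨r, hr⟩ := (R.reducedTable j₀ hj₀).exists_isBlock_true
  push_cast at hi hU
  obtain rfl := hi.unique (hr.isLeast R.tableIn hj₀)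
  obtain ⟨-, f, hf, h1, h2, h3⟩ := (insertAt_spec (n - j₀) R.cells j₀ r le_rfl hj₀ R.tableIn
    R.reducedTable hr.openAt).2 _ hU
  refine ⟨f, by omega, fun j hj => h1 j (by omega), fun j hj hkj => ?_⟩
  rcases Nat.lt_or_ge j₀ j with h4 | h4
  · rw [exchangeInto_of_ne (by omega)]
    exact h3 j h4 hj
  · obtain rfl : j = j₀ := by omega
    rw [exchangeInto_self rfl, h2, hf]
    exact .start hr

/-- The algorithm ends by `insertAt_spec`. Its output is an rc-graph because row steps keep every
row reduced and reduced rows exclude the forbidden crossings. -/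
theorem exists_insertLetter (R : RCGraph n) (hk : 1 ≤ k ∧ k ≤ n) :
    ∃ U : RCGraph n, R.InsertLetter k U := by
  obtain ⟨j₀, rfl⟩ : ∃ j, k = j + 1 := ⟨k - 1, by omega⟩
  have hj₀ : j₀ < n := by omega
  obtain ⟨r, hr⟩ := (R.reducedTable j₀ hj₀).exists_isBlock_true
  obtain ⟨⟨U, hU⟩, hspec⟩ := insertAt_spec (n - j₀) R.cells j₀ r le_rfl hj₀ R.tableIn
    R.reducedTable hr.openAt
  obtain ⟨hin, f, hf, h1, h2, h3⟩ := hspec U hU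
  have hrows : InsertRows n R.cells (j₀ + 1) U f := by
    refine ⟨by omega, fun j hj => h1 j (by omega), fun j hj hkj => ?_⟩
    rcases Nat.lt_or_ge j₀ j with h4 | h4
    · rw [exchangeInto_of_ne (by omega)]
      exact h3 j h4 hj
    · obtain rfl : j = j₀ := by omega
      rw [exchangeInto_self rfl, h2, hf]
      exact .start hr
  have hred := hrows.reducedTable R.reducedTable
  have hpos : ∀ c ∈ U, 0 < c.2 := fun c hc => (hin c hc).2.1
  refine ⟨⟨U, fun c hc => ⟨(hin c hc).1, (hin c hc).2.2⟩, hred.noDoubleCrossing hpos,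
    hred.nonpos_not_cross hpos⟩, (n : ℤ) - r, ?_, ?_⟩
  · push_cast
    exact hr.isLeast R.tableIn hj₀
  · push_cast
    exact hU

theorem ext_rows (h : ∀ j < n, rowCells n S.cells (j + 1) = rowCells n U.cells (j + 1)) :
    S = U :=
  RCGraph.ext (S.tableIn.ext U.tableIn h)

theorem InsertLetter.unique (hk : 1 ≤ k ∧ k ≤ n) (h : R.InsertLetter k S)
    (h' : R.InsertLetter k S') : S = S' := by
  obtain ⟨f, hf⟩ := h.exists_insertRows hk
  obtain ⟨f', hf'⟩ := h'.exists_insertRows hk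
  exact ext_rows fun j hj => (hf.congr_below hf' R.reducedTable (n + 1) (fun _ _ => rfl) hj
    (by omega)).1

theorem exists_insertWord (R : RCGraph n) (v : List ℕ) (hv : ∀ x ∈ v, 1 ≤ x ∧ x ≤ n) :
    ∃ U, R.InsertWord v U := by
  induction v generalizing R with
  | nil => exact ⟨R, rfl⟩
  | cons k v ih =>
    obtain ⟨S, hS⟩ := R.exists_insertLetter (hv k (by simp))
    obtain ⟨U, hU⟩ := ih S fun x hx => hv x (by simp [hx])
    exact ⟨U, S, hS, hU⟩

theorem InsertWord.unique {v : List ℕ} (hv : ∀ x ∈ v, 1 ≤ x ∧ x ≤ n) (h : R.InsertWord v S)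
    (h' : R.InsertWord v S') : S = S' := by
  induction v generalizing R with
  | nil => exact h.trans h'.symm
  | cons k v ih =>
    obtain ⟨T, h1, h2⟩ := h
    obtain ⟨T', h3, h4⟩ := h'
    obtain rfl := h1.unique (hv k (by simp)) h3
    exact ih (fun x hx => hv x (by simp [hx])) h2 h4

theorem insertWord_append {v w : List ℕ} :
    R.InsertWord (v ++ w) U ↔ ∃ S, R.InsertWord v S ∧ S.InsertWord w U := by
  induction v generalizing R with
  | nil => simp [InsertWord]
  | cons k v ih =>
    simp only [List.cons_append, InsertWord, ih]
    constructor
    · rintro ⟨S, h1, T, h2, h3⟩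
      exact ⟨T, ⟨S, h1, h2⟩, h3⟩
    · rintro ⟨T, ⟨S, h1, h2⟩, h3⟩
      exact ⟨S, h1, T, h2, h3⟩
end RCGraph

/-! ### Knuth equivalence -/

/-- Knuth equivalence of words. -/
inductive KnuthEquiv : List ℕ → List ℕ → Prop
  | refl (v : List ℕ) : KnuthEquiv v v
  | symm {v w : List ℕ} : KnuthEquiv v w → KnuthEquiv w v
  | trans {u v w : List ℕ} : KnuthEquiv u v → KnuthEquiv v w → KnuthEquiv u w
  | append {v w : List ℕ} (u t : List ℕ) : KnuthEquiv v w → KnuthEquiv (u ++ v ++ t) (u ++ w ++ t)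
  | first {x y z : ℕ} : x < y → y ≤ z → KnuthEquiv [y, x, z] [y, z, x]
  | last {x y z : ℕ} : x ≤ y → y < z → KnuthEquiv [z, x, y] [x, z, y]

namespace KnuthEquiv
variable {u v w : List ℕ}

theorem mem_iff (h : KnuthEquiv v w) (a : ℕ) : a ∈ v ↔ a ∈ w := by
  induction h with
  | refl => rfl
  | symm _ ih => exact ih.symm
  | trans _ _ ih1 ih2 => exact ih1.trans ih2
  | append u t _ ih => simp [ih]
  | first => simp; tauto
  | last => simp; tauto

theorem append_left (u : List ℕ) (h : KnuthEquiv v w) : KnuthEquiv (u ++ v) (u ++ w) := by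
  simpa using h.append u []

theorem append_right (t : List ℕ) (h : KnuthEquiv v w) : KnuthEquiv (v ++ t) (w ++ t) := by
  simpa using h.append [] t

/-- Since each insertion has exactly one result, in the elementary relations it is enough to show
that any two results of the two sides coincide. -/
theorem insertWord {n : ℕ} (h : KnuthEquiv v w) (hv : ∀ x ∈ v, 1 ≤ x ∧ x ≤ n)
    (R U : RCGraph n) : R.InsertWord v U ↔ R.InsertWord w U := by
  induction h generalizing R U with
  | refl => rfl
  | symm h ih => exact (ih (fun x hx => hv x ((h.mem_iff x).1 hx)) R U).symm
  | trans h1 _ ih1 ih2 =>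
    exact (ih1 hv R U).trans (ih2 (fun x hx => hv x ((h1.mem_iff x).2 hx)) R U)
  | append u t _ ih =>
    have ih' := ih fun x hx => hv x (by simp [hx])
    simp only [RCGraph.insertWord_append, ih']
  | @first x y z hxy hyz =>
    have hx := hv x (by simp)
    have hy := hv y (by simp)
    have hz := hv z (by simp)
    have key : ∀ U V, R.InsertWord [y, x, z] U → R.InsertWord [y, z, x] V → U = V := by
      rintro U V ⟨R₁, h₁, R₂, h₂, R₃, h₃, rfl⟩ ⟨S₁, k₁, S₂, k₂, S₃, k₃, rfl⟩
      obtain rfl := h₁.unique hy k₁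
      obtain ⟨f₁, h₁⟩ := h₁.exists_insertRows hy
      obtain ⟨f₂, h₂⟩ := h₂.exists_insertRows hx
      obtain ⟨f₃, h₃⟩ := h₃.exists_insertRows hz
      obtain ⟨g₂, k₂⟩ := k₂.exists_insertRows hz
      obtain ⟨g₃, k₃⟩ := k₃.exists_insertRows hx
      exact RCGraph.ext_rows (InsertRows.knuth_first hxy hyz R.reducedTable h₁ h₂ h₃ k₂ k₃)
    obtain ⟨A, hA⟩ := R.exists_insertWord [y, x, z] hv
    obtain ⟨B, hB⟩ := R.exists_insertWord [y, z, x] (by simp_all)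
    constructor
    · intro h; rw [key U B h hB]; exact hB
    · intro h; rw [← key A U hA h]; exact hA
  | @last x y z hxy hyz =>
    have hx := hv x (by simp)
    have hy := hv y (by simp)
    have hz := hv z (by simp)
    have key : ∀ U V, R.InsertWord [z, x, y] U → R.InsertWord [x, z, y] V → U = V := by
      rintro U V ⟨R₁, h₁, R₂, h₂, R₃, h₃, rfl⟩ ⟨S₁, k₁, S₂, k₂, S₃, k₃, rfl⟩
      obtain ⟨f₁, h₁⟩ := h₁.exists_insertRows hz
      obtain ⟨f₂, h₂⟩ := h₂.exists_insertRows hx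
      obtain ⟨f₃, h₃⟩ := h₃.exists_insertRows hy
      obtain ⟨g₁, k₁⟩ := k₁.exists_insertRows hx
      obtain ⟨g₂, k₂⟩ := k₂.exists_insertRows hz
      obtain ⟨g₃, k₃⟩ := k₃.exists_insertRows hy
      exact RCGraph.ext_rows (InsertRows.knuth_last hxy hyz R.reducedTable h₁ h₂ h₃ k₁ k₂ k₃)
    obtain ⟨A, hA⟩ := R.exists_insertWord [z, x, y] hv
    obtain ⟨B, hB⟩ := R.exists_insertWord [x, z, y] (by simp_all)
    constructor
    · intro h; rw [key U B h hB]; exact hB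
    · intro h; rw [← key A U hA h]; exact hA

/-! #### Row insertion -/

/-- `y b₁ ⋯ bₘ x = y x b₁ ⋯ bₘ` for `x < y ≤ b₁ ≤ ⋯ ≤ bₘ`. -/
theorem move_left {x y : ℕ} (hxy : x < y) : ∀ β : List ℕ, (∀ b ∈ β, y ≤ b) → β.Pairwise (· ≤ ·) →
    KnuthEquiv (y :: β ++ [x]) (y :: x :: β) := by
  intro β
  induction β using List.reverseRecOn with
  | nil => exact fun _ _ => .refl _
  | append_singleton β b ih =>
    intro hb hs
    have hs' := List.pairwise_append.1 hs
    have h1 := ih (fun c hc => hb c (by simp [hc])) hs'.1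
    -- the letter `c` just before `b`
    obtain ⟨γ, c, hc, hcb, hcy⟩ : ∃ γ c, y :: β = γ ++ [c] ∧ c ≤ b ∧ y ≤ c := by
      rcases List.eq_nil_or_concat β with rfl | ⟨β', c, rfl⟩
      · exact ⟨[], y, rfl, hb b (by simp), le_rfl⟩
      · exact ⟨y :: β', c, by simp, hs'.2.2 c (by simp) b (by simp), hb c (by simp)⟩
    have h2 : KnuthEquiv (y :: (β ++ [b]) ++ [x]) (y :: β ++ [x] ++ [b]) := by
      have e1 : y :: (β ++ [b]) ++ [x] = γ ++ [c, b, x] := by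
        rw [← List.cons_append, hc]; simp
      have e2 : y :: β ++ [x] ++ [b] = γ ++ [c, x, b] := by rw [hc]; simp
      rw [e1, e2]
      exact (KnuthEquiv.first (by omega) hcb).symm.append_left γ
    have h3 := h1.append_right [b]
    exact h2.trans (by simpa using h3)

/-- `a₁ ⋯ aₘ y x = y a₁ ⋯ aₘ x` for `a₁ ≤ ⋯ ≤ aₘ ≤ x < y`. -/
theorem move_right {x y : ℕ} (hxy : x < y) : ∀ α : List ℕ, (∀ a ∈ α, a ≤ x) →
    α.Pairwise (· ≤ ·) → KnuthEquiv (α ++ [y, x]) (y :: α ++ [x]) := by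
  intro α
  induction α with
  | nil => exact fun _ _ => .refl _
  | cons a α ih =>
    intro ha hs
    rw [List.pairwise_cons] at hs
    have h1 := (ih (fun c hc => ha c (by simp [hc])) hs.2).append_left [a]
    obtain ⟨c, γ, hc, hac, hcx⟩ : ∃ c γ, α ++ [x] = c :: γ ∧ a ≤ c ∧ c ≤ x := by
      rcases α with _ | ⟨c, α⟩
      · exact ⟨x, [], rfl, ha a (by simp), le_rfl⟩
      · exact ⟨c, α ++ [x], rfl, hs.1 c (by simp), ha c (by simp)⟩
    have h2 : KnuthEquiv ([a] ++ (y :: α ++ [x])) (y :: (a :: α) ++ [x]) := by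
      have e1 : [a] ++ (y :: α ++ [x]) = [a, y, c] ++ γ := by simp [hc]
      have e2 : y :: (a :: α) ++ [x] = [y, a, c] ++ γ := by simp [hc]
      rw [e1, e2]
      exact (KnuthEquiv.last hac (by omega)).symm.append_right γ
    exact (by simpa using h1 : KnuthEquiv (a :: α ++ [y, x]) ([a] ++ (y :: α ++ [x]))).trans h2

/-- First `x` travels left through `β` to the place behind `y`, then `y` travels left through `α`.
-/
theorem bump {x y : ℕ} (hxy : x < y) (α β : List ℕ) (hα : ∀ a ∈ α, a ≤ x) (hβ : ∀ b ∈ β, y ≤ b)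
    (hαs : α.Pairwise (· ≤ ·)) (hβs : β.Pairwise (· ≤ ·)) :
    KnuthEquiv (α ++ y :: β ++ [x]) (y :: (α ++ x :: β)) := by
  have h1 := (move_left hxy β hβ hβs).append_left α
  have h2 := (move_right hxy α hα hαs).append_right β
  have h3 : KnuthEquiv (α ++ y :: β ++ [x]) (α ++ [y, x] ++ β) := by simpa using h1
  exact h3.trans (by simpa using h2)

/-- Rows are read from the bottom up. The bumped entry, moved to the front of the word of its row,
therefore stands at the end of the word of the lower rows, which is where its own insertion begins.
-/
theorem schenstedInsert (x : ℕ) (T : List (List ℕ)) (hT : ∀ r ∈ T, r.Pairwise (· ≤ ·)) :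
    KnuthEquiv (T.reverse.flatten ++ [x]) (schenstedInsert x T).reverse.flatten := by
  induction T generalizing x with
  | nil => exact .refl _
  | cons r T ih =>
    have hr := hT r (by simp)
    obtain ⟨hlt, hgt⟩ := getD_findIdx_spec x r
    rw [_root_.schenstedInsert]
    split_ifs with h
    · have hgt := hgt h
      generalize List.findIdx (fun y => decide (x < y)) r = p at h hlt hgt ⊢
      have hsplit : r = r.take p ++ r[p] :: r.drop (p + 1) := by simp
      have hset : r.set p x = r.take p ++ x :: r.drop (p + 1) := List.set_eq_take_append_cons_drop .. |>.trans (by simp [h])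
      have hr' := hr
      rw [hsplit, List.pairwise_append, List.pairwise_cons] at hr'
      have hb := bump hgt (r.take p) (r.drop (p + 1)) (fun a ha => by
        obtain ⟨i, hi, rfl⟩ := List.mem_take_iff_getElem.1 ha
        have := hlt i (by omega)
        rwa [List.getD_eq_getElem _ _ (by omega)] at this) hr'.2.1.1 hr'.1 hr'.2.1.2
      rw [← hsplit, ← hset] at hb
      have h1 := hb.append_left T.reverse.flatten
      have h2 := (ih r[p] fun s hs => hT s (by simp [hs])).append_right (r.set p x)
      have h3 : KnuthEquiv ((r :: T).reverse.flatten ++ [x])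
          (T.reverse.flatten ++ [r[p]] ++ r.set p x) := by simpa using h1
      exact h3.trans (by simpa using h2)
    · simpa using KnuthEquiv.refl _
end KnuthEquiv

/-! ### Knuth equivalence of tableau words, and the conclusion. -/

theorem IsTableauRows.pairwise {n : ℕ} {T : List (List ℕ)} (hT : IsTableauRows n T) :
    ∀ r ∈ T, r.Pairwise (· ≤ ·) := by
  intro r hr
  obtain ⟨i, hi, rfl⟩ := List.getElem_of_mem hr
  have h := (hT.row T i hi).2.1
  rw [List.getD_eq_getElem _ _ hi] at h
  rw [List.pairwise_iff_getElem]
  intro a b ha hb hab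
  have := h a b hab.le hb
  rwa [List.getD_eq_getElem _ _ ha, List.getD_eq_getElem _ _ hb] at this

theorem KnuthEquiv.foldl_schenstedInsert {n : ℕ} (v : List ℕ) (hv : ∀ x ∈ v, 1 ≤ x ∧ x ≤ n) :
    ∀ T : List (List ℕ), IsTableauRows n T → KnuthEquiv (T.reverse.flatten ++ v)
      (v.foldl (fun T x => _root_.schenstedInsert x T) T).reverse.flatten := by
  induction v with
  | nil => intro T _; simpa using KnuthEquiv.refl _
  | cons x v ih =>
    intro T hT
    have h1 := (KnuthEquiv.schenstedInsert x T hT.pairwise).append_right v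
    have h2 := ih (fun y hy => hv y (by simp [hy])) _ (hT.schenstedInsert T x (hv x (by simp)))
    exact (by simpa using h1 : KnuthEquiv (T.reverse.flatten ++ x :: v) _).trans h2

theorem YoungTableau.knuthEquiv_word {n : ℕ} (Y₁ Y₂ : YoungTableau n) :
    KnuthEquiv (Y₁.word ++ Y₂.word) (Y₁.insertTableau Y₂).word := by
  rw [YoungTableau.word, YoungTableau.word, YoungTableau.insertTableau,
    YoungTableau.word, YoungTableau.rows_ofRows]
  exact KnuthEquiv.foldl_schenstedInsert Y₂.word Y₂.mem_word _ Y₁.isTableauRows_rows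

/-- `R ← (Y₁ ← Y₂) = (R ← Y₁) ← Y₂`: all the insertions have exactly one result, and the results
of the two sides are the same rc-graph. -/
theorem corollary4p5 (n : ℕ) (R : RCGraph n) (Y₁ Y₂ : YoungTableau n) :
    ∃ R₁ U : RCGraph n,
      (∀ S : RCGraph n, R.InsertTableau Y₁ S ↔ S = R₁) ∧
      (∀ S : RCGraph n, R₁.InsertTableau Y₂ S ↔ S = U) ∧
      (∀ S : RCGraph n, R.InsertTableau (Y₁.insertTableau Y₂) S ↔ S = U) := by
  obtain ⟨R₁, h₁⟩ := R.exists_insertWord Y₁.word Y₁.mem_word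
  obtain ⟨U, h₂⟩ := R₁.exists_insertWord Y₂.word Y₂.mem_word
  have hmem : ∀ x ∈ Y₁.word ++ Y₂.word, 1 ≤ x ∧ x ≤ n := by
    intro x hx
    rcases List.mem_append.1 hx with hx | hx
    · exact Y₁.mem_word x hx
    · exact Y₂.mem_word x hx
  have h₃ : R.InsertTableau (Y₁.insertTableau Y₂) U :=
    ((Y₁.knuthEquiv_word Y₂).insertWord hmem R U).1 (RCGraph.insertWord_append.2 ⟨R₁, h₁, h₂⟩)
  refine ⟨R₁, U, fun S => ⟨fun h => h.unique Y₁.mem_word h₁, ?_⟩,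
    fun S => ⟨fun h => h.unique Y₂.mem_word h₂, ?_⟩,
    fun S => ⟨fun h => h.unique (Y₁.insertTableau Y₂).mem_word h₃, ?_⟩⟩
  · rintro rfl; exact h₁
  · rintro rfl; exact h₂
  · rintro rfl; exact h₃
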